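/- Let $N>2$ be divisible by $4$, and let $\nu$ be a probability distribution supported on $\{3,5,\dots,N-3\}$. Consider the Markov chain on $\{0,\dots,N\}$ with symmetric random redistribution ($\nu_0=\nu_N=\nu$), whose transition function is $$p(x,y)=\begin{cases}\tfrac12 & x=y,\\ \tfrac14 & |x-y|=1,\\ \tfrac14\,\nu(y) & x\in\{0,N\},\ |x-y|>1,\\ 0&\text{otherwise.}\end{cases}$$ Let $\rho$ be the largest even number that is at most the distance from the support of $\nu$ to $\{0,N\}$. A coupling started from $(x,y)$ is a process $(X_n,Y_n)_{n\ge 0}$ with $X_0=x$, $Y_0=y$, such that $X$ and $Y$ are each Markov chains with transition function $p$ and such that $X_n=Y_n$ implies $X_k=Y_k$ for all $k\ge n$; the pair $(X,Y)$ is not required to be Markovian. Its coupling time is $\tau=\inf\{t:X_t=Y_t\}$. For $L\ge1$ let $T(L)$ be the exit time from $\{1,\dots,L\}$ of the lazy random walk on $\mathbb Z$ (it stays put with probability $\frac12$ and steps to each neighbour with probability $\frac14$) started from $\lfloor (L+1)/2\rfloor$, and let $\lambda(L)=\frac12\left(\cos\frac{\pi}{L+1}+1\right)$. **Theorem.** (1)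 If $0\le x<y\le N$ and $y-x$ is even with $y-x\le\rho$, then there is a coupling started from $(x,y)$ whose coupling time $\tau$ is stochastically dominated by the sum of at most $5$ independent copies of $T(N/2)$: for some $m\le5$ and i.i.d. copies $T_1,\dots,T_m$ of $T(N/2)$, $P(\tau>t)\le P(T_1+\dots+T_m>t)$ for all $t\in\mathbb Z_+$. (2) The rate of convergence is $\lambda(N/2)$, independently of $\nu$: if $d_t=\max_{x,y}\max_{A\subseteq\{0,\dots,N\}}\left(P_x(X_t\in A)-P_y(X_t\in A)\right)$, then $\lim_{t\to\infty}\frac1t\ln d_t=\ln\lambda(N/2)$. -/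

import Mathlib

open MeasureTheory Filter Topology

namespace RWRedistribution

/-- The state space `{0, …, N}`. -/
abbrev State (N : ℕ) : Type := Fin (N + 1)

/-- The transition function of the lazy nearest neighbour walk on `{0, …, N}` with redistribution:
stay put with probability `1/2`, move to each neighbour with probability `1/4`, and with
probability `1/4` jump from `0` according to `ν₀` and from `N` according to `νN`. -/
noncomputable def trans (N : ℕ) (ν₀ νN : PMF (State N)) : Matrix (State N) (State N) ℝ :=
  fun x y =>
    if x = y then 1 / 2
    else if |((y : ℕ) : ℤ) - ((x : ℕ) : ℤ)| = 1 then 1 / 4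
    else if (x : ℕ) = 0 then 1 / 4 * (ν₀ y).toReal
    else if (x : ℕ) = N then 1 / 4 * (νN y).toReal
    else 0

/-- The parity assumption on a redistribution measure:
it is supported on `{3, 5, …, N - 3}` (used with `N` divisible by `4`). -/
def ParitySupport (N : ℕ) (ν : PMF (State N)) : Prop :=
  ∀ z ∈ ν.support, Odd (z : ℕ) ∧ 3 ≤ (z : ℕ) ∧ (z : ℕ) + 3 ≤ N

/-- `ρ`: the largest even number which is at most the distance from the union of the supports of
`ν₀` and `νN` to `{0, N}`. -/
noncomputable def rho (N : ℕ) (ν₀ νN : PMF (State N)) : ℕ :=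
  2 * (sInf {k : ℕ | ∃ z : State N, (z ∈ ν₀.support ∨ z ∈ νN.support) ∧
    k = min (z : ℕ) (N - (z : ℕ))} / 2)

/-- `X` is a Markov chain (with respect to its own filtration) with transition matrix `p` and
initial state `x`, under the probability measure `μ`. -/
structure IsMarkovChain {S Ω : Type} [MeasurableSpace S] [MeasurableSpace Ω]
    (μ : Measure Ω) (p : Matrix S S ℝ) (x : S) (X : ℕ → Ω → S) : Prop where
  measurable : ∀ n, Measurable (X n)
  init : ∀ᵐ ω ∂μ, X 0 ω = x
  markov : ∀ (n : ℕ) (a : ℕ → S),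
    μ.real {ω | ∀ i ≤ n + 1, X i ω = a i} = μ.real {ω | ∀ i ≤ n, X i ω = a i} * p (a n) (a (n + 1))

/-- `(X, Y)` is a (coalescing) coupling of the chains with transition matrix `p` started from `x`
and `y`. Nothing is required of the pair `(X, Y)` beyond the two marginal laws and coalescence;
in particular the pair need not be Markovian. -/
structure IsCoupling {S Ω : Type} [MeasurableSpace S] [MeasurableSpace Ω]
    (μ : Measure Ω) (p : Matrix S S ℝ) (x y : S) (X Y : ℕ → Ω → S) : Prop where
  left : IsMarkovChain μ p x X
  right : IsMarkovChain μ p y Y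
  coalescing : ∀ᵐ ω ∂μ, ∀ n, X n ω = Y n ω → ∀ k, n ≤ k → X k ω = Y k ω

/-- The coupling time `τ = inf {t : X_t = Y_t}`, with `inf ∅ = ∞`. -/
noncomputable def couplingTime {S Ω : Type} (X Y : ℕ → Ω → S) (ω : Ω) : ℕ∞ :=
  ⨅ (t : ℕ) (_ : X t ω = Y t ω), (t : ℕ∞)

/-- The law of one step of the lazy walk on `ℤ`. -/
noncomputable def stepLaw : Measure ℤ :=
  (2⁻¹ : ENNReal) • Measure.dirac 0 + (4⁻¹ : ENNReal) • Measure.dirac 1 +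
    (4⁻¹ : ENNReal) • Measure.dirac (-1)

instance : IsProbabilityMeasure stepLaw := by
  constructor
  have h : (4 : ENNReal)⁻¹ = 2⁻¹ * 2⁻¹ := by
    rw [← ENNReal.mul_inv (Or.inl two_ne_zero) (Or.inl ENNReal.ofNat_ne_top)]
    norm_num
  simp only [stepLaw, Measure.coe_add, Measure.coe_smul, Pi.add_apply, Pi.smul_apply,
    measure_univ, smul_eq_mul, mul_one]
  rw [h, add_assoc, ← mul_add, ENNReal.inv_two_add_inv_two, mul_one, ENNReal.inv_two_add_inv_two]

/-- The lazy walk on `ℤ` started from `z`, as a function of its sequence of steps. -/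
def walk (z : ℤ) (ξ : ℕ → ℤ) (n : ℕ) : ℤ := z + ∑ k ∈ Finset.range n, ξ k

/-- `T(L)`: the exit time from `{1, …, L}` of the lazy walk started from `⌊(L + 1) / 2⌋`,
as a function of the steps of the walk. -/
noncomputable def exitTime (L : ℕ) (ξ : ℕ → ℤ) : ℕ∞ :=
  ⨅ (n : ℕ) (_ : walk (((L + 1) / 2 : ℕ) : ℤ) ξ n ∉ Set.Icc (1 : ℤ) (L : ℤ)), (n : ℕ∞)

/-- The joint law of the step sequences of `m` independent lazy walks. -/
noncomputable def walksLaw (m : ℕ) : Measure (Fin m → ℕ → ℤ) :=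
  Measure.pi fun _ => Measure.infinitePi fun _ => stepLaw

/-- The random time `τ` is stochastically dominated by the sum of `m` independent copies
of `T(L)`. -/
def DominatedByCopies {Ω : Type} [MeasurableSpace Ω] (μ : Measure Ω) (τ : Ω → ℕ∞)
    (m L : ℕ) : Prop :=
  ∀ t : ℕ, μ {ω | (t : ℕ∞) < τ ω} ≤
    walksLaw m {ξ | (t : ℕ∞) < ∑ i, exitTime L (ξ i)}

/-- The total variation distance `max_A (P_x (X_t ∈ A) - P_y (X_t ∈ A))`, where
`P_x (X_t ∈ A) = ∑ z ∈ A, (p ^ t) x z`. -/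
noncomputable def tvDist {N : ℕ} (p : Matrix (State N) (State N) ℝ) (t : ℕ) (x y : State N) : ℝ :=
  ⨆ A : Finset (State N), (∑ z ∈ A, (p ^ t) x z - ∑ z ∈ A, (p ^ t) y z)

/-- `d_t = max_{x, y} d_t(x, y)`. -/
noncomputable def maxTvDist {N : ℕ} (p : Matrix (State N) (State N) ℝ) (t : ℕ) : ℝ :=
  ⨆ x : State N, ⨆ y : State N, tvDist p t x y

/-- `λ(L) = (cos (π / (L + 1)) + 1) / 2`. -/
noncomputable def lam (L : ℕ) : ℝ := 1 / 2 * (Real.cos (Real.pi / ((L : ℝ) + 1)) + 1)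

end RWRedistribution

namespace RWRedistribution

open Polynomial

/-! ### Sequences acted upon by polynomials in a shift operator -/

/-! Write `N = 4m` and `P = (1 + A) / 2`, where `A` averages the two neighbours and both outer
points `-1`, `N + 1` carry the `ν`-mean of the function. The central estimate is `heat_sub_le`: if
`0 ≤ f ≤ 1` and `x`, `y` have the same parity, then `P^t f x - P^t f y ≤ P(T₁ + T₂ + T₃ > t)` for
independent copies of `T(2m)`. A maximal coupling (`exists_coupling`) turns this bound on total
variation into the bound on the coupling time, with three copies.

Split `P^t f` by reflection in the centre. The antisymmetric part vanishes at the centre and agrees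
at the outer points, so it is controlled by a lazy walk killed outside `{1, …, 2m}`: one exit time.
On symmetric functions, Chebyshev polynomials of the first kind in `A`, evaluated at the centre,
read off values at a given distance, so `H = ∑ ν(z) T_{d(z)} - T_{2m+1}` annihilates them. The
parity assumption gives `H = 2 (1 - X²) R` with `R` of degree at most `2m - 1`. Since `A² g = g`
forces `g` to be constant on parity classes, `R(A)` equalises the symmetric part. Hence `R(A) P^t f`
differs between `x` and `y` by at most `R(1) P(T > t)`.

To undo `R`, note that `A` acts on `t ↦ P^t f` as `shiftOp`. The polynomial `R` is the top rung of a
ladder with nonnegative nearest neighbour recursion (`exists_isLadder`) whose rungs are nonnegative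
combinations of the `U_j`, and `U_j(A)` is positive. A comparison principle (`IsLadder.aeval_le`)
bounds the difference by the solution of the corresponding scalar recursion. Because `R` has real
roots `r_i` in `[-1, 1]`, that solution is the survival function of `T` plus independent geometric
times with failure probabilities `(1 + r_i) / 2`. Sign alternation gives `r_i ≤ cos ((i + 1) π / (2m
+ 1))`, while `T` itself is a sum of `m` geometric times with parameters `cos ((2i + 1) π / (2m +
1))`. So the roots, taken in pairs, are dominated by two further copies of `T`.

For the rate, the survival function of `T₁ + T₂ + T₃` is `O(ρ^t)` for every `ρ > λ`, and the two
parity classes are linked in one step because `ν` lives on odd points while `0` is even. An explicit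
trigonometric eigenfunction with eigenvalue `λ` gives the lower bound. -/

/-- The operator `w ↦ 2 w (· + 1) - w` on sequences. -/
noncomputable def shiftOp : Module.End ℝ (ℕ → ℝ) where
  toFun w t := 2 * w (t + 1) - w t
  map_add' u v := by ext t; simp only [Pi.add_apply]; ring
  map_smul' a v := by ext t; simp only [Pi.smul_apply, smul_eq_mul, RingHom.id_apply]; ring

theorem shiftOp_apply (w : ℕ → ℝ) (t : ℕ) : shiftOp w t = 2 * w (t + 1) - w t := rfl

theorem aeval_shiftOp_succ (p : ℝ[X]) (w : ℕ → ℝ) (t : ℕ) :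
    aeval shiftOp p w (t + 1) = (aeval shiftOp p w t + aeval shiftOp (X * p) w t) / 2 := by
  rw [map_mul, aeval_X, Module.End.mul_apply, shiftOp_apply]
  ring

theorem pow_shiftOp_eq_one {w : ℕ → ℝ} {d : ℕ} (hw : ∀ t ≤ d, w t = 1) (j : ℕ) :
    ∀ t, t + j ≤ d → (shiftOp ^ j) w t = 1 := by
  induction j with
  | zero => intro t ht; simpa using hw t (by omega)
  | succ j ih =>
    intro t ht
    rw [pow_succ', Module.End.mul_apply, shiftOp_apply, ih t (by omega), ih (t + 1) (by omega)]
    norm_num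

theorem aeval_shiftOp_zero {w : ℕ → ℝ} {d : ℕ} (hw : ∀ t ≤ d, w t = 1) {p : ℝ[X]}
    (hp : p.natDegree ≤ d) : aeval shiftOp p w 0 = p.eval 1 := by
  rw [aeval_eq_sum_range, eval_eq_sum_range, LinearMap.sum_apply, Finset.sum_apply]
  refine Finset.sum_congr rfl fun j hj => ?_
  rw [LinearMap.smul_apply, Pi.smul_apply,
    pow_shiftOp_eq_one hw j 0 (by have := Finset.mem_range.1 hj; omega)]
  simp

/-- A finite family of polynomials on which multiplication by `X` acts as a nearest neighbour
matrix with nonnegative entries. -/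
def IsLadder (n : ℕ) (p : ℕ → ℝ[X]) : Prop :=
  ∀ i < n, ∃ a b : ℝ, 0 ≤ a ∧ 0 ≤ b ∧ X * p i = a • p (i + 1) + b • p (i - 1)

/-- Comparison principle, by induction on time: the value of a rung at `t + 1` is a nonnegative
combination of it and its neighbours at `t`, so only the top rung has to be controlled at all times.
At the bottom, `i - 1 = 0` lets rung `0` feed on itself. -/
theorem IsLadder.aeval_le {n : ℕ} {p : ℕ → ℝ[X]} (hp : IsLadder n p) {y w : ℕ → ℝ}
    (h0 : ∀ i < n, aeval shiftOp (p i) y 0 ≤ aeval shiftOp (p i) w 0)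
    (hn : ∀ t, aeval shiftOp (p n) y t ≤ aeval shiftOp (p n) w t) :
    ∀ t, ∀ i ≤ n, aeval shiftOp (p i) y t ≤ aeval shiftOp (p i) w t := by
  intro t
  induction t with
  | zero =>
    intro i hi
    rcases hi.lt_or_eq with h | rfl
    · exact h0 i h
    · exact hn 0
  | succ t ih =>
    intro i hi
    rcases hi.lt_or_eq with h | rfl
    · obtain ⟨a, b, ha, hb, hab⟩ := hp i h
      rw [aeval_shiftOp_succ, aeval_shiftOp_succ, hab]
      simp only [map_add, map_smul, LinearMap.add_apply, LinearMap.smul_apply, Pi.add_apply,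
        Pi.smul_apply, smul_eq_mul]
      have h1 := mul_le_mul_of_nonneg_left (ih (i + 1) (by omega)) ha
      have h2 := mul_le_mul_of_nonneg_left (ih (i - 1) (by omega)) hb
      have h3 := ih i hi
      linarith
    · exact hn (t + 1)

/-! ### Adding independent geometric times -/

/-- If `q t = P(σ > t)`, then `geoAdd c q t = P(σ + τ > t)`, where `τ` is a geometric time with
failure probability `(1 + c) / 2`, independent of `σ`. -/
noncomputable def geoAdd (c : ℝ) (q : ℕ → ℝ) : ℕ → ℝ
  | 0 => 1
  | t + 1 => (1 + c) / 2 * geoAdd c q t + (1 - c) / 2 * q t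

/-- Successive application of `geoAdd (c i)`, `i < k`. -/
noncomputable def geoAdds (c : ℕ → ℝ) : ℕ → (ℕ → ℝ) → ℕ → ℝ
  | 0, q => q
  | k + 1, q => geoAdd (c k) (geoAdds c k q)

/-- Adding a geometric time inverts the linear factor `X - c` up to the constant `1 - c`; this is
how real roots become independent geometric times. -/
theorem aeval_geoAdd (c : ℝ) (q : ℕ → ℝ) :
    aeval shiftOp (X - C c) (geoAdd c q) = (1 - c) • q := by
  ext t
  simp only [map_sub, aeval_X, aeval_C, LinearMap.sub_apply, Pi.sub_apply, shiftOp_apply,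
    Module.algebraMap_end_apply, Pi.smul_apply, smul_eq_mul, geoAdd]
  ring

theorem aeval_geoAdds (c : ℕ → ℝ) (k : ℕ) (q : ℕ → ℝ) :
    aeval shiftOp (∏ i ∈ Finset.range k, (X - C (c i))) (geoAdds c k q) =
      (∏ i ∈ Finset.range k, (1 - c i)) • q := by
  induction k with
  | zero => simp [geoAdds]
  | succ k ih =>
    rw [Finset.prod_range_succ, map_mul, Module.End.mul_apply, geoAdds, aeval_geoAdd, map_smul,
      ih, Finset.prod_range_succ, smul_smul, mul_comm]

theorem geoAdds_eq_one (c : ℕ → ℝ) (k : ℕ) (q : ℕ → ℝ) : ∀ t < k, geoAdds c k q t = 1 := by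
  induction k with
  | zero => intro t ht; omega
  | succ k ih =>
    intro t ht
    rw [geoAdds]
    induction t with
    | zero => rfl
    | succ t iht =>
      rw [geoAdd, iht (by omega), ih t (by omega)]
      ring

/-- The survival functions: antitone with values in `[0, 1]`. -/
structure IsSurvival (q : ℕ → ℝ) : Prop where
  anti : ∀ t, q (t + 1) ≤ q t
  nonneg : ∀ t, 0 ≤ q t
  le_one : ∀ t, q t ≤ 1

theorem isSurvival_zero : IsSurvival 0 := ⟨fun _ => le_rfl, fun _ => le_rfl, fun _ => zero_le_one⟩

theorem IsSurvival.le_geoAdd {q : ℕ → ℝ} (hq : IsSurvival q) {c : ℝ} (hc : c ∈ Set.Icc (-1 : ℝ) 1)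
    (t : ℕ) : q t ≤ geoAdd c q t := by
  obtain ⟨h1, h2⟩ := hc
  induction t with
  | zero => exact hq.le_one 0
  | succ t ih =>
    rw [geoAdd]
    have := hq.anti t
    nlinarith

theorem IsSurvival.geoAdd {q : ℕ → ℝ} (hq : IsSurvival q) {c : ℝ}
    (hc : c ∈ Set.Icc (-1 : ℝ) 1) : IsSurvival (geoAdd c q) := by
  have hle := hq.le_geoAdd hc
  obtain ⟨h1, h2⟩ := hc
  have anti : ∀ t, RWRedistribution.geoAdd c q (t + 1) ≤ RWRedistribution.geoAdd c q t := by
    intro t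
    rw [RWRedistribution.geoAdd]
    have := hle t
    nlinarith
  refine ⟨anti, fun t => (hq.nonneg t).trans (hle t), fun t => ?_⟩
  induction t with
  | zero => exact le_rfl
  | succ t ih => exact (anti t).trans ih

theorem IsSurvival.geoAdds {q : ℕ → ℝ} (hq : IsSurvival q) {c : ℕ → ℝ} (k : ℕ)
    (hc : ∀ i < k, c i ∈ Set.Icc (-1 : ℝ) 1) : IsSurvival (geoAdds c k q) := by
  induction k with
  | zero => exact hq
  | succ k ih => exact (ih fun i hi => hc i (by omega)).geoAdd (hc k (by omega))

/-- Raising `c` moves weight from `q t` to `geoAdd c q t`, which is the larger of the two. -/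
theorem geoAdd_mono {q q' : ℕ → ℝ} (hq : IsSurvival q) (hqq : ∀ t, q t ≤ q' t) {c c' : ℝ}
    (hc : c ∈ Set.Icc (-1 : ℝ) 1) (hc' : c' ∈ Set.Icc (-1 : ℝ) 1) (hcc : c ≤ c') (t : ℕ) :
    geoAdd c q t ≤ geoAdd c' q' t := by
  have hle := hq.le_geoAdd hc
  obtain ⟨h1, h2⟩ := hc
  obtain ⟨h3, h4⟩ := hc'
  induction t with
  | zero => exact le_rfl
  | succ t ih =>
    rw [geoAdd, geoAdd]
    have e1 := hle t
    have e2 := hqq t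
    nlinarith [mul_nonneg (sub_nonneg.2 hcc) (sub_nonneg.2 e1),
      mul_nonneg (by linarith : 0 ≤ 1 - c') (sub_nonneg.2 e2),
      mul_nonneg (by linarith : 0 ≤ 1 + c') (sub_nonneg.2 ih)]

/-- Both orders satisfy one second-order recursion, symmetric in `a` and `b`, with the same first
two values. -/
theorem geoAdd_comm (a b : ℝ) (q : ℕ → ℝ) : geoAdd a (geoAdd b q) = geoAdd b (geoAdd a q) := by
  have key : ∀ t, geoAdd a (geoAdd b q) t = geoAdd b (geoAdd a q) t ∧
      geoAdd a (geoAdd b q) (t + 1) = geoAdd b (geoAdd a q) (t + 1) := by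
    intro t
    induction t with
    | zero => refine ⟨rfl, ?_⟩; simp only [geoAdd]; ring
    | succ t ih =>
      refine ⟨ih.2, ?_⟩
      have e1 : ∀ (a b : ℝ), geoAdd a (geoAdd b q) (t + 2) =
          ((1 + a) / 2 + (1 + b) / 2) * geoAdd a (geoAdd b q) (t + 1) -
          (1 + a) / 2 * ((1 + b) / 2) * geoAdd a (geoAdd b q) t +
          (1 - a) / 2 * ((1 - b) / 2) * q t := by
        intro a b
        simp only [geoAdd]
        ring
      rw [e1 a b, e1 b a, ih.1, ih.2]
      ring
  exact funext fun t => (key t).1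

theorem geoAdd_geoAdds_comm (a : ℝ) (c : ℕ → ℝ) (k : ℕ) (q : ℕ → ℝ) :
    geoAdd a (geoAdds c k q) = geoAdds c k (geoAdd a q) := by
  induction k with
  | zero => rfl
  | succ k ih => rw [geoAdds, geoAdds, geoAdd_comm, ih]

theorem geoAdds_two_mul_le {q : ℕ → ℝ} (hq : IsSurvival q) {c d : ℕ → ℝ} (k : ℕ)
    (hc : ∀ i < 2 * k, c i ∈ Set.Icc (-1 : ℝ) 1) (hd : ∀ i < k, d i ∈ Set.Icc (-1 : ℝ) 1)
    (h : ∀ i < k, c (2 * i) ≤ d i ∧ c (2 * i + 1) ≤ d i) (t : ℕ) :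
    geoAdds c (2 * k) q t ≤ geoAdds d k (geoAdds d k q) t := by
  induction k generalizing t with
  | zero => exact le_rfl
  | succ k ih =>
    have hs := hq.geoAdds (2 * k) fun i hi => hc i (by omega)
    have e : geoAdds d (k + 1) (geoAdds d (k + 1) q) =
        geoAdd (d k) (geoAdd (d k) (geoAdds d k (geoAdds d k q))) := by
      simp only [geoAdds]
      rw [← geoAdd_geoAdds_comm]
    rw [e, show 2 * (k + 1) = 2 * k + 1 + 1 by ring, geoAdds, geoAdds]
    refine geoAdd_mono (hs.geoAdd (hc _ (by omega))) (fun t => ?_) (hc _ (by omega))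
      (hd _ (by omega)) (h k (by omega)).2 t
    exact geoAdd_mono hs (ih (fun i hi => hc i (by omega)) (fun i hi => hd i (by omega))
      fun i hi => h i (by omega)) (hc _ (by omega)) (hd _ (by omega)) (h k (by omega)).1 t

theorem geoAdd_le_pow {q : ℕ → ℝ} {c ρ K : ℝ} (hc : c ∈ Set.Icc (-1 : ℝ) 1)
    (hρ : (1 + c) / 2 < ρ) (hq : ∀ t, q t ≤ K * ρ ^ t) :
    ∃ K', ∀ t, geoAdd c q t ≤ K' * ρ ^ t := by
  obtain ⟨h1, h2⟩ := hc
  have hρ0 : 0 < ρ := by linarith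
  -- The constant makes `K' * ρ ^ t` a supersolution of the recursion; the `1` covers time `0`.
  refine ⟨max 1 ((1 - c) / 2 * K / (ρ - (1 + c) / 2)), fun t => ?_⟩
  set K' := max 1 ((1 - c) / 2 * K / (ρ - (1 + c) / 2)) with hK'
  have hK : (1 - c) / 2 * K ≤ K' * (ρ - (1 + c) / 2) := by
    rw [← div_le_iff₀ (by linarith)]
    exact le_max_right _ _
  induction t with
  | zero =>
    have h : 1 ≤ K' := le_max_left _ _
    simpa [geoAdd] using h
  | succ t ih =>
    rw [geoAdd, pow_succ]
    have e1 := mul_le_mul_of_nonneg_left ih (by linarith : 0 ≤ (1 + c) / 2)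
    have e2 := mul_le_mul_of_nonneg_left (hq t) (by linarith : 0 ≤ (1 - c) / 2)
    have e3 := mul_le_mul_of_nonneg_right hK (pow_nonneg hρ0.le t)
    linarith

theorem geoAdds_le_pow {q : ℕ → ℝ} {c : ℕ → ℝ} {ρ : ℝ} (k : ℕ)
    (hc : ∀ i < k, c i ∈ Set.Icc (-1 : ℝ) 1) (hρ : ∀ i < k, (1 + c i) / 2 < ρ)
    (hq : ∃ K, ∀ t, q t ≤ K * ρ ^ t) :
    ∃ K, ∀ t, geoAdds c k q t ≤ K * ρ ^ t := by
  induction k with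
  | zero => exact hq
  | succ k ih =>
    obtain ⟨K, hK⟩ := ih (fun i hi => hc i (by omega)) fun i hi => hρ i (by omega)
    exact geoAdd_le_pow (hc k (by omega)) (hρ k (by omega)) hK

/-! ### Roots of polynomials with alternating signs -/

/-- Split off the greatest root in the first interval and induct on the quotient. The signs are only
weak, so a root may sit at a shared endpoint; choosing the greatest one preserves the sign of the
quotient there. -/
theorem exists_roots_of_alternating (n : ℕ) (p : ℝ[X]) (hp : p.natDegree ≤ n) (x : ℕ → ℝ)
    (hx : ∀ i < n, x (i + 1) < x i) (hs : ∀ i ≤ n, 0 ≤ (-1) ^ i * p.eval (x i)) :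
    ∃ (a : ℝ) (r : ℕ → ℝ), (∀ i < n, x (i + 1) ≤ r i ∧ r i ≤ x i) ∧
      p = C a * ∏ i ∈ Finset.range n, (X - C (r i)) := by
  induction n generalizing p x with
  | zero => exact ⟨p.coeff 0, 0, by simp, by simpa using eq_C_of_natDegree_le_zero hp⟩
  | succ n ih =>
    have h10 : x 1 < x 0 := hx 0 (by omega)
    have hs0 : 0 ≤ p.eval (x 0) := by simpa using hs 0 (by omega)
    have hs1 : p.eval (x 1) ≤ 0 := by simpa using hs 1 (by omega)
    set Z : Set ℝ := Set.Icc (x 1) (x 0) ∩ {s | p.eval s = 0} with hZ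
    have hZc : IsCompact Z :=
      isCompact_Icc.inter_right (isClosed_eq p.continuous continuous_const)
    have hZn : Z.Nonempty := by
      obtain ⟨s, hs, hs'⟩ := intermediate_value_Icc h10.le p.continuous.continuousOn ⟨hs1, hs0⟩
      exact ⟨s, hs, hs'⟩
    obtain ⟨r, ⟨hrI, hr0⟩, hrmax⟩ := hZc.exists_isGreatest hZn
    obtain ⟨p', hp'⟩ := dvd_iff_isRoot.2 (show p.IsRoot r from hr0)
    have hev : ∀ s, p.eval s = (s - r) * p'.eval s := fun s => by rw [hp']; simp
    have hdeg : p'.natDegree ≤ n := by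
      by_cases h0 : p' = 0
      · simp [h0]
      · rw [hp', natDegree_mul (X_sub_C_ne_zero r) h0, natDegree_X_sub_C] at hp
        omega
    obtain ⟨a, r', hr', hpr'⟩ := ih p' hdeg (fun i => x (i + 1)) (fun i hi => hx (i + 1) (by omega))
      (by
        have anti : ∀ i ≤ n, x (i + 1) ≤ x 1 := by
          intro i
          induction i with
          | zero => intro _; exact le_rfl
          | succ i ihi => intro hi; exact (hx (i + 1) (by omega)).le.trans (ihi (by omega))
        intro i hi
        rcases (hrI.1.trans' (anti i hi)).lt_or_eq with hlt | heq
        · have := hs (i + 1) (by omega)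
          rw [hev, pow_succ] at this
          have h2 : 0 ≤ (r - x (i + 1)) * ((-1) ^ i * p'.eval (x (i + 1))) := by linarith
          exact nonneg_of_mul_nonneg_right h2 (by linarith)
        · have hi0 : i = 0 := by
            by_contra h
            have : x (i + 1) < x 1 := by
              obtain ⟨j, rfl⟩ := Nat.exists_eq_succ_of_ne_zero h
              exact (hx (j + 1) (by omega)).trans_le (anti j (by omega))
            linarith [hrI.1]
          subst hi0
          -- The root is at `x 1`, so `p` says nothing about the sign of `p'` there. Were it
          -- negative, `p'` would vanish further right in the interval, against maximality of `r`.
          by_contra hneg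
          simp only [pow_zero, one_mul, not_le] at hneg
          have h0' : 0 ≤ p'.eval (x 0) := by
            rw [hev] at hs0
            exact nonneg_of_mul_nonneg_right hs0 (by linarith)
          obtain ⟨s, hsI, hs'⟩ := intermediate_value_Icc h10.le p'.continuous.continuousOn
            ⟨hneg.le, h0'⟩
          have hsZ : s ∈ Z :=
            ⟨hsI, by change p.eval s = 0; rw [hev, show p'.eval s = 0 from hs', mul_zero]⟩
          have hsr := hrmax hsZ
          have : s = x 1 := le_antisymm (by linarith) hsI.1
          rw [this] at hs'
          simp only [zero_add] at hneg
          linarith)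
    refine ⟨a, fun i => if i = 0 then r else r' (i - 1), fun i hi => ?_, ?_⟩
    · rcases i with _ | i
      · exact hrI
      · simpa using hr' i (by omega)
    · rw [Finset.prod_range_succ', hp', hpr']
      simp only [Nat.add_eq_zero_iff, one_ne_zero, and_false, if_false, Nat.add_sub_cancel, if_true]
      ring

end RWRedistribution

namespace RWRedistribution

open Polynomial

/-! ### Chebyshev ladders -/

open Chebyshev in
/-- The combination `∑ l ≤ r, b l * U (s - 2 l)` of Chebyshev polynomials of the second kind. -/
noncomputable def chebSum (b : ℕ → ℝ) (r : ℕ) (s : ℤ) : ℝ[X] :=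
  ∑ l ∈ Finset.range (r + 1), b l • U ℝ (s - 2 * l)

/-- Nonnegative combinations of the Chebyshev polynomials of the second kind of degree `≤ d`. -/
noncomputable def chebCone (d : ℕ) : Submodule NNReal ℝ[X] :=
  Submodule.span NNReal ((fun j : ℕ => Chebyshev.U ℝ j) '' {j | j ≤ d})

theorem U_mem_chebCone {j d : ℕ} (h : j ≤ d) : Chebyshev.U ℝ j ∈ chebCone d :=
  Submodule.subset_span ⟨j, h, rfl⟩

theorem smul_mem_chebCone {d : ℕ} {p : ℝ[X]} (hp : p ∈ chebCone d) {a : ℝ} (ha : 0 ≤ a) :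
    a • p ∈ chebCone d :=
  (chebCone d).smul_mem (⟨a, ha⟩ : NNReal) hp

theorem chebCone_mono {d e : ℕ} (h : d ≤ e) : chebCone d ≤ chebCone e :=
  Submodule.span_mono (Set.image_mono fun _ hj => le_trans hj h)

theorem natDegree_le_of_mem_chebCone {d : ℕ} {p : ℝ[X]} (hp : p ∈ chebCone d) :
    p.natDegree ≤ d := by
  induction hp using Submodule.span_induction with
  | mem x hx =>
    obtain ⟨j, hj, rfl⟩ := hx
    simpa using hj
  | zero => simp
  | add x y _ _ hx hy => exact natDegree_add_le_of_degree_le hx hy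
  | smul a x _ hx => exact (natDegree_smul_le (a : ℝ) x).trans hx

theorem X_mul_U (s : ℤ) : (X : ℝ[X]) * Chebyshev.U ℝ s =
    (2⁻¹ : ℝ) • (Chebyshev.U ℝ (s + 1) + Chebyshev.U ℝ (s - 1)) := by
  rw [Chebyshev.U_add_one, sub_add_cancel, mul_assoc, ← C_ofNat, ← smul_eq_C_mul, smul_smul]
  norm_num

theorem X_mul_chebSum (b : ℕ → ℝ) (r : ℕ) (s : ℤ) :
    X * chebSum b r s = (2⁻¹ : ℝ) • (chebSum b r (s + 1) + chebSum b r (s - 1)) := by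
  simp only [chebSum, Finset.mul_sum, ← Finset.sum_add_distrib, Finset.smul_sum, mul_smul_comm,
    X_mul_U]
  refine Finset.sum_congr rfl fun l _ => ?_
  rw [smul_comm, ← smul_add, show s - 2 * (l : ℤ) + 1 = s + 1 - 2 * l by ring,
    show s - 2 * (l : ℤ) - 1 = s - 1 - 2 * l by ring]

theorem chebSum_reflect (b : ℕ → ℝ) (r : ℕ) (s : ℤ) :
    chebSum (fun l => b (r - l)) r s = -chebSum b r (2 * r - 2 - s) := by
  rw [chebSum, chebSum, ← Finset.sum_neg_distrib, ← Finset.sum_range_reflect]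
  refine Finset.sum_congr rfl fun l hl => ?_
  have hl' : l ≤ r := by have := Finset.mem_range.1 hl; omega
  rw [show r + 1 - 1 - l = r - l by omega, Nat.sub_sub_self hl', ← smul_neg,
    ← Chebyshev.U_neg_sub_two]
  congr 2
  push_cast [hl']
  ring

theorem chebSum_congr {b b' : ℕ → ℝ} {r : ℕ} (h : ∀ l ≤ r, b l = b' l) (s : ℤ) :
    chebSum b r s = chebSum b' r s :=
  Finset.sum_congr rfl fun l hl => by rw [h l (by have := Finset.mem_range.1 hl; omega)]

theorem chebSum_succ {b : ℕ → ℝ} {r : ℕ} (h : b (r + 1) = 0) (s : ℤ) :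
    chebSum b (r + 1) s = chebSum b r s := by
  rw [chebSum, Finset.sum_range_succ, h, zero_smul, add_zero, chebSum]

theorem chebSum_sub_smul (b b' : ℕ → ℝ) (k : ℝ) (r : ℕ) (s : ℤ) :
    chebSum (fun l => b l - k * b' l) r s = chebSum b r s - k • chebSum b' r s := by
  simp only [chebSum, sub_smul, Finset.sum_sub_distrib, Finset.smul_sum, smul_smul]

/-- At this index the sum equals minus its reversal. Averaging the two gives `U (r - 2 l)` the
coefficient `(b l - b (r + 1 - l)) / 2`, and as `l` passes the middle this changes sign together
with `U`, since `U (-j - 2) = -U j`. -/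
theorem chebSum_mem_chebCone {b : ℕ → ℝ} (hb : Antitone b) (r : ℕ) :
    chebSum b (r + 1) r ∈ chebCone r := by
  have h2 : (2 : ℝ) • chebSum b (r + 1) r =
      ∑ l ∈ Finset.range (r + 2), (b l - b (r + 1 - l)) • Chebyshev.U ℝ ((r : ℤ) - 2 * l) := by
    have e := chebSum_reflect b (r + 1) r
    rw [show 2 * ((r + 1 : ℕ) : ℤ) - 2 - r = r by push_cast; ring] at e
    rw [two_smul]
    nth_rewrite 2 [← neg_neg (chebSum b (r + 1) r)]
    rw [← e, chebSum, chebSum, ← sub_eq_add_neg, ← Finset.sum_sub_distrib]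
    exact Finset.sum_congr rfl fun l _ => by rw [sub_smul]
  have h3 : chebSum b (r + 1) r = (2⁻¹ : ℝ) • ((2 : ℝ) • chebSum b (r + 1) r) := by
    rw [smul_smul]; norm_num
  rw [h3, h2]
  refine smul_mem_chebCone (Submodule.sum_mem _ fun l hl => ?_) (by norm_num)
  have hl' : l ≤ r + 1 := by have := Finset.mem_range.1 hl; omega
  rcases lt_trichotomy (2 * l) (r + 1) with h | h | h
  · obtain ⟨j, hj⟩ : ∃ j : ℕ, (r : ℤ) - 2 * l = j := ⟨r - 2 * l, by omega⟩
    rw [hj]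
    exact smul_mem_chebCone (U_mem_chebCone (by omega)) (sub_nonneg.2 (hb (by omega)))
  · rw [show (r : ℤ) - 2 * l = -1 by omega, Chebyshev.U_neg_one, smul_zero]
    exact Submodule.zero_mem _
  · obtain ⟨j, hj⟩ : ∃ j : ℕ, (r : ℤ) - 2 * l = -j - 2 := ⟨2 * l - r - 2, by omega⟩
    rw [hj, Chebyshev.U_neg_sub_two, smul_neg, ← neg_smul, neg_sub]
    exact smul_mem_chebCone (U_mem_chebCone (by omega)) (sub_nonneg.2 (hb (by omega)))

theorem chebSum_one_reflect (r : ℕ) : chebSum (fun _ => 1) r ((r : ℤ) - 1) = 0 := by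
  have e := chebSum_reflect (fun _ => 1) r ((r : ℤ) - 1)
  rw [show 2 * (r : ℤ) - 2 - (r - 1) = r - 1 by ring] at e
  have h2 : (2 : ℝ) • chebSum (fun _ => 1) r ((r : ℤ) - 1) = 0 := by
    rw [two_smul]
    nth_rewrite 1 [e]
    exact neg_add_cancel _
  simpa using h2

theorem chebSum_one (r : ℕ) : chebSum (fun _ => 1) r (r : ℤ) = Chebyshev.U ℝ r := by
  rcases r with _ | r
  · simp [chebSum]
  · have h := chebSum_one_reflect r
    rw [chebSum] at h ⊢
    rw [Finset.sum_range_succ']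
    simp only [one_smul, Nat.cast_zero, mul_zero, sub_zero, add_eq_right] at h ⊢
    rw [← h]
    refine Finset.sum_congr rfl fun l _ => ?_
    congr 1
    push_cast
    ring

/-- The nonnegative recursion satisfied by a nonincreasing combination of Chebyshev polynomials. -/
theorem exists_isLadder (r : ℕ) (b : ℕ → ℝ) (hb : Antitone b) (hb0 : ∀ l, r + 1 < l → b l = 0)
    (hpos : b (r + 1) < b 0) :
    ∃ p : ℕ → ℝ[X], IsLadder r p ∧ p r = chebSum b (r + 1) r ∧
      (∃ a c : ℝ, 0 ≤ a ∧ 0 ≤ c ∧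
        X * p r = a • chebSum b (r + 1) (r + 1) + c • p (r - 1)) ∧
      (∀ i ≤ r, p i ∈ chebCone i) ∧ ∃ c : ℝ, 0 < c ∧ p 0 = C c := by
  induction r generalizing b with
  | zero =>
    have hnn : 0 ≤ b 1 := by rw [← hb0 2 (by omega)]; exact hb (by omega)
    have e0 : chebSum b 1 (0 : ℕ) = C (b 0 - b 1) := by
      rw [chebSum, Finset.sum_range_succ, Finset.sum_range_one]
      simp [Chebyshev.U_neg_two, smul_eq_C_mul, sub_eq_add_neg]
    have e1 : chebSum b 1 ((0 : ℕ) + 1) = C (2 * b 0) * X := by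
      rw [chebSum, Finset.sum_range_succ, Finset.sum_range_one]
      simp only [Nat.cast_zero, zero_add, mul_zero, sub_zero, Chebyshev.U_one, Nat.cast_one,
        mul_one, smul_eq_C_mul, C_mul]
      rw [show (1 : ℤ) - 2 = -1 by norm_num, Chebyshev.U_neg_one,
        show (C 2 : ℝ[X]) = 2 from map_ofNat C 2]
      ring
    refine ⟨fun _ => C (b 0 - b 1), by intro i hi; omega, e0.symm,
      ⟨(b 0 - b 1) / (2 * b 0), 0, by apply div_nonneg <;> linarith, le_rfl, ?_⟩, fun i hi => ?_,
      b 0 - b 1, by linarith, rfl⟩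
    · rw [zero_add, e1, smul_eq_C_mul, ← mul_assoc, ← C_mul, div_mul_cancel₀, zero_smul, add_zero,
        mul_comm]
      linarith
    · have : C (b 0 - b 1) = (b 0 - b 1) • Chebyshev.U ℝ (0 : ℕ) := by
        simp [smul_eq_C_mul]
      rw [this]
      exact smul_mem_chebCone (U_mem_chebCone (by omega)) (by linarith)
  | succ r ih =>
    have hnn : ∀ l, 0 ≤ b l := fun l => by
      rw [← hb0 (max l (r + 3)) (by omega)]; exact hb (by omega)
    have hb00 : 0 < b 0 := (hnn _).trans_lt hpos
    -- A reduction of Schur type: subtracting `k` times the reversed coefficients kills the last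
    -- one. The result stays antitone because the negative of a reversed antitone sequence is
    -- antitone.
    set k := b (r + 2) / b 0 with hk
    have hk0 : 0 ≤ k := div_nonneg (hnn _) hb00.le
    have hk1 : k < 1 := by rw [hk, div_lt_one hb00]; exact hpos
    have hkb : k * b 0 = b (r + 2) := div_mul_cancel₀ _ hb00.ne'
    set b' : ℕ → ℝ := fun l => if l ≤ r + 2 then b l - k * b (r + 2 - l) else 0 with hb'
    have hb'z : b' (r + 2) = 0 := by simp [hb', hkb]
    have hb'anti : Antitone b' := by
      refine antitone_nat_of_succ_le fun l => ?_
      rcases lt_trichotomy l (r + 2) with h | h | h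
      · simp only [hb', if_pos h.le, if_pos (Nat.succ_le_of_lt h)]
        have e1 := hb (Nat.le_succ l)
        have e2 := mul_le_mul_of_nonneg_left
          (hb (show r + 2 - (l + 1) ≤ r + 2 - l by omega)) hk0
        simp only [Nat.succ_eq_add_one] at e1
        linarith
      · subst h; rw [hb'z]; simp [hb']
      · simp [hb', show ¬ l ≤ r + 2 by omega, show ¬ l + 1 ≤ r + 2 by omega]
    have hsum : ∀ s, chebSum b' (r + 1) s =
        chebSum b (r + 2) s + k • chebSum b (r + 2) (2 * (r + 2 : ℕ) - 2 - s) := by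
      intro s
      rw [← chebSum_succ hb'z, chebSum_congr (b' := fun l => b l - k * b (r + 2 - l))
        (fun l hl => by simp [hb', hl]), chebSum_sub_smul, chebSum_reflect]
      simp
    -- Reflection exchanges the indices `r` and `r + 2`, so the lower neighbour equals the reduced
    -- sum minus `k` times the upper neighbour.
    have hX : X * chebSum b (r + 2) (r + 1 : ℕ) =
        ((1 - k) / 2) • chebSum b (r + 2) ((r + 1 : ℕ) + 1) +
          (2⁻¹ : ℝ) • chebSum b' (r + 1) r := by
      rw [X_mul_chebSum, hsum, show 2 * ((r + 2 : ℕ) : ℤ) - 2 - r = (r + 1 : ℕ) + 1 by push_cast; ring,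
        show ((r + 1 : ℕ) : ℤ) - 1 = r by push_cast; ring]
      module
    by_cases hcase : b' (r + 1) < b' 0
    · obtain ⟨p, hp, hpr, ⟨a, c, ha, hc, hXp⟩, hcone, c0, hc0, hp0⟩ :=
        ih b' hb'anti (fun l hl => by
          rcases (show r + 2 ≤ l by omega).lt_or_eq with h | rfl
          · simp [hb', show ¬ l ≤ r + 2 by omega]
          · exact hb'z) hcase
      refine ⟨fun i => if i ≤ r then p i else chebSum b (r + 2) (r + 1 : ℕ), ?_, by simp,
        ⟨(1 - k) / 2, 2⁻¹, by linarith, by norm_num, ?_⟩, fun i hi => ?_, c0, hc0, by simp [hp0]⟩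
      · intro i hi
        rcases (Nat.lt_succ_iff.1 hi).lt_or_eq with h | rfl
        · simpa [h.le, Nat.succ_le_of_lt h, show i ≤ r + 1 by omega] using hp i h
        · refine ⟨a * (1 + k), c, by positivity, hc, ?_⟩
          simp only [le_rfl, if_true, show ¬ i + 1 ≤ i by omega, if_false,
            show i - 1 ≤ i by omega]
          -- The index `i + 1` is its own reflection, so the ladder of the reduced coefficients
          -- continues into the new top rung.
          have e : chebSum b' (i + 1) (i + 1) = (1 + k) • chebSum b (i + 2) (i + 1 : ℕ) := by
            rw [hsum, show 2 * ((i + 2 : ℕ) : ℤ) - 2 - (i + 1) = (i + 1 : ℕ) by push_cast; ring]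
            push_cast
            module
          rw [hXp, e, smul_smul]
      · simp only [show ¬ r + 1 ≤ r by omega, if_false, Nat.add_sub_cancel, le_rfl, if_true]
        rw [hX, hpr]
      · by_cases h : i ≤ r
        · simpa [h] using hcone i h
        · obtain rfl : i = r + 1 := by omega
          simpa using chebSum_mem_chebCone hb (r + 1)
    -- Degenerate case: `b` is constant up to `r + 1` and zero at `r + 2`. The sum collapses to a
    -- multiple of `U (r + 1)`, and the `U i` themselves form the ladder.
    · have h1 : b' (r + 1) = b r.succ - k * b 1 := by simp [hb', show r + 2 - (r + 1) = 1 by omega]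
      have h2 : b' 0 = b 0 - k * b (r + 2) := by simp [hb']
      rw [h1, h2, not_lt] at hcase
      have e1 := hb (show 0 ≤ r + 1 by omega)
      have e2 := hb (show 1 ≤ r + 2 by omega)
      have e3 := mul_le_mul_of_nonneg_left e2 hk0
      simp only [Nat.succ_eq_add_one] at hcase
      have hconst : b (r + 1) = b 0 := by linarith
      have hl : ∀ l ≤ r + 1, b l = b 0 := fun l hl =>
        le_antisymm (hb (by omega)) (hconst ▸ hb hl)
      have hk' : k = 0 := by
        have : k * (b 1 - b (r + 2)) ≤ 0 := by nlinarith
        rw [hl 1 (by omega)] at this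
        nlinarith
      have hlast : b (r + 2) = 0 := by rw [← hkb, hk', zero_mul]
      have hS : ∀ s, chebSum b (r + 2) s = b 0 • chebSum (fun _ => 1) (r + 1) s := by
        intro s
        rw [chebSum_succ hlast, chebSum_congr (b' := fun _ => b 0) hl]
        simp [chebSum, Finset.smul_sum]
      have hcb : chebSum b' (r + 1) r = 0 := by
        rw [hsum, hk', zero_smul, add_zero, hS]
        have := chebSum_one_reflect (r + 1)
        rw [show ((r + 1 : ℕ) : ℤ) - 1 = r by push_cast; ring] at this
        rw [this, smul_zero]
      refine ⟨fun i => b 0 • Chebyshev.U ℝ i, ?_, ?_, ⟨(1 - k) / 2, 0, by linarith, le_rfl, ?_⟩,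
        fun i hi => smul_mem_chebCone (U_mem_chebCone le_rfl) hb00.le, b 0, hb00, by
          simp [smul_eq_C_mul]⟩
      · intro i hi
        rcases i with _ | i
        · refine ⟨2⁻¹, 0, by norm_num, le_rfl, ?_⟩
          have := X_mul_U 0
          simp only [zero_add, zero_sub, Chebyshev.U_neg_one, add_zero] at this
          simp only [mul_smul_comm, Nat.cast_zero, this, zero_add, Nat.cast_one, zero_smul,
            add_zero]
          rw [smul_comm]
        · refine ⟨2⁻¹, 2⁻¹, by norm_num, by norm_num, ?_⟩
          simp only [mul_smul_comm, X_mul_U, Nat.add_sub_cancel]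
          push_cast
          rw [show (i : ℤ) + 1 - 1 = i by ring]
          module
      · rw [hS, chebSum_one]
      · have := hX
        rw [hcb, hS, chebSum_one] at this
        simp only [this, smul_zero, zero_smul]

end RWRedistribution

namespace RWRedistribution

open Polynomial

/-! ### The boundary extension and the averaging operator -/

section Chain

variable {N : ℕ}

/-- A function on `{0, …, N}`, shifted to `{1, …, N + 1}` and extended by its `w`-mean. -/
noncomputable def bext (w : State N → ℝ) : (State N → ℝ) →ₗ[ℝ] (ℤ → ℝ) where
  toFun f u := if h : 1 ≤ u ∧ u ≤ N + 1 then f ⟨(u - 1).toNat, by omega⟩ else ∑ z, w z * f z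
  map_add' f g := by
    ext u
    simp only [Pi.add_apply]
    split_ifs
    · rfl
    · simp [mul_add, Finset.sum_add_distrib]
  map_smul' a f := by
    ext u
    simp only [Pi.smul_apply, smul_eq_mul, RingHom.id_apply]
    split_ifs
    · rfl
    · rw [Finset.mul_sum]
      exact Finset.sum_congr rfl fun z _ => by ring

theorem bext_of_mem (w f : State N → ℝ) {u : ℤ} (x : State N) (h : u = (x : ℕ) + 1) :
    bext w f u = f x := by
  have hx := x.2
  rw [bext, LinearMap.coe_mk, AddHom.coe_mk, dif_pos (by omega)]
  congr 1
  ext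
  simp [h]

theorem bext_of_notMem (w f : State N → ℝ) {u : ℤ} (h : u < 1 ∨ N + 1 < u) :
    bext w f u = ∑ z, w z * f z := by
  rw [bext, LinearMap.coe_mk, AddHom.coe_mk, dif_neg (by omega)]

theorem exists_state {u : ℤ} (h1 : 1 ≤ u) (h2 : u ≤ N + 1) : ∃ x : State N, u = (x : ℕ) + 1 :=
  ⟨⟨(u - 1).toNat, by omega⟩, by simp only; omega⟩

theorem bext_nonneg {w f : State N → ℝ} (hw : ∀ z, 0 ≤ w z) (hf : ∀ x, 0 ≤ f x) (u : ℤ) :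
    0 ≤ bext w f u := by
  by_cases h : 1 ≤ u ∧ u ≤ N + 1
  · obtain ⟨x, hx⟩ := exists_state h.1 h.2
    rw [bext_of_mem w f x hx]
    exact hf x
  · rw [bext_of_notMem w f (by omega)]
    exact Finset.sum_nonneg fun z _ => mul_nonneg (hw z) (hf z)

theorem bext_one {w : State N → ℝ} (hw : ∑ z, w z = 1) (u : ℤ) : bext w 1 u = 1 := by
  by_cases h : 1 ≤ u ∧ u ≤ N + 1
  · obtain ⟨x, hx⟩ := exists_state h.1 h.2
    rw [bext_of_mem w 1 x hx]
    rfl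
  · rw [bext_of_notMem w 1 (by omega)]
    simpa using hw

/-- The operator averaging the two neighbours, the neighbours outside being distributed
according to `w`. -/
noncomputable def avg (w : State N → ℝ) : Module.End ℝ (State N → ℝ) where
  toFun f x := (bext w f ((x : ℕ) : ℤ) + bext w f (((x : ℕ) : ℤ) + 2)) / 2
  map_add' f g := by
    ext x
    simp only [map_add, Pi.add_apply]
    ring
  map_smul' a f := by
    ext x
    simp only [map_smul, Pi.smul_apply, smul_eq_mul, RingHom.id_apply]
    ring

theorem bext_avg (w f : State N → ℝ) {u : ℤ} (h1 : 1 ≤ u) (h2 : u ≤ N + 1) :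
    bext w (avg w f) u = (bext w f (u - 1) + bext w f (u + 1)) / 2 := by
  obtain ⟨x, rfl⟩ := exists_state h1 h2
  rw [bext_of_mem w _ x rfl, avg, LinearMap.coe_mk, AddHom.coe_mk]
  congr 3
  ring_nf

theorem avg_one {w : State N → ℝ} (hw : ∑ z, w z = 1) : avg w 1 = 1 := by
  ext x
  rw [avg, LinearMap.coe_mk, AddHom.coe_mk, bext_one hw, bext_one hw]
  norm_num

theorem aeval_avg_one {w : State N → ℝ} (hw : ∑ z, w z = 1) (p : ℝ[X]) :
    aeval (avg w) p 1 = p.eval 1 • (1 : State N → ℝ) := by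
  induction p using Polynomial.induction_on' with
  | add p q hp hq => rw [map_add, LinearMap.add_apply, hp, hq, eval_add, add_smul]
  | monomial n a =>
    have h : ∀ n, (avg w ^ n) 1 = 1 := by
      intro n
      induction n with
      | zero => simp
      | succ n ih => rw [pow_succ, Module.End.mul_apply, avg_one hw, ih]
    rw [aeval_monomial, Module.End.mul_apply, h]
    simp

/-- The support stays at distance at least `3` from the ends, so redistribution never hits an end or
its neighbour and the clauses of `trans` simply add up. -/
theorem trans_eq {ν : PMF (State N)} (hN : 2 < N) (hν : ParitySupport N ν) (x y : State N) :
    trans N ν ν x y = 1 / 2 * (if y = x then 1 else 0) +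
      1 / 4 * (if (x : ℕ) = 0 then (ν y).toReal else if (y : ℕ) + 1 = x then 1 else 0) +
      1 / 4 * (if (x : ℕ) = N then (ν y).toReal else if (y : ℕ) = x + 1 then 1 else 0) := by
  have h0 : ((y : ℕ) < 3 ∨ N < (y : ℕ) + 3) → (ν y).toReal = 0 := by
    intro h
    have : y ∉ ν.support := fun hy => by have := hν y hy; omega
    rw [PMF.mem_support_iff, not_not] at this
    simp [this]
  have hy := y.2
  have hx := x.2
  have habs : (|((y : ℕ) : ℤ) - ((x : ℕ) : ℤ)| = 1) ↔ ((y : ℕ) + 1 = x ∨ (y : ℕ) = x + 1) := by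
    rw [abs_eq one_pos.le]; omega
  unfold trans
  simp only [habs, Fin.ext_iff]
  by_cases e : (x : ℕ) = 0 ∨ (x : ℕ) = N
  · by_cases h3 : (y : ℕ) < 3 ∨ N < (y : ℕ) + 3
    · rw [h0 h3]
      split_ifs <;> first | omega | norm_num
    · split_ifs <;> first | omega | norm_num
  · split_ifs <;> first | omega | norm_num

theorem trans_mulVec {ν : PMF (State N)} (hN : 2 < N) (hν : ParitySupport N ν) (f : State N → ℝ) :
    (trans N ν ν).mulVec f = (2⁻¹ : ℝ) • (f + avg (fun z => (ν z).toReal) f) := by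
  ext x
  have hx := x.2
  have e1 : ∑ y : State N, (if y = x then (1 : ℝ) else 0) * f y = f x := by simp
  have e2 : ∑ y : State N, (if (x : ℕ) = 0 then (ν y).toReal else
      if (y : ℕ) + 1 = x then 1 else 0) * f y = bext (fun z => (ν z).toReal) f ((x : ℕ) : ℤ) := by
    split_ifs with h
    · rw [bext_of_notMem _ _ (by omega)]
    · have : ∀ y : State N, (y : ℕ) + 1 = x ↔ y = ⟨x - 1, by omega⟩ := fun y => by
        rw [Fin.ext_iff]; simp only; omega
      simp only [this]
      rw [bext_of_mem _ f ⟨x - 1, by omega⟩ (by simp only; omega)]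
      simp
  have e3 : ∑ y : State N, (if (x : ℕ) = N then (ν y).toReal else
      if (y : ℕ) = x + 1 then 1 else 0) * f y =
      bext (fun z => (ν z).toReal) f (((x : ℕ) : ℤ) + 2) := by
    split_ifs with h
    · rw [bext_of_notMem _ _ (by omega)]
    · have : ∀ y : State N, (y : ℕ) = x + 1 ↔ y = ⟨x + 1, by omega⟩ := fun y => by
        rw [Fin.ext_iff]
      simp only [this]
      rw [bext_of_mem _ f ⟨x + 1, by omega⟩ (by simp only; push_cast; ring)]
      simp
  rw [Pi.smul_apply, Pi.add_apply, avg, LinearMap.coe_mk, AddHom.coe_mk, ← e2, ← e3, ← e1]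
  simp only [Matrix.mulVec, dotProduct, trans_eq hN hν, smul_eq_mul]
  rw [← Finset.sum_add_distrib, Finset.sum_div, ← Finset.sum_add_distrib, Finset.mul_sum]
  refine Finset.sum_congr rfl fun y _ => ?_
  ring

/-! ### Positivity of the Chebyshev polynomials of the averaging operator -/

theorem two_smul_avg (w : State N → ℝ) (s : ℤ) (f : State N → ℝ) :
    aeval (avg w) (Chebyshev.U ℝ (s + 1)) f =
      (2 : ℝ) • avg w (aeval (avg w) (Chebyshev.U ℝ s) f) -
        aeval (avg w) (Chebyshev.U ℝ (s - 1)) f := by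
  rw [Chebyshev.U_add_one, map_sub, LinearMap.sub_apply, mul_assoc, map_mul, map_mul, aeval_X,
    Module.End.mul_apply, Module.End.mul_apply, map_ofNat]
  congr 1
  rw [two_smul]
  exact two_smul ℕ _

/-- The `U_j(A) f` solve a discrete wave equation. While the ray from `u` to the right does not pass
`N + 2`, it contributes exactly the value at its end. -/
theorem bext_U_right (w f : State N → ℝ) (j : ℕ) : ∀ u : ℤ, 1 ≤ u → u + j ≤ N + 2 →
    bext w (aeval (avg w) (Chebyshev.U ℝ j) f) u =
      bext w (aeval (avg w) (Chebyshev.U ℝ (j - 1)) f) (u - 1) + bext w f (u + j) := by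
  induction j with
  | zero => intro u _ _; simp [Chebyshev.U_neg_one]
  | succ j ih =>
    intro u h1 h2
    push_cast at h2 ⊢
    rw [two_smul_avg, map_sub, Pi.sub_apply, map_smul, Pi.smul_apply, bext_avg w _ h1 (by omega),
      ih (u + 1) (by omega) (by omega), add_sub_cancel_right, add_sub_cancel_right,
      show u + 1 + (j : ℤ) = u + (j + 1) by ring, smul_eq_mul]
    ring

theorem bext_U_left (w f : State N → ℝ) (j : ℕ) : ∀ u : ℤ, u ≤ N + 1 → j ≤ u →
    bext w (aeval (avg w) (Chebyshev.U ℝ j) f) u =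
      bext w (aeval (avg w) (Chebyshev.U ℝ (j - 1)) f) (u + 1) + bext w f (u - j) := by
  induction j with
  | zero => intro u _ _; simp [Chebyshev.U_neg_one]
  | succ j ih =>
    intro u h1 h2
    push_cast at h2 ⊢
    rw [two_smul_avg, map_sub, Pi.sub_apply, map_smul, Pi.smul_apply, bext_avg w _ (by omega) h1,
      ih (u - 1) (by omega) (by omega), sub_add_cancel, add_sub_cancel_right,
      show u - 1 - (j : ℤ) = u - (j + 1) by ring, smul_eq_mul]
    ring

/-- When `2 j ≤ N + 2`, a ray of length `j` fits on at least one side of every point; recursing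
along that side involves only additions. -/
theorem aeval_U_nonneg {w f : State N → ℝ} (hw : ∀ z, 0 ≤ w z) (hf : ∀ x, 0 ≤ f x) {j : ℕ}
    (hj : 2 * j ≤ N + 2) (x : State N) : 0 ≤ aeval (avg w) (Chebyshev.U ℝ j) f x := by
  induction j generalizing x with
  | zero => simpa using hf x
  | succ j ih =>
    have hx := x.2
    rw [← bext_of_mem w (aeval (avg w) (Chebyshev.U ℝ (j + 1 : ℕ)) f) x rfl]
    have hnn := bext_nonneg hw (ih (by omega))
    by_cases h : 2 * ((x : ℕ) + 1) ≤ N + 2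
    · rw [bext_U_right w f _ _ (by omega) (by omega), show ((j + 1 : ℕ) : ℤ) - 1 = j by push_cast; ring]
      exact add_nonneg (hnn _) (bext_nonneg hw hf _)
    · rw [bext_U_left w f _ _ (by omega) (by omega), show ((j + 1 : ℕ) : ℤ) - 1 = j by push_cast; ring]
      exact add_nonneg (hnn _) (bext_nonneg hw hf _)

theorem aeval_nonneg_of_mem_chebCone {w f : State N → ℝ} (hw : ∀ z, 0 ≤ w z) (hf : ∀ x, 0 ≤ f x)
    {d : ℕ} (hd : 2 * d ≤ N + 2) {p : ℝ[X]} (hp : p ∈ chebCone d) (x : State N) :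
    0 ≤ aeval (avg w) p f x := by
  induction hp using Submodule.span_induction with
  | mem p hp =>
    obtain ⟨j, hj, rfl⟩ := hp
    exact aeval_U_nonneg hw hf (by have : j ≤ d := hj; omega) x
  | zero => simp
  | add p q _ _ hp hq =>
    rw [map_add, LinearMap.add_apply, Pi.add_apply]
    exact add_nonneg hp hq
  | smul a p _ hp =>
    have : a • p = (a : ℝ) • p := rfl
    rw [this, map_smul, LinearMap.smul_apply, Pi.smul_apply, smul_eq_mul]
    exact mul_nonneg a.2 hp

theorem aeval_le_of_mem_chebCone {w f : State N → ℝ} (hw : ∀ z, 0 ≤ w z) (hw1 : ∑ z, w z = 1)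
    {K : ℝ} (hf : ∀ x, f x ≤ K) {d : ℕ} (hd : 2 * d ≤ N + 2) {p : ℝ[X]} (hp : p ∈ chebCone d)
    (x : State N) : aeval (avg w) p f x ≤ K * p.eval 1 := by
  have h := aeval_nonneg_of_mem_chebCone hw (f := K • 1 - f) (fun x => by simpa using hf x) hd hp x
  rw [map_sub, map_smul, aeval_avg_one hw1] at h
  simpa using h

/-! ### Symmetric functions -/

theorem bext_symm {w f : State N → ℝ} (hf : ∀ x, f x.rev = f x) (u : ℤ) :
    bext w f (N + 2 - u) = bext w f u := by
  by_cases h : 1 ≤ u ∧ u ≤ N + 1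
  · obtain ⟨x, hx⟩ := exists_state h.1 h.2
    have := x.2
    rw [bext_of_mem w f x hx, bext_of_mem w f x.rev (by rw [Fin.val_rev]; omega), hf]
  · rw [bext_of_notMem w f (by omega), bext_of_notMem w f (by omega)]

theorem avg_symm {w f : State N → ℝ} (hf : ∀ x, f x.rev = f x) (x : State N) :
    avg w f x.rev = avg w f x := by
  have := x.2
  rw [avg, LinearMap.coe_mk, AddHom.coe_mk,
    show ((x.rev : ℕ) : ℤ) = N + 2 - ((x : ℕ) + 2) by rw [Fin.val_rev]; omega, bext_symm hf,
    show (N : ℤ) + 2 - ((x : ℕ) + 2) + 2 = N + 2 - (x : ℕ) by ring, bext_symm hf, add_comm]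

theorem aeval_avg_symm {w f : State N → ℝ} (hf : ∀ x, f x.rev = f x) (p : ℝ[X]) (x : State N) :
    aeval (avg w) p f x.rev = aeval (avg w) p f x := by
  induction p using Polynomial.induction_on' generalizing x with
  | add p q hp hq => simp only [map_add, LinearMap.add_apply, Pi.add_apply, hp, hq]
  | monomial n a =>
    have h : ∀ n, ∀ x, (avg w ^ n) f x.rev = (avg w ^ n) f x := by
      intro n
      induction n with
      | zero => simpa using hf
      | succ n ih =>
        intro x
        rw [pow_succ', Module.End.mul_apply]
        exact avg_symm ih x
    rw [aeval_monomial, Module.End.mul_apply]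
    simp [h]

end Chain

end RWRedistribution

namespace RWRedistribution

open Polynomial

/-! ### Chebyshev polynomials at the centre, and functions fixed by the square of the averaging
operator. -/

section Symmetric

variable {N : ℕ}

theorem two_mul_T (i : ℤ) : (2 : ℝ[X]) * Chebyshev.T ℝ i = Chebyshev.U ℝ i - Chebyshev.U ℝ (i - 2) :=
  by simpa using Chebyshev.two_mul_T_eq_U_sub_U ℝ (i - 2)

/-- D'Alembert's formula: in `2 T_i = U_i - U_{i-2}`, peeling once to the right from `h` and once to
the left from `h - 1` leaves just the two ends. -/
theorem bext_T_center {w f : State N → ℝ} {h : ℕ} (hN : N + 2 = 2 * h) {i : ℕ} (hi : i ≤ h) :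
    2 * bext w (aeval (avg w) (Chebyshev.T ℝ i) f) h = bext w f (h + i) + bext w f (h - i) := by
  have e : 2 * bext w (aeval (avg w) (Chebyshev.T ℝ i) f) h =
      bext w (aeval (avg w) ((2 : ℝ[X]) * Chebyshev.T ℝ i) f) h := by
    rw [map_mul, map_ofNat, Module.End.mul_apply, two_mul]
    rw [show (2 : Module.End ℝ (State N → ℝ)) (aeval (avg w) (Chebyshev.T ℝ i) f) =
      aeval (avg w) (Chebyshev.T ℝ i) f + aeval (avg w) (Chebyshev.T ℝ i) f from two_smul ℕ _,
      map_add, Pi.add_apply]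
  rw [e, two_mul_T, map_sub, LinearMap.sub_apply, map_sub, Pi.sub_apply,
    bext_U_right w f i _ (by omega) (by omega)]
  rcases i with _ | i
  · have h2 : Chebyshev.U ℝ (-2) = -1 := by simp
    simp only [Nat.cast_zero, zero_sub, Chebyshev.U_neg_one, h2, map_zero, LinearMap.zero_apply,
      map_neg, map_one, LinearMap.neg_apply, Module.End.one_apply, Pi.neg_apply, add_zero, sub_zero,
      Pi.zero_apply]
    ring
  · have := bext_U_left w f i ((h : ℤ) - 1) (by omega) (by omega)
    rw [show ((i + 1 : ℕ) : ℤ) - 1 = i by push_cast; ring, this, sub_add_cancel,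
      show ((i + 1 : ℕ) : ℤ) - 2 = i - 1 by push_cast; ring]
    push_cast
    rw [show (h : ℤ) - 1 - i = h - (i + 1) by ring]
    ring

/-- The distance of `z + 1` to the centre `h`. -/
def centerDist (h : ℕ) (z : State N) : ℕ := (((z : ℕ) : ℤ) + 1 - h).natAbs

/-- At the centre the `T` at distance `d(z)` returns `f z`, while `T_h` returns the boundary value,
which is the `w`-mean: the two cancel. The polynomial commutes with `avg w` and preserves symmetry,
so applying this to `avg w f` spreads the zero outwards step by step. -/
theorem aeval_T_sub_eq_zero {w f : State N → ℝ} {h : ℕ} (hN : N + 2 = 2 * h)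
    (hf : ∀ x, f x.rev = f x) :
    aeval (avg w) (∑ z, w z • Chebyshev.T ℝ (centerDist h z : ℕ) - Chebyshev.T ℝ h) f = 0 := by
  set H := ∑ z : State N, w z • Chebyshev.T ℝ (centerDist h z : ℕ) - Chebyshev.T ℝ h with hH
  have hcenter : ∀ f : State N → ℝ, (∀ x, f x.rev = f x) → bext w (aeval (avg w) H f) h = 0 := by
    intro f hf
    have e1 : 2 * bext w (aeval (avg w) (Chebyshev.T ℝ h) f) h = 2 * ∑ z, w z * f z := by
      rw [bext_T_center hN le_rfl, bext_of_notMem w f (by omega), bext_of_notMem w f (by omega)]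
      ring
    have e2 : ∀ z : State N,
        2 * bext w (aeval (avg w) (Chebyshev.T ℝ (centerDist h z : ℕ)) f) h = 2 * f z := by
      intro z
      have hz := z.2
      rw [bext_T_center hN (by unfold centerDist; omega)]
      have e3 : bext w f (h - (centerDist h z : ℕ)) = bext w f (h + (centerDist h z : ℕ)) := by
        rw [← bext_symm hf, show (N : ℤ) + 2 - (h - (centerDist h z : ℕ)) = h + (centerDist h z : ℕ) by
          omega]
      rw [e3]
      have e4 : bext w f (h + (centerDist h z : ℕ)) = f z := by
        rcases le_total (h : ℤ) ((z : ℕ) + 1) with hle | hle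
        · exact bext_of_mem w f z (by unfold centerDist; omega)
        · rw [← e3]
          exact bext_of_mem w f z (by unfold centerDist; omega)
      rw [e4]
      ring
    rw [hH, map_sub, LinearMap.sub_apply, map_sub, Pi.sub_apply, map_sum, LinearMap.sum_apply,
      map_sum, Finset.sum_apply]
    simp only [map_smul, LinearMap.smul_apply, Pi.smul_apply, smul_eq_mul]
    rw [show bext w (aeval (avg w) (Chebyshev.T ℝ h) f) h = ∑ z, w z * f z by linarith, sub_eq_zero]
    exact Finset.sum_congr rfl fun z _ => by rw [show bext w _ _ = f z by linarith [e2 z]]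
  have hcomm : ∀ f, aeval (avg w) H (avg w f) = avg w (aeval (avg w) H f) := by
    intro f
    have := congrArg (fun p => aeval (avg w) p f) (mul_comm H X)
    simpa using this
  have hk : ∀ k : ℕ, h + k ≤ N + 1 → ∀ f : State N → ℝ, (∀ x, f x.rev = f x) →
      bext w (aeval (avg w) H f) (h + k) = 0 := by
    intro k
    induction k using Nat.twoStepInduction with
    | zero => intro _ f hf; simpa using hcenter f hf
    | one =>
      intro hk f hf
      have e := hcenter (avg w f) (avg_symm hf)
      rw [hcomm, bext_avg _ _ (by omega) (by omega),
        ← bext_symm (aeval_avg_symm hf H) ((h : ℤ) - 1),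
        show (N : ℤ) + 2 - (h - 1) = h + 1 by omega] at e
      push_cast
      linarith
    | more k ih1 ih2 =>
      intro hk f hf
      have e := ih2 (by omega) (avg w f) (avg_symm hf)
      rw [hcomm, bext_avg _ _ (by omega) (by omega),
        show (h : ℤ) + (k + 1 : ℕ) - 1 = h + k by push_cast; ring, ih1 (by omega) f hf,
        show (h : ℤ) + (k + 1 : ℕ) + 1 = h + (k + 1 + 1 : ℕ) by push_cast; ring] at e
      linarith
  ext x
  have hx := x.2
  rw [← bext_of_mem w (aeval (avg w) H f) x rfl, Pi.zero_apply]
  rcases le_total (h : ℤ) ((x : ℕ) + 1) with hle | hle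
  · have := hk ((x : ℕ) + 1 - h) (by omega) f hf
    rwa [show (h : ℤ) + ((x : ℕ) + 1 - h : ℕ) = (x : ℕ) + 1 by omega] at this
  · rw [← bext_symm (aeval_avg_symm hf H)]
    have := hk (h - ((x : ℕ) + 1)) (by omega) f hf
    rwa [show (h : ℤ) + (h - ((x : ℕ) + 1) : ℕ) = N + 2 - ((x : ℕ) + 1) by omega] at this

/-- A harmonic function is affine on `{0, …, N + 2}`, and its two end values are the same mean. -/
theorem bext_eq_of_avg_eq {w s : State N → ℝ} (hs : avg w s = s) (x y : State N) : s x = s y := by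
  have hlin : ∀ k : ℕ, k ≤ N + 2 → bext w s k = bext w s 0 + k * (bext w s 1 - bext w s 0) := by
    intro k
    induction k using Nat.twoStepInduction with
    | zero => intro _; simp
    | one => intro _; simp
    | more k ih1 ih2 =>
      intro hk
      have e := bext_avg w s (u := (k + 1 : ℕ)) (by omega) (by omega)
      rw [hs, ih2 (by omega), show ((k + 1 : ℕ) : ℤ) - 1 = k by push_cast; ring, ih1 (by omega),
        show ((k + 1 : ℕ) : ℤ) + 1 = (k + 2 : ℕ) by push_cast; ring] at e
      push_cast at e ⊢
      linarith
  have h2 := hlin (N + 2) le_rfl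
  rw [bext_of_notMem w s (by omega), bext_of_notMem w s (u := 0) (by omega)] at h2
  have h3 : bext w s 1 - ∑ z, w z * s z = 0 := by
    have h4 : ((N + 2 : ℕ) : ℝ) * (bext w s 1 - ∑ z, w z * s z) = 0 := by linarith
    exact (mul_eq_zero.1 h4).resolve_left (by positivity)
  have hc : ∀ x : State N, s x = ∑ z, w z * s z := by
    intro x
    have hx := x.2
    have := hlin ((x : ℕ) + 1) (by omega)
    rw [bext_of_mem w s x (by push_cast; ring), bext_of_notMem w s (u := 0) (by omega), h3] at this
    linarith
  rw [hc x, hc y]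

/-- After multiplication by `(-1) ^ u` the function is affine; since `N` is even the end values
still agree. -/
theorem bext_eq_of_avg_eq_neg {w s : State N → ℝ} (hN : Even N) (hs : avg w s = -s) (x y : State N)
    (hxy : Even ((x : ℕ) + y)) : s x = s y := by
  have hlin : ∀ k : ℕ, k ≤ N + 2 →
      (-1) ^ k * bext w s k = bext w s 0 + k * (-bext w s 1 - bext w s 0) := by
    intro k
    induction k using Nat.twoStepInduction with
    | zero => intro _; simp
    | one => intro _; simp
    | more k ih1 ih2 =>
      intro hk
      have e := bext_avg w s (u := (k + 1 : ℕ)) (by omega) (by omega)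
      rw [hs, show ((k + 1 : ℕ) : ℤ) - 1 = k by push_cast; ring,
        show ((k + 1 : ℕ) : ℤ) + 1 = (k + 2 : ℕ) by push_cast; ring, map_neg, Pi.neg_apply] at e
      have i1 := ih1 (by omega)
      have i2 := ih2 (by omega)
      have e' : bext w s ((k + 2 : ℕ)) = -2 * bext w s ((k + 1 : ℕ)) - bext w s k := by linarith
      rw [e', pow_add]
      rw [pow_succ] at i2
      push_cast at i1 i2 ⊢
      linarith
  have h2 := hlin (N + 2) le_rfl
  rw [bext_of_notMem w s (by omega), bext_of_notMem w s (u := 0) (by omega),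
    Even.neg_one_pow (by simpa [Nat.even_add] using hN)] at h2
  have h3 : -bext w s 1 - ∑ z, w z * s z = 0 := by
    have h4 : ((N + 2 : ℕ) : ℝ) * (-bext w s 1 - ∑ z, w z * s z) = 0 := by linarith
    exact (mul_eq_zero.1 h4).resolve_left (by positivity)
  have hc : ∀ x : State N, (-1) ^ ((x : ℕ) + 1) * s x = ∑ z, w z * s z := by
    intro x
    have hx := x.2
    have := hlin ((x : ℕ) + 1) (by omega)
    rw [bext_of_mem w s x (by push_cast; ring), bext_of_notMem w s (u := 0) (by omega), h3] at this
    linarith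
  have h5 := hc x
  rw [← hc y] at h5
  have h6 : ((-1 : ℝ)) ^ ((x : ℕ) + 1) = (-1) ^ ((y : ℕ) + 1) := by
    rw [pow_succ, pow_succ]
    congr 1
    rcases Nat.even_or_odd (x : ℕ) with hx | hx
    · rw [hx.neg_one_pow, Even.neg_one_pow (by rw [Nat.even_add] at hxy; exact hxy.1 hx)]
    · rw [hx.neg_one_pow, Odd.neg_one_pow]
      rw [Nat.even_add] at hxy
      rw [← Nat.not_even_iff_odd] at hx ⊢
      exact fun h => hx (hxy.2 h)
  rw [h6] at h5
  exact mul_left_cancel₀ (pow_ne_zero _ (by norm_num)) h5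

theorem eq_of_avg_avg_eq {w g : State N → ℝ} (hN : Even N) (hg : avg w (avg w g) = g) (x y : State N)
    (hxy : Even ((x : ℕ) + y)) : g x = g y := by
  have h1 := bext_eq_of_avg_eq (s := g + avg w g) (by rw [map_add, hg, add_comm]) x y
  have h2 := bext_eq_of_avg_eq_neg (s := g - avg w g) hN (by rw [map_sub, hg, neg_sub]) x y hxy
  simp only [Pi.add_apply, Pi.sub_apply] at h1 h2
  linarith

end Symmetric

/-! ### The polynomial equalising the symmetric part -/

section Equaliser

variable {N : ℕ}

/-- The mass of the points at distance at most `h - 2 - 2 l` from the centre. -/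
noncomputable def centerMass (w : State N → ℝ) (h l : ℕ) : ℝ :=
  ∑ z, if centerDist h z + 2 + 2 * l ≤ h then w z else 0

theorem centerMass_antitone {w : State N → ℝ} (hw : ∀ z, 0 ≤ w z) (h : ℕ) :
    Antitone (centerMass w h) := by
  intro l l' hl
  refine Finset.sum_le_sum fun z _ => ?_
  have := hw z
  split_ifs <;> first | exact le_rfl | assumption | omega

theorem four_mul_T_sub_T (j : ℤ) : (4 : ℝ[X]) * (1 - X ^ 2) * Chebyshev.U ℝ j =
    2 * (Chebyshev.T ℝ j - Chebyshev.T ℝ (j + 2)) := by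
  have h1 := two_mul_T j
  have h2 := two_mul_T (j + 2)
  have h3 := Chebyshev.U_add_two ℝ j
  have h4 := Chebyshev.U_add_two ℝ (j - 1)
  have h5 := Chebyshev.U_add_two ℝ (j - 2)
  rw [add_sub_cancel_right] at h2
  rw [show j - 1 + 2 = j + 1 by ring, sub_add_cancel] at h4
  rw [show j - 2 + 1 = j - 1 by ring, sub_add_cancel] at h5
  linear_combination -h1 + h2 + h3 + 2 * X * h4 + h5

/-- Each `z` contributes a telescoping sum of `T_j - T_{j+2}` from `h` down to its distance from the
centre, in steps of two. The parity condition makes it land exactly there. -/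
theorem equaliser_identity {w : State N → ℝ} {h : ℕ} (hpar : ∀ z, w z ≠ 0 → Odd (centerDist h z + h + 1))
    (hle : ∀ z, w z ≠ 0 → centerDist h z + 2 ≤ h) (hw1 : ∑ z, w z = 1) :
    (4 : ℝ[X]) * (1 - X ^ 2) * chebSum (centerMass w h) (h - 1) ((h : ℤ) - 2) =
      2 * (∑ z, w z • Chebyshev.T ℝ (centerDist h z : ℕ) - Chebyshev.T ℝ h) := by
  have hT : Chebyshev.T ℝ h = ∑ z, w z • Chebyshev.T ℝ h := by
    rw [← Finset.sum_smul, hw1, one_smul]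
  rw [hT, ← Finset.sum_sub_distrib, chebSum, Finset.mul_sum, Finset.mul_sum]
  simp only [centerMass, Finset.sum_smul, Finset.mul_sum]
  rw [Finset.sum_comm]
  refine Finset.sum_congr rfl fun z _ => ?_
  by_cases hz : w z = 0
  · simp [hz]
  obtain ⟨q, hq⟩ := hpar z hz
  have hle' := hle z hz
  obtain ⟨n, hn⟩ : ∃ n, h = centerDist h z + 2 * n ∧ 1 ≤ n := ⟨h - q, by omega⟩
  have h1 : ∀ l ∈ Finset.range (h - 1 + 1), (4 : ℝ[X]) * (1 - X ^ 2) *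
      ((if centerDist h z + 2 + 2 * l ≤ h then w z else 0) • Chebyshev.U ℝ ((h : ℤ) - 2 - 2 * l)) =
      if l < n then w z • (2 * (Chebyshev.T ℝ ((h : ℤ) - 2 * (l + 1 : ℕ)) -
        Chebyshev.T ℝ ((h : ℤ) - 2 * l))) else 0 := by
    intro l _
    by_cases hl : l < n
    · rw [if_pos hl, if_pos (by omega), mul_smul_comm, four_mul_T_sub_T]
      congr 4 <;> push_cast <;> ring_nf
    · rw [if_neg hl, if_neg (by omega), zero_smul, mul_zero]
  rw [Finset.sum_congr rfl h1, ← Finset.sum_filter,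
    show Finset.filter (· < n) (Finset.range (h - 1 + 1)) = Finset.range n by
      ext; simp; omega,
    ← Finset.smul_sum, ← Finset.mul_sum,
    Finset.sum_range_sub (fun l => Chebyshev.T ℝ ((h : ℤ) - 2 * (l : ℕ)))]
  rw [Nat.cast_zero, mul_zero, sub_zero, show (h : ℤ) - 2 * n = (centerDist h z : ℕ) by omega,
    ← smul_sub, mul_smul_comm]

theorem aeval_equaliser {w f : State N → ℝ} {h : ℕ} (hN : N + 2 = 2 * h) (hNe : Even N)
    (hpar : ∀ z, w z ≠ 0 → Odd (centerDist h z + h + 1))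
    (hle : ∀ z, w z ≠ 0 → centerDist h z + 2 ≤ h) (hw1 : ∑ z, w z = 1)
    (hf : ∀ x, f x.rev = f x) {x y : State N} (hxy : Even ((x : ℕ) + y)) :
    aeval (avg w) (chebSum (centerMass w h) (h - 1) ((h : ℤ) - 2)) f x =
      aeval (avg w) (chebSum (centerMass w h) (h - 1) ((h : ℤ) - 2)) f y := by
  set R := chebSum (centerMass w h) (h - 1) ((h : ℤ) - 2) with hR
  refine eq_of_avg_avg_eq hNe (w := w) ?_ x y hxy
  have h1 := congrArg (fun p => aeval (avg w) p f) (equaliser_identity hpar hle hw1)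
  simp only [← hR] at h1
  have h2 : (4 : ℝ[X]) * (1 - X ^ 2) * R = C 4 * (R - X * (X * R)) := by
    rw [show (C 4 : ℝ[X]) = 4 from map_ofNat C 4]; ring
  rw [h2, map_mul, Module.End.mul_apply, map_mul, Module.End.mul_apply,
    aeval_T_sub_eq_zero hN hf, map_zero, aeval_C, Module.algebraMap_end_apply, map_sub,
    LinearMap.sub_apply, map_mul, map_mul, aeval_X, Module.End.mul_apply, Module.End.mul_apply,
    smul_eq_zero] at h1
  exact (sub_eq_zero.1 (h1.resolve_left (by norm_num))).symm

end Equaliser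

end RWRedistribution

namespace RWRedistribution

open Polynomial

/-! ### The killed lazy walk -/

/-- The probability that the lazy walk started from `z` is in `{1, …, L}` up to time `t`. -/
noncomputable def kill (L : ℕ) : ℕ → ℤ → ℝ
  | 0, z => if 1 ≤ z ∧ z ≤ L then 1 else 0
  | t + 1, z => if 1 ≤ z ∧ z ≤ L then
      (kill L t (z - 1) + 2 * kill L t z + kill L t (z + 1)) / 4 else 0

theorem kill_of_notMem {L : ℕ} (t : ℕ) {z : ℤ} (h : ¬(1 ≤ z ∧ z ≤ L)) : kill L t z = 0 := by
  cases t <;> simp only [kill, if_neg h]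

theorem kill_zero_of_mem {L : ℕ} {z : ℤ} (h : 1 ≤ z ∧ z ≤ L) : kill L 0 z = 1 := by
  simp only [kill, if_pos h]

theorem kill_succ_of_mem {L : ℕ} (t : ℕ) {z : ℤ} (h : 1 ≤ z ∧ z ≤ L) :
    kill L (t + 1) z = (kill L t (z - 1) + 2 * kill L t z + kill L t (z + 1)) / 4 := by
  simp only [kill, if_pos h]

theorem kill_nonneg (L t : ℕ) (z : ℤ) : 0 ≤ kill L t z := by
  induction t generalizing z with
  | zero => rw [kill]; split_ifs <;> norm_num
  | succ t ih =>
    rw [kill]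
    split_ifs
    · have h1 := ih (z - 1)
      have h2 := ih z
      have h3 := ih (z + 1)
      linarith
    · exact le_rfl

theorem kill_symm (L t : ℕ) (z : ℤ) : kill L t (L + 1 - z) = kill L t z := by
  induction t generalizing z with
  | zero => rw [kill, kill]; congr 1; ext; omega
  | succ t ih =>
    by_cases h : 1 ≤ z ∧ z ≤ L
    · rw [kill_succ_of_mem t h, kill_succ_of_mem t (by omega), ih, ← ih (z - 1), ← ih (z + 1),
        show (L : ℤ) + 1 - z - 1 = L + 1 - (z + 1) by ring,
        show (L : ℤ) + 1 - z + 1 = L + 1 - (z - 1) by ring]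
      ring
    · rw [kill_of_notMem _ h, kill_of_notMem _ (by omega)]

theorem kill_center (m t : ℕ) : kill (2 * m) t (m + 1) = kill (2 * m) t m := by
  rw [← kill_symm (2 * m) t m]
  congr 1
  push_cast
  ring

theorem kill_le_succ (m t : ℕ) {z : ℤ} (h : z + 1 ≤ m) :
    kill (2 * m) t z ≤ kill (2 * m) t (z + 1) := by
  induction t generalizing z with
  | zero => rw [kill, kill]; split_ifs <;> first | omega | norm_num
  | succ t ih =>
    by_cases hz : 1 ≤ z
    · rw [kill_succ_of_mem t (by push_cast; omega), kill_succ_of_mem t (by push_cast; omega)]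
      have h1 := ih (z := z - 1) (by omega)
      have h2 := ih h
      have h3 : kill (2 * m) t (z + 1) ≤ kill (2 * m) t (z + 1 + 1) := by
        rcases h.lt_or_eq with h' | h'
        · exact ih (by omega)
        · rw [h', kill_center]
      rw [sub_add_cancel] at h1
      rw [add_sub_cancel_right]
      linarith
    · rw [kill_of_notMem _ (by omega)]
      exact kill_nonneg _ _ _

theorem kill_le_center (m t : ℕ) (z : ℤ) : kill (2 * m) t z ≤ kill (2 * m) t m := by
  have h : ∀ k : ℕ, kill (2 * m) t (m - k) ≤ kill (2 * m) t m := by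
    intro k
    induction k with
    | zero => simp
    | succ k ih =>
      refine le_trans ?_ ih
      have := kill_le_succ m t (z := m - (k + 1 : ℕ)) (by omega)
      rwa [show (m : ℤ) - (k + 1 : ℕ) + 1 = m - k by push_cast; ring] at this
  rcases le_total z m with hz | hz
  · have := h (m - z).toNat
    rwa [show (m : ℤ) - ((m - z).toNat : ℕ) = z by omega] at this
  · rcases hz.lt_or_eq with hz' | rfl
    · rw [← kill_symm]
      have := h (z - m - 1).toNat
      rwa [show (m : ℤ) - ((z - m - 1).toNat : ℕ) = (2 * m : ℕ) + 1 - z by push_cast; omega] at this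
    · exact le_rfl

/-! ### Sums of independent times -/

/-- If `S t = P(τ > t)` and `q t = P(σ > t)` with `τ`, `σ` independent, then
`convAdd S q t = P(τ + σ > t)`. -/
noncomputable def convAdd (S q : ℕ → ℝ) (t : ℕ) : ℝ :=
  S t + (1 - S 0) * q t + ∑ s ∈ Finset.range t, (S s - S (s + 1)) * q (t - 1 - s)

theorem convAdd_zero_left (q : ℕ → ℝ) : convAdd 0 q = q := by
  ext t; simp [convAdd]

theorem convAdd_zero_right (S : ℕ → ℝ) : convAdd S 0 = S := by
  ext t; simp [convAdd]

/-- The survival function of the exit time of the walk started from `m + k`. -/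
noncomputable def surv (m k : ℕ) (t : ℕ) : ℝ := kill (2 * m) t (m + k)

theorem surv_one (m : ℕ) : surv m 1 = surv m 0 := by
  ext t
  have := kill_center m t
  simpa [surv] using this

/-- First-step analysis of the walk started from the interior point `m + k + 1`. -/
theorem convAdd_surv_succ {m k : ℕ} (hk : k < m) (q : ℕ → ℝ) (t : ℕ) :
    convAdd (surv m (k + 1)) q (t + 1) = (convAdd (surv m k) q t +
      2 * convAdd (surv m (k + 1)) q t + convAdd (surv m (k + 2)) q t) / 4 := by
  have hS : ∀ s, surv m (k + 1) (s + 1) =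
      (surv m k s + 2 * surv m (k + 1) s + surv m (k + 2) s) / 4 := by
    intro s
    rw [surv, kill_succ_of_mem s (by push_cast; omega), surv, surv, surv]
    push_cast
    rw [show (m : ℤ) + (k + 1) - 1 = m + k by ring, show (m : ℤ) + (k + 1) + 1 = m + (k + 2) by ring]
  have h0 : surv m (k + 1) 0 = 1 := by
    rw [surv, kill_zero_of_mem]; push_cast; omega
  have h1 := hS 0
  simp only [convAdd]
  rw [Finset.sum_range_succ', h0]
  have e : ∀ s ∈ Finset.range t, (surv m (k + 1) (s + 1) - surv m (k + 1) (s + 1 + 1)) *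
      q (t + 1 - 1 - (s + 1)) = ((surv m k s - surv m k (s + 1)) * q (t - 1 - s) +
      2 * ((surv m (k + 1) s - surv m (k + 1) (s + 1)) * q (t - 1 - s)) +
      (surv m (k + 2) s - surv m (k + 2) (s + 1)) * q (t - 1 - s)) / 4 := by
    intro s _
    rw [show t + 1 - 1 - (s + 1) = t - 1 - s by omega]
    linear_combination q (t - 1 - s) * hS s - q (t - 1 - s) * hS (s + 1)
  rw [Finset.sum_congr rfl e, ← Finset.sum_div, Finset.sum_add_distrib, Finset.sum_add_distrib,
    ← Finset.mul_sum, hS t, h1, h0]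
  simp only [Nat.add_sub_cancel, Nat.sub_zero]
  ring

/-! ### The exit time as a sum of independent geometric times. -/

/-- The Chebyshev polynomials of the third kind. -/
noncomputable def chebV (i : ℕ) : ℝ[X] := Chebyshev.U ℝ i - Chebyshev.U ℝ (i - 1)

theorem X_mul_chebV (i : ℕ) :
    X * chebV i = (2⁻¹ : ℝ) • chebV (i + 1) + (2⁻¹ : ℝ) • chebV (i - 1) := by
  rw [chebV, mul_sub, X_mul_U, X_mul_U]
  rcases i with _ | i
  · have h2 : Chebyshev.U ℝ (-2) = -1 := by simp
    simp [chebV, h2, Chebyshev.U_neg_one]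
    module
  · simp only [chebV, Nat.add_sub_cancel]
    push_cast
    rw [add_sub_cancel_right, add_sub_cancel_right]
    module

theorem isLadder_chebV (n : ℕ) : IsLadder n chebV := fun i _ =>
  ⟨2⁻¹, 2⁻¹, by norm_num, by norm_num, X_mul_chebV i⟩

theorem natDegree_chebV_le (i : ℕ) : (chebV i).natDegree ≤ i := by
  refine (natDegree_sub_le _ _).trans (max_le ?_ ?_)
  · simp
  · rw [Chebyshev.natDegree_U]; omega

theorem eval_one_chebV (i : ℕ) : (chebV i).eval 1 = 1 := by
  simp [chebV, Chebyshev.U_eval_one]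

theorem shiftOp_convAdd {m k : ℕ} (hk : k < m) (q : ℕ → ℝ) :
    shiftOp (convAdd (surv m (k + 1)) q) =
      (2⁻¹ : ℝ) • (convAdd (surv m k) q + convAdd (surv m (k + 2)) q) := by
  ext t
  rw [shiftOp_apply, convAdd_surv_succ hk]
  simp only [Pi.smul_apply, Pi.add_apply, smul_eq_mul]
  ring

/-- Each rung moves the starting point one step outwards. At the centre, the equality of the
survival functions from `m` and `m + 1` matches the convention that rung `0` is its own lower
neighbour. -/
theorem aeval_chebV_convAdd {m : ℕ} (q : ℕ → ℝ) (k : ℕ) (hk : k ≤ m) :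
    aeval shiftOp (chebV k) (convAdd (surv m 1) q) = convAdd (surv m (k + 1)) q := by
  have hX : ∀ i, chebV (i + 1) = (2 : ℝ) • (X * chebV i) - chebV (i - 1) := by
    intro i; rw [X_mul_chebV]; module
  have h0 : aeval shiftOp (chebV 0) (convAdd (surv m 1) q) = convAdd (surv m 1) q := by
    simp [chebV, Chebyshev.U_neg_one]
  have hs : ∀ i, aeval shiftOp (chebV (i + 1)) (convAdd (surv m 1) q) =
      (2 : ℝ) • shiftOp (aeval shiftOp (chebV i) (convAdd (surv m 1) q)) -
        aeval shiftOp (chebV (i - 1)) (convAdd (surv m 1) q) := by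
    intro i
    rw [hX, map_sub, map_smul, map_mul, aeval_X]
    rfl
  induction k using Nat.twoStepInduction with
  | zero => exact h0
  | one =>
    rw [hs, h0, shiftOp_convAdd (by omega), surv_one]
    module
  | more k ih1 ih2 =>
    rw [hs, ih2 (by omega), shiftOp_convAdd (by omega), Nat.add_sub_cancel, ih1 (by omega)]
    module

/-- At rung `m` the walk starts at `2m + 1`, already outside, and only `q` remains. Both sides thus
have the same top rung and initial data, and the comparison principle used in both directions
identifies them. -/
theorem convAdd_eq_geoAdds {m : ℕ} (q : ℕ → ℝ) {a : ℝ} {r : ℕ → ℝ}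
    (hr : chebV m = C a * ∏ i ∈ Finset.range m, (X - C (r i))) :
    convAdd (surv m 0) q = geoAdds r m q := by
  have htop : aeval shiftOp (chebV m) (convAdd (surv m 1) q) =
      aeval shiftOp (chebV m) (geoAdds r m q) := by
    rw [aeval_chebV_convAdd q m le_rfl]
    have h0 : surv m (m + 1) = 0 := by
      ext t; rw [surv, kill_of_notMem _ (by push_cast; omega)]; rfl
    have h1 : a * ∏ i ∈ Finset.range m, (1 - r i) = 1 := by
      have := eval_one_chebV m
      rw [hr] at this
      simpa [eval_prod] using this
    rw [h0, convAdd_zero_left, hr, map_mul, Module.End.mul_apply, aeval_geoAdds, aeval_C,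
      Module.algebraMap_end_apply, smul_smul, h1, one_smul]
  have hbot : ∀ i < m, aeval shiftOp (chebV i) (convAdd (surv m 1) q) 0 =
      aeval shiftOp (chebV i) (geoAdds r m q) 0 := by
    intro i hi
    rw [aeval_chebV_convAdd q i hi.le, aeval_shiftOp_zero (d := m - 1)
      (fun t ht => geoAdds_eq_one _ _ _ t (by omega)) ((natDegree_chebV_le i).trans (by omega)),
      eval_one_chebV, convAdd, surv, kill_zero_of_mem (by push_cast; omega)]
    simp
  have h0 : ∀ w : ℕ → ℝ, aeval shiftOp (chebV 0) w = w := fun w => by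
    simp [chebV, Chebyshev.U_neg_one]
  rw [← surv_one]
  ext t
  have l1 := (isLadder_chebV m).aeval_le (fun i hi => (hbot i hi).le) (fun t => by rw [htop]) t 0
    (by omega)
  have l2 := (isLadder_chebV m).aeval_le (fun i hi => (hbot i hi).ge) (fun t => by rw [htop]) t 0
    (by omega)
  rw [h0, h0] at l1 l2
  exact le_antisymm l1 l2

/-- The roots of the Chebyshev polynomial of the third kind. -/
noncomputable def rootV (m i : ℕ) : ℝ := Real.cos ((2 * i + 1) * Real.pi / (2 * m + 1))

theorem chebV_eval_rootV {m i : ℕ} (hi : i < m) : (chebV m).eval (rootV m i) = 0 := by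
  set θ : ℝ := (2 * i + 1) * Real.pi / (2 * m + 1) with hθ
  have him : (i : ℝ) + 1 ≤ m := by exact_mod_cast hi
  have hπ := Real.pi_pos
  have h0 : 0 < θ := by positivity
  have h1 : θ < Real.pi := by
    rw [hθ, div_lt_iff₀ (by positivity)]; nlinarith
  have hsin := Real.sin_pos_of_pos_of_lt_pi h0 h1
  have e1 := Chebyshev.U_real_cos θ m
  have e2 := Chebyshev.U_real_cos θ (m - 1)
  have e3 : (((m : ℤ) : ℝ) + 1) * θ = (2 * i + 1) * Real.pi - m * θ := by
    rw [hθ]; push_cast; field_simp; ring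
  have e4 : Real.sin ((2 * i + 1) * Real.pi - m * θ) = Real.sin (m * θ) := by
    rw [show (2 * i + 1) * Real.pi - m * θ = Real.pi - m * θ + i * (2 * Real.pi) by ring,
      Real.sin_add_nat_mul_two_pi, Real.sin_pi_sub]
  rw [e3, e4] at e1
  push_cast at e2
  rw [sub_add_cancel] at e2
  have : (chebV m).eval (rootV m i) * Real.sin θ = 0 := by
    rw [chebV, eval_sub, rootV, ← hθ, sub_mul, e1, e2, sub_self]
  exact (mul_eq_zero.1 this).resolve_right hsin.ne'

theorem rootV_lt {m i j : ℕ} (hij : i < j) (hj : j < m) : rootV m j < rootV m i := by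
  have hjm : (j : ℝ) + 1 ≤ m := by exact_mod_cast hj
  have hπ := Real.pi_pos
  refine Real.cos_lt_cos_of_nonneg_of_le_pi (by positivity) ?_ ?_
  · rw [div_le_iff₀ (by positivity)]; nlinarith
  · gcongr

theorem rootV_le {m i : ℕ} (hi : i < m) : rootV m i ≤ rootV m 0 := by
  rcases Nat.eq_zero_or_pos i with rfl | h
  · exact le_rfl
  · exact (rootV_lt h hi).le

theorem rootV_mem (m i : ℕ) : rootV m i ∈ Set.Icc (-1 : ℝ) 1 :=
  ⟨Real.neg_one_le_cos _, Real.cos_le_one _⟩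

/-- After matching the coefficient of degree `m`, the difference has degree below `m` and `m`
distinct zeros. -/
theorem chebV_eq_prod (m : ℕ) :
    ∃ a : ℝ, chebV m = C a * ∏ i ∈ Finset.range m, (X - C (rootV m i)) := by
  refine ⟨(chebV m).coeff m, ?_⟩
  rw [← Lagrange.nodal_eq]
  set P := Lagrange.nodal (Finset.range m) (rootV m) with hP
  rw [← sub_eq_zero]
  have hinj : Set.InjOn (rootV m) (Finset.range m : Set ℕ) := by
    intro i hi j hj h
    rcases lt_trichotomy i j with hij | hij | hij
    · exact absurd h (rootV_lt hij (Finset.mem_range.1 hj)).ne'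
    · exact hij
    · exact absurd h (rootV_lt hij (Finset.mem_range.1 hi)).ne
  have hPdeg : P.natDegree = m := by
    rw [hP, Lagrange.natDegree_nodal, Finset.card_range]
  refine eq_zero_of_degree_lt_of_eval_index_eq_zero (Finset.range m) hinj ?_ fun i hi => ?_
  · rw [Finset.card_range, degree_lt_iff_coeff_zero]
    intro k hk
    rcases hk.lt_or_eq with h | rfl
    · rw [coeff_sub, coeff_C_mul, coeff_eq_zero_of_natDegree_lt ((natDegree_chebV_le m).trans_lt h),
        coeff_eq_zero_of_natDegree_lt (hPdeg.trans_lt h)]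
      simp
    · have h1 : P.coeff m = 1 := by
        have := Lagrange.nodal_monic (s := Finset.range m) (v := rootV m)
        rw [Monic, leadingCoeff, ← hP, hPdeg] at this
        exact this
      rw [coeff_sub, coeff_C_mul, h1, mul_one, sub_self]
  · rw [eval_sub, eval_mul, chebV_eval_rootV (Finset.mem_range.1 hi), hP,
      Lagrange.eval_nodal_at_node hi, mul_zero, sub_zero]

theorem convAdd_surv_eq (m : ℕ) (q : ℕ → ℝ) : convAdd (surv m 0) q = geoAdds (rootV m) m q := by
  obtain ⟨a, ha⟩ := chebV_eq_prod m
  exact convAdd_eq_geoAdds q ha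

theorem surv_eq (m : ℕ) : surv m 0 = geoAdds (rootV m) m 0 := by
  rw [← convAdd_surv_eq, convAdd_zero_right]

theorem isSurvival_surv (m : ℕ) : IsSurvival (surv m 0) := by
  rw [surv_eq]
  exact isSurvival_zero.geoAdds m fun i _ => rootV_mem m i

end RWRedistribution

namespace RWRedistribution

open Polynomial

/-! ### The bound on the evolution of differences -/

section Heat

variable {N : ℕ}

/-- The evolution of a function under the chain with redistribution `w`. -/
noncomputable def heat (w f : State N → ℝ) : ℕ → State N → ℝ
  | 0 => f
  | t + 1 => (2⁻¹ : ℝ) • (heat w f t + avg w (heat w f t))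

theorem heat_eq_pow_mulVec {ν : PMF (State N)} (hN : 2 < N) (hν : ParitySupport N ν)
    (f : State N → ℝ) (t : ℕ) :
    heat (fun z => (ν z).toReal) f t = (trans N ν ν ^ t).mulVec f := by
  induction t with
  | zero => simp [heat]
  | succ t ih => rw [heat, ih, pow_succ', ← Matrix.mulVec_mulVec, trans_mulVec hN hν]

theorem avg_apply (w f : State N → ℝ) (x : State N) :
    avg w f x = (bext w f ((x : ℕ) : ℤ) + bext w f (((x : ℕ) : ℤ) + 2)) / 2 := rfl

theorem bext_heat_succ (w f : State N → ℝ) (t : ℕ) {u : ℤ} (h1 : 1 ≤ u) (h2 : u ≤ N + 1) :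
    bext w (heat w f (t + 1)) u = (bext w (heat w f t) (u - 1) + 2 * bext w (heat w f t) u +
      bext w (heat w f t) (u + 1)) / 4 := by
  rw [heat, map_smul, Pi.smul_apply, map_add, Pi.add_apply, bext_avg w _ h1 h2, smul_eq_mul]
  ring

/-- The difference of a function and its mirror image vanishes at `0`, where both sides equal the
`w`-mean, and at the centre `2m + 1`; in between it evolves by the killed walk. -/
theorem abs_bext_sub_le {m : ℕ} {w f : State (4 * m) → ℝ}
    (hf0 : ∀ x, 0 ≤ f x) (hf1 : ∀ x, f x ≤ 1) (t : ℕ) {u : ℤ} (h0 : 0 ≤ u) (hu : u ≤ 2 * m + 1) :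
    |bext w (heat w f t) u - bext w (heat w f t) (4 * m + 2 - u)| ≤ kill (2 * m) t u := by
  have hbdry : ∀ t, ∀ u : ℤ, u = 0 ∨ u = 2 * m + 1 →
      |bext w (heat w f t) u - bext w (heat w f t) (4 * m + 2 - u)| ≤ kill (2 * m) t u := by
    intro t u hu
    rw [kill_of_notMem _ (by push_cast; omega)]
    rcases hu with rfl | rfl
    · rw [bext_of_notMem w _ (by omega), bext_of_notMem w _ (by push_cast; omega)]
      simp
    · rw [show 4 * (m : ℤ) + 2 - (2 * m + 1) = 2 * m + 1 by ring]
      simp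
  induction t generalizing u with
  | zero =>
    by_cases hb : u = 0 ∨ u = 2 * m + 1
    · exact hbdry 0 u hb
    · rw [kill_zero_of_mem (by push_cast; omega)]
      obtain ⟨x, hx⟩ := exists_state (N := 4 * m) (u := u) (by omega) (by push_cast; omega)
      obtain ⟨y, hy⟩ := exists_state (N := 4 * m) (u := 4 * m + 2 - u) (by omega)
        (by push_cast; omega)
      rw [heat, bext_of_mem w f x hx, bext_of_mem w f y hy, abs_le]
      have a1 := hf0 x
      have a2 := hf0 y
      have a3 := hf1 x
      have a4 := hf1 y
      constructor <;> linarith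
  | succ t ih =>
    by_cases hb : u = 0 ∨ u = 2 * m + 1
    · exact hbdry (t + 1) u hb
    · rw [kill_succ_of_mem t (by push_cast; omega), bext_heat_succ w f t (by omega)
        (by push_cast; omega), bext_heat_succ w f t (u := 4 * m + 2 - u) (by omega)
        (by push_cast; omega)]
      have i1 := abs_le.1 (ih (u := u - 1) (by omega) (by omega))
      have i2 := abs_le.1 (ih (u := u) (by omega) (by omega))
      have i3 := abs_le.1 (ih (u := u + 1) (by omega) (by omega))
      rw [show 4 * (m : ℤ) + 2 - (u - 1) = 4 * m + 2 - u + 1 by ring] at i1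
      rw [show 4 * (m : ℤ) + 2 - (u + 1) = 4 * m + 2 - u - 1 by ring] at i3
      rw [abs_le]
      constructor <;> linarith [i1.1, i1.2, i2.1, i2.2, i3.1, i3.2]

theorem abs_heat_sub_rev_le {m : ℕ} {w f : State (4 * m) → ℝ}
    (hf0 : ∀ x, 0 ≤ f x) (hf1 : ∀ x, f x ≤ 1) (t : ℕ) (x : State (4 * m)) :
    |heat w f t x - heat w f t x.rev| ≤ surv m 0 t := by
  have key : ∀ x : State (4 * m), (x : ℕ) ≤ 2 * m →
      |heat w f t x - heat w f t x.rev| ≤ surv m 0 t := by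
    intro x hx
    have h := abs_bext_sub_le (w := w) hf0 hf1 t (u := (x : ℕ) + 1) (by omega) (by omega)
    rw [bext_of_mem w _ x rfl, bext_of_mem w _ x.rev (by rw [Fin.val_rev]; omega)] at h
    refine h.trans ?_
    rw [surv, Nat.cast_zero, add_zero]
    exact kill_le_center m t _
  rcases le_total (x : ℕ) (2 * m) with h | h
  · exact key x h
  · rw [abs_sub_comm]
    have := key x.rev (by rw [Fin.val_rev]; omega)
    rwa [Fin.rev_rev] at this

/-- Along the evolution, `shiftOp` in time is `avg w` in space, so polynomial identities for the
operator become recursions in `t`. -/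
theorem aeval_shiftOp_heat (w f : State N → ℝ) (x y : State N) (p : ℝ[X]) (t : ℕ) :
    aeval shiftOp p (fun t => heat w f t x - heat w f t y) t =
      aeval (avg w) p (heat w f t) x - aeval (avg w) p (heat w f t) y := by
  induction p using Polynomial.induction_on' generalizing t with
  | add p q hp hq =>
    simp only [map_add, LinearMap.add_apply, Pi.add_apply, hp, hq]
    ring
  | monomial n a =>
    have h : ∀ n, ∀ t, (shiftOp ^ n) (fun t => heat w f t x - heat w f t y) t =
        (avg w ^ n) (heat w f t) x - (avg w ^ n) (heat w f t) y := by
      intro n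
      induction n with
      | zero => intro t; rfl
      | succ n ih =>
        intro t
        rw [pow_succ', Module.End.mul_apply, shiftOp_apply, ih, ih, heat, map_smul, map_add,
          pow_succ, Module.End.mul_apply]
        simp only [Pi.smul_apply, Pi.add_apply, smul_eq_mul]
        ring
    rw [aeval_monomial, aeval_monomial, Module.End.mul_apply, Module.End.mul_apply,
      Module.algebraMap_end_apply, Module.algebraMap_end_apply, Pi.smul_apply, Pi.smul_apply,
      Pi.smul_apply, h]
    simp only [smul_eq_mul]
    ring

/-! ### The bound by three exit times. -/

/-- The parity assumption for a redistribution weight. -/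
structure IsParityWeight (m : ℕ) (w : State (4 * m) → ℝ) : Prop where
  nonneg : ∀ z, 0 ≤ w z
  sum : ∑ z, w z = 1
  odd : ∀ z, w z ≠ 0 → Odd (z : ℕ)
  three_le : ∀ z, w z ≠ 0 → 3 ≤ (z : ℕ)
  add_three_le : ∀ z, w z ≠ 0 → (z : ℕ) + 3 ≤ 4 * m

variable {m : ℕ} {w : State (4 * m) → ℝ}

/-- The polynomial equalising the symmetric part of a function over each parity class. -/
noncomputable def equaliser (m : ℕ) (w : State (4 * m) → ℝ) : ℝ[X] :=
  chebSum (centerMass w (2 * m + 1)) (2 * m) ((2 * m - 1 : ℕ) : ℤ)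

theorem IsParityWeight.odd_centerDist (hw : IsParityWeight m w) (z : State (4 * m)) (hz : w z ≠ 0) :
    Odd (centerDist (2 * m + 1) z + (2 * m + 1) + 1) := by
  obtain ⟨k, hk⟩ := hw.odd z hz
  rw [Nat.odd_iff]
  unfold centerDist
  omega

theorem IsParityWeight.centerDist_le (hw : IsParityWeight m w) (z : State (4 * m)) (hz : w z ≠ 0) :
    centerDist (2 * m + 1) z + 4 ≤ 2 * m + 1 := by
  have h1 := hw.three_le z hz
  have h2 := hw.add_three_le z hz
  unfold centerDist
  omega

theorem equaliser_eval (hm : 0 < m) (hw : IsParityWeight m w) (s : ℝ) :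
    4 * (1 - s ^ 2) * (equaliser m w).eval s =
      2 * (∑ z, w z * (Chebyshev.T ℝ (centerDist (2 * m + 1) z : ℕ)).eval s -
        (Chebyshev.T ℝ (2 * m + 1 : ℕ)).eval s) := by
  have h := congrArg (fun p => eval s p) (equaliser_identity (h := 2 * m + 1) hw.odd_centerDist
    (fun z hz => by have := hw.centerDist_le z hz; omega) hw.sum)
  rw [show ((2 * m + 1 : ℕ) : ℤ) - 2 = (2 * m - 1 : ℕ) by omega] at h
  simpa [equaliser, eval_finsetSum] using h

/-- The symmetric part cancels. The antisymmetric part is at most half of `surv` in modulus, and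
positivity on the cone costs the factor `R(1)` at each of `x` and `y`. -/
theorem aeval_equaliser_sub_le (hm : 0 < m) (hw : IsParityWeight m w)
    (hcone : equaliser m w ∈ chebCone (2 * m - 1)) {f : State (4 * m) → ℝ} (hf0 : ∀ x, 0 ≤ f x)
    (hf1 : ∀ x, f x ≤ 1) {x y : State (4 * m)} (hxy : Even ((x : ℕ) + y)) (t : ℕ) :
    aeval (avg w) (equaliser m w) (heat w f t) x - aeval (avg w) (equaliser m w) (heat w f t) y ≤
      (equaliser m w).eval 1 * surv m 0 t := by
  set g := heat w f t with hg
  set S : State (4 * m) → ℝ := fun x => (g x + g x.rev) / 2 with hS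
  set D : State (4 * m) → ℝ := fun x => (g x - g x.rev) / 2 with hD
  have hgSD : g = S + D := by ext x; simp only [hS, hD, Pi.add_apply]; ring
  have hSsym : ∀ x, S x.rev = S x := fun x => by simp only [hS, Fin.rev_rev]; ring
  have hDle : ∀ x, |D x| ≤ surv m 0 t / 2 := fun x => by
    have := abs_heat_sub_rev_le (w := w) hf0 hf1 t x
    rw [hD, abs_div, abs_two]
    linarith
  have e := aeval_equaliser (w := w) (f := S) (h := 2 * m + 1) (by ring) ⟨2 * m, by ring⟩
    hw.odd_centerDist (fun z hz => by have := hw.centerDist_le z hz; omega) hw.sum hSsym hxy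
  rw [show ((2 * m + 1 : ℕ) : ℤ) - 2 = (2 * m - 1 : ℕ) by omega] at e
  change aeval (avg w) (equaliser m w) S x = aeval (avg w) (equaliser m w) S y at e
  rw [hgSD, map_add, Pi.add_apply, Pi.add_apply, e]
  have b1 := aeval_le_of_mem_chebCone hw.nonneg hw.sum (fun x => (abs_le.1 (hDle x)).2)
    (by omega) hcone x
  have b2 := aeval_le_of_mem_chebCone (f := -D) (K := surv m 0 t / 2) hw.nonneg hw.sum
    (fun x => by have := (abs_le.1 (hDle x)).1; simp only [Pi.neg_apply]; linarith)
    (by omega) hcone y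
  rw [map_neg, Pi.neg_apply] at b2
  linarith

/-- At the `2m` nodes `cos ((i + 1) π / (2m + 1))` the polynomial `T_{2m+1}` equals `±1`, while the
`w`-average of the other `T`s is at most `1` in modulus; hence the equaliser alternates weakly in
sign. -/
theorem equaliser_eq_prod (hm : 0 < m) (hw : IsParityWeight m w)
    (hdeg : (equaliser m w).natDegree ≤ 2 * m - 1) :
    ∃ (a : ℝ) (r : ℕ → ℝ), (∀ i < 2 * m - 1, r i ∈ Set.Icc (-1 : ℝ) 1 ∧
      r i ≤ Real.cos ((i + 1) * Real.pi / (2 * m + 1))) ∧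
      equaliser m w = C a * ∏ i ∈ Finset.range (2 * m - 1), (X - C (r i)) := by
  have hπ := Real.pi_pos
  obtain ⟨a, r, hr, ha⟩ := exists_roots_of_alternating (2 * m - 1) (equaliser m w) hdeg
    (fun i => Real.cos ((i + 1) * Real.pi / (2 * m + 1)))
    (fun i hi => by
      have : (i : ℝ) + 2 ≤ 2 * m := by exact_mod_cast (by omega : i + 2 ≤ 2 * m)
      refine Real.cos_lt_cos_of_nonneg_of_le_pi (by positivity) ?_ ?_
      · rw [div_le_iff₀ (by positivity)]; push_cast; nlinarith
      · push_cast; gcongr; linarith)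
    (fun i hi => by
      have hi' : (i : ℝ) + 1 ≤ 2 * m := by exact_mod_cast (by omega : i + 1 ≤ 2 * m)
      set θ : ℝ := (i + 1) * Real.pi / (2 * m + 1) with hθ
      have h0 : 0 < θ := by positivity
      have h1 : θ < Real.pi := by rw [hθ, div_lt_iff₀ (by positivity)]; nlinarith
      have hsin := Real.sin_pos_of_pos_of_lt_pi h0 h1
      have e := equaliser_eval hm hw (Real.cos θ)
      have hs : 1 - Real.cos θ ^ 2 = Real.sin θ ^ 2 := by rw [Real.sin_sq]
      have hT : (Chebyshev.T ℝ (2 * m + 1 : ℕ)).eval (Real.cos θ) = -(-1) ^ i := by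
        rw [Chebyshev.T_real_cos, show (((2 * m + 1 : ℕ) : ℤ) : ℝ) * θ = (i + 1 : ℕ) * Real.pi by
          rw [hθ]; push_cast; field_simp, Real.cos_nat_mul_pi, pow_succ]
        ring
      have hsum : |∑ z, w z * (Chebyshev.T ℝ (centerDist (2 * m + 1) z : ℕ)).eval (Real.cos θ)| ≤ 1 := by
        refine (Finset.abs_sum_le_sum_abs _ _).trans ?_
        rw [← hw.sum]
        refine Finset.sum_le_sum fun z _ => ?_
        rw [abs_mul, abs_of_nonneg (hw.nonneg z), Chebyshev.T_real_cos]
        exact mul_le_of_le_one_right (hw.nonneg z) (Real.abs_cos_le_one _)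
      rw [hs, hT] at e
      have hpos : 0 < 4 * Real.sin θ ^ 2 := by positivity
      refine nonneg_of_mul_nonneg_right (b := (-1) ^ i * (equaliser m w).eval (Real.cos θ)) ?_ hpos
      obtain ⟨s1, s2⟩ := abs_le.1 hsum
      rcases neg_one_pow_eq_or ℝ i with h | h <;> rw [h] at e ⊢ <;> linarith)
  refine ⟨a, r, fun i hi => ⟨⟨(Real.neg_one_le_cos _).trans (hr i hi).1,
    (hr i hi).2.trans (Real.cos_le_one _)⟩, (hr i hi).2⟩, ha⟩

/-- Differences of the evolution over a parity class are bounded by the survival function of the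
sum of three exit times. -/
theorem heat_sub_le (hm : 0 < m) (hw : IsParityWeight m w) {f : State (4 * m) → ℝ}
    (hf0 : ∀ x, 0 ≤ f x) (hf1 : ∀ x, f x ≤ 1) {x y : State (4 * m)} (hxy : Even ((x : ℕ) + y))
    (t : ℕ) : heat w f t x - heat w f t y ≤
      convAdd (surv m 0) (convAdd (surv m 0) (surv m 0)) t := by
  have hb0 : centerMass w (2 * m + 1) 0 = 1 := by
    rw [← hw.sum]
    refine Finset.sum_congr rfl fun z _ => ?_
    by_cases hz : w z = 0
    · simp [hz]
    · rw [if_pos (by have := hw.centerDist_le z hz; omega)]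
  have hbz : ∀ l, 2 * m - 1 < l + 1 → centerMass w (2 * m + 1) l = 0 := fun l hl =>
    Finset.sum_eq_zero fun z _ => if_neg (by omega)
  obtain ⟨p, hp, hpr, -, hcone, c, hc, hp0⟩ := exists_isLadder (2 * m - 1)
    (centerMass w (2 * m + 1)) (centerMass_antitone hw.nonneg _) (fun l hl => hbz l (by omega))
    (by rw [hb0, hbz _ (by omega)]; exact one_pos)
  have hR : p (2 * m - 1) = equaliser m w := by
    rw [hpr, equaliser, show 2 * m - 1 + 1 = 2 * m by omega]
  have hRcone : equaliser m w ∈ chebCone (2 * m - 1) := hR ▸ hcone _ le_rfl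
  obtain ⟨a, r, hr, ha⟩ := equaliser_eq_prod hm hw (natDegree_le_of_mem_chebCone hRcone)
  have hq := isSurvival_surv m
  have h1 : ∀ t, heat w f t x - heat w f t y ≤ geoAdds r (2 * m - 1) (surv m 0) t := by
    intro t
    have hle := hp.aeval_le (y := fun t => heat w f t x - heat w f t y)
      (w := geoAdds r (2 * m - 1) (surv m 0))
      -- Initial data: the geometric sum is `1` up to time `2m - 2`, which covers the degree of a
      -- lower rung, so the right side is `p i` at `1`. The left side is a difference of two values
      -- in `[0, (p i).eval 1]`.
      (fun i hi => by
        have hci := chebCone_mono (show i ≤ 2 * m - 1 by omega) (hcone i hi.le)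
        rw [aeval_shiftOp_heat, aeval_shiftOp_zero (d := 2 * m - 2)
          (fun t ht => geoAdds_eq_one _ _ _ t (by omega))
          ((natDegree_le_of_mem_chebCone (hcone i hi.le)).trans (by omega)), heat]
        have b1 := aeval_le_of_mem_chebCone hw.nonneg hw.sum hf1 (by omega) hci x
        have b2 := aeval_nonneg_of_mem_chebCone hw.nonneg hf0 (by omega) hci y
        linarith)
      (fun t => by
        rw [aeval_shiftOp_heat, hR]
        refine (aeval_equaliser_sub_le hm hw hRcone hf0 hf1 hxy t).trans (le_of_eq ?_)
        rw [ha, map_mul, Module.End.mul_apply, aeval_geoAdds, aeval_C, Module.algebraMap_end_apply]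
        simp [eval_prod, mul_assoc]) t 0 (by omega)
    rw [hp0, aeval_C, Module.algebraMap_end_apply, Module.algebraMap_end_apply, Pi.smul_apply,
      Pi.smul_apply, smul_eq_mul, smul_eq_mul] at hle
    exact le_of_mul_le_mul_left hle hc
  -- The parameter `-1` adds a deterministic unit of time. This only increases the sum, and it makes
  -- the number of factors even for the pairing.
  set r' : ℕ → ℝ := fun i => if i < 2 * m - 1 then r i else -1 with hr'
  have hr'mem : ∀ i < 2 * m, r' i ∈ Set.Icc (-1 : ℝ) 1 := by
    intro i _
    by_cases h : i < 2 * m - 1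
    · simpa only [hr', if_pos h] using (hr i h).1
    · simp only [hr', if_neg h]; norm_num
  have hr'le : ∀ i, r' i ≤ Real.cos ((i + 1) * Real.pi / (2 * m + 1)) := by
    intro i
    by_cases h : i < 2 * m - 1
    · simpa only [hr', if_pos h] using (hr i h).2
    · simp only [hr', if_neg h]; exact Real.neg_one_le_cos _
  have hcongr : ∀ k ≤ 2 * m - 1, geoAdds r k (surv m 0) = geoAdds r' k (surv m 0) := by
    intro k
    induction k with
    | zero => intro _; rfl
    | succ k ih =>
      intro hk
      rw [geoAdds, geoAdds, ih (by omega)]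
      simp only [hr', if_pos (show k < 2 * m - 1 by omega)]
  have h2 : geoAdds r (2 * m - 1) (surv m 0) t ≤ geoAdds r' (2 * m) (surv m 0) t := by
    rw [hcongr _ le_rfl]
    obtain ⟨n, hn⟩ : ∃ n, 2 * m = n + 1 := ⟨2 * m - 1, by omega⟩
    rw [hn, Nat.add_sub_cancel, geoAdds]
    exact (hq.geoAdds n fun i hi => hr'mem i (by omega)).le_geoAdd (hr'mem n (by omega)) t
  have hπ := Real.pi_pos
  refine (h1 t).trans (h2.trans ?_)
  rw [convAdd_surv_eq, convAdd_surv_eq]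
  -- The node bounding root `2 i` is exactly `rootV m i`, and the one bounding root `2 i + 1` lies
  -- below it.
  refine geoAdds_two_mul_le hq m hr'mem (fun i _ => rootV_mem m i) (fun i hi => ⟨?_, ?_⟩) t
  · have := hr'le (2 * i)
    push_cast at this
    exact this
  · refine (hr'le (2 * i + 1)).trans ?_
    have hi' : (i : ℝ) + 1 ≤ m := by exact_mod_cast hi
    refine Real.cos_le_cos_of_nonneg_of_le_pi (by positivity) ?_ ?_
    · rw [div_le_iff₀ (by positivity)]; push_cast; nlinarith
    · push_cast; gcongr; linarith

end Heat

end RWRedistribution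

namespace RWRedistribution

/-! ### The law of sums of independent exit times -/

section SumOfTimes

theorem measureReal_lt_add {Ω Ω' : Type*} [MeasurableSpace Ω] [MeasurableSpace Ω'] (μ : Measure Ω)
    (ν : Measure Ω') [IsProbabilityMeasure μ] [IsProbabilityMeasure ν] {τ : Ω → ℕ∞} {σ : Ω' → ℕ∞}
    (hτ : Measurable τ) (hσ : Measurable σ) (t : ℕ) :
    (μ.prod ν).real {p | (t : ℕ∞) < τ p.1 + σ p.2} =
      convAdd (fun t => μ.real {ω | (t : ℕ∞) < τ ω}) (fun t => ν.real {ω | (t : ℕ∞) < σ ω}) t := by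
  have mτ : ∀ A : Set ℕ∞, MeasurableSet {ω | τ ω ∈ A} := fun A => hτ (MeasurableSet.of_discrete)
  have mσ : ∀ A : Set ℕ∞, MeasurableSet {ω | σ ω ∈ A} := fun A => hσ (MeasurableSet.of_discrete)
  have hset : {p : Ω × Ω' | (t : ℕ∞) < τ p.1 + σ p.2} = {ω | τ ω ∈ Set.Ioi (t : ℕ∞)} ×ˢ Set.univ ∪
      ⋃ s ∈ Finset.range (t + 1), {ω | τ ω = (s : ℕ∞)} ×ˢ {ω | σ ω ∈ Set.Ioi ((t - s : ℕ) : ℕ∞)} := by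
    ext ⟨ω, ω'⟩
    simp only [Set.mem_ofPred_eq, Set.mem_union, Set.mem_prod, Set.mem_univ, and_true, Set.mem_iUnion,
      Finset.mem_range, Set.mem_Ioi, exists_prop]
    induction h : τ ω using ENat.recTopCoe with
    | top => simp
    | coe a =>
      induction h' : σ ω' using ENat.recTopCoe with
      | top =>
        simp only [add_top, ENat.natCast_lt_top, true_iff, Nat.cast_inj, Nat.cast_lt]
        by_cases hat : t < a
        · exact Or.inl hat
        · exact Or.inr ⟨a, by omega, rfl, trivial⟩
      | coe b =>
        rw [← Nat.cast_add]
        simp only [Nat.cast_inj, Nat.cast_lt]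
        constructor
        · intro hab
          by_cases hat : t < a
          · exact Or.inl hat
          · exact Or.inr ⟨a, by omega, rfl, by omega⟩
        · rintro (h1 | ⟨s, h1, rfl, h2⟩) <;> omega
  have hS : ∀ s : ℕ, μ.real {ω | τ ω = ((s + 1 : ℕ) : ℕ∞)} =
      μ.real {ω | (s : ℕ∞) < τ ω} - μ.real {ω | ((s + 1 : ℕ) : ℕ∞) < τ ω} := by
    intro s
    rw [eq_sub_iff_add_eq, ← measureReal_union (s₁ := {ω | τ ω = ((s + 1 : ℕ) : ℕ∞)})]
    · congr 1
      ext ω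
      simp only [Set.mem_union, Set.mem_ofPred_eq]
      induction τ ω using ENat.recTopCoe with
      | top => simp
      | coe a => simp only [Nat.cast_inj, Nat.cast_lt]; omega
    · rw [Set.disjoint_left]
      intro ω h1 h2
      simp only [Set.mem_ofPred_eq] at h1 h2
      rw [h1] at h2
      exact lt_irrefl _ h2
    · exact mτ (Set.Ioi _)
  have hS0 : μ.real {ω | τ ω = ((0 : ℕ) : ℕ∞)} = 1 - μ.real {ω | ((0 : ℕ) : ℕ∞) < τ ω} := by
    refine Eq.trans ?_ (probReal_compl_eq_one_sub (mτ (Set.Ioi ((0 : ℕ) : ℕ∞))))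
    congr 1
    ext ω
    simp
  rw [hset, measureReal_union ?_ ?_ (measure_ne_top _ _) (measure_ne_top _ _), measureReal_prod_prod, probReal_univ, mul_one,
    measureReal_biUnion_finset, Finset.sum_range_succ']
  · simp only [measureReal_prod_prod, hS, hS0, convAdd, Set.mem_Ioi, Nat.sub_zero]
    rw [add_assoc]
    congr 1
    rw [add_comm]
    congr 1
    refine Finset.sum_congr rfl fun s hs => ?_
    rw [show t - (s + 1) = t - 1 - s by omega]
  · intro s _ s' _ hne
    rw [Function.onFun, Set.disjoint_left]
    rintro ⟨ω, ω'⟩ ⟨h1, _⟩ ⟨h2, _⟩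
    simp only [Set.mem_ofPred_eq] at h1 h2
    exact hne (Nat.cast_injective (h1.symm.trans h2))
  · exact fun s _ => (mτ {(s : ℕ∞)}).prod (mσ _)
  · rw [Set.disjoint_left]
    rintro ⟨ω, ω'⟩ ⟨h1, _⟩ h2
    simp only [Set.mem_iUnion, Finset.mem_range, exists_prop] at h2
    obtain ⟨s, hs, ⟨h2, _⟩⟩ := h2
    simp only [Set.mem_ofPred_eq, Set.mem_Ioi] at h1 h2
    rw [h2, Nat.cast_lt] at h1
    omega
  · exact Finset.measurableSet_biUnion _ fun s _ => (mτ {(s : ℕ∞)}).prod (mσ _)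

/-- Prepend a term to a sequence. -/
def seqCons {α : Type*} (p : α × (ℕ → α)) : ℕ → α
  | 0 => p.1
  | n + 1 => p.2 n

theorem measurable_seqCons {α : Type*} [MeasurableSpace α] : Measurable (seqCons (α := α)) := by
  refine measurable_pi_lambda _ fun n => ?_
  cases n with
  | zero => exact measurable_fst
  | succ n => exact (measurable_pi_apply n).comp measurable_snd

/-- This is what permits conditioning on the first step of the walk; it is checked on cylinders. -/
theorem map_seqCons {α : Type*} [MeasurableSpace α] (μ : Measure α) [IsProbabilityMeasure μ] :
    (μ.prod (Measure.infinitePi fun _ : ℕ => μ)).map seqCons =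
      Measure.infinitePi fun _ : ℕ => μ := by
  refine Measure.eq_infinitePi _ fun s t ht => ?_
  obtain ⟨n, hn⟩ : ∃ n, s ⊆ Finset.range (n + 1) :=
    ⟨s.sup id, fun i hi => Finset.mem_range.2 (Nat.lt_succ_of_le (Finset.le_sup (f := id) hi))⟩
  set t' : ℕ → Set α := fun i => if i ∈ s then t i else Set.univ with ht'
  have hmeas : ∀ i, MeasurableSet (t' i) := fun i => by
    simp only [ht']; split_ifs
    · exact ht i
    · exact MeasurableSet.univ
  have h1 : Set.pi (s : Set ℕ) t = Set.pi (Finset.range (n + 1) : Set ℕ) t' := by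
    ext x
    simp only [Set.mem_pi, Finset.mem_coe, ht']
    constructor
    · intro h i _
      split_ifs with hi
      · exact h i hi
      · trivial
    · intro h i hi
      simpa [hi] using h i (hn hi)
  have h2 : ∏ i ∈ s, μ (t i) = ∏ i ∈ Finset.range (n + 1), μ (t' i) := by
    rw [← Finset.prod_subset hn]
    · exact Finset.prod_congr rfl fun i hi => by simp [ht', hi]
    · intro i _ hi; simp [ht', hi]
  have h3 : seqCons ⁻¹' Set.pi (Finset.range (n + 1) : Set ℕ) t' =
      t' 0 ×ˢ Set.pi (Finset.range n : Set ℕ) fun i => t' (i + 1) := by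
    ext ⟨a, ξ⟩
    simp only [Set.mem_preimage, Set.mem_pi, Finset.mem_coe, Finset.mem_range, Set.mem_prod]
    constructor
    · intro h
      exact ⟨h 0 (by omega), fun i hi => h (i + 1) (by omega)⟩
    · rintro ⟨h, h'⟩ i hi
      cases i with
      | zero => exact h
      | succ i => exact h' i (by omega)
  rw [h1, h2, Measure.map_apply measurable_seqCons
    (MeasurableSet.pi (Finset.countable_toSet _) fun i _ => hmeas i), h3, Measure.prod_prod,
    Measure.infinitePi_pi _ fun i _ => hmeas (i + 1), Finset.prod_range_succ', mul_comm]

theorem walk_seqCons_succ (z a : ℤ) (ξ : ℕ → ℤ) (n : ℕ) :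
    walk z (seqCons (a, ξ)) (n + 1) = walk (z + a) ξ n := by
  rw [walk, walk, Finset.sum_range_succ']
  simp only [seqCons]
  ring

theorem measurable_walk (z : ℤ) (n : ℕ) : Measurable fun ξ : ℕ → ℤ => walk z ξ n :=
  measurable_const.add (Finset.measurable_sum _ fun i _ => measurable_pi_apply i)

theorem measurableSet_survive (L : ℕ) (z : ℤ) (t : ℕ) :
    MeasurableSet {ξ | ∀ n ≤ t, walk z ξ n ∈ Set.Icc (1 : ℤ) L} := by
  have : {ξ | ∀ n ≤ t, walk z ξ n ∈ Set.Icc (1 : ℤ) L} =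
      ⋂ n ∈ Set.Iic t, (fun ξ => walk z ξ n) ⁻¹' Set.Icc (1 : ℤ) L := by
    ext ξ; simp
  rw [this]
  exact MeasurableSet.biInter (Set.to_countable _) fun n _ =>
    measurable_walk z n MeasurableSet.of_discrete

theorem lintegral_stepLaw (f : ℤ → ENNReal) :
    ∫⁻ a, f a ∂stepLaw = 2⁻¹ * f 0 + 4⁻¹ * f 1 + 4⁻¹ * f (-1) := by
  rw [stepLaw, lintegral_add_measure, lintegral_add_measure, lintegral_smul_measure,
    lintegral_smul_measure, lintegral_smul_measure, lintegral_dirac, lintegral_dirac,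
    lintegral_dirac]
  simp only [smul_eq_mul]

theorem measure_survive (L : ℕ) (z : ℤ) (t : ℕ) :
    (Measure.infinitePi fun _ : ℕ => stepLaw) {ξ | ∀ n ≤ t, walk z ξ n ∈ Set.Icc (1 : ℤ) L} =
      ENNReal.ofReal (kill L t z) := by
  induction t generalizing z with
  | zero =>
    by_cases h : 1 ≤ z ∧ z ≤ L
    · rw [kill_zero_of_mem h, ENNReal.ofReal_one, ← measure_univ (μ := Measure.infinitePi fun _ : ℕ => stepLaw)]
      congr 1
      ext ξ
      simp [walk, h]
    · rw [kill_of_notMem 0 h, ENNReal.ofReal_zero, ← measure_empty (μ := Measure.infinitePi fun _ : ℕ => stepLaw)]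
      congr 1
      ext ξ
      simpa [walk] using h
  | succ t ih =>
    rw [← map_seqCons, Measure.map_apply measurable_seqCons (measurableSet_survive L z _)]
    by_cases h : 1 ≤ z ∧ z ≤ L
    · rw [Measure.prod_apply (measurable_seqCons (measurableSet_survive L z _))]
      have hset : ∀ a : ℤ, Prod.mk a ⁻¹' (seqCons ⁻¹'
          {ξ | ∀ n ≤ t + 1, walk z ξ n ∈ Set.Icc (1 : ℤ) L}) =
          {ξ | ∀ n ≤ t, walk (z + a) ξ n ∈ Set.Icc (1 : ℤ) L} := by
        intro a
        ext ξ
        simp only [Set.mem_preimage, Set.mem_ofPred_eq]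
        constructor
        · intro h' n hn
          rw [← walk_seqCons_succ]
          exact h' (n + 1) (by omega)
        · intro h' n hn
          cases n with
          | zero => simpa [walk] using h
          | succ n => rw [walk_seqCons_succ]; exact h' n (by omega)
      simp only [hset, ih]
      rw [lintegral_stepLaw, kill_succ_of_mem t h, add_zero]
      have e2 : (2⁻¹ : ENNReal) = ENNReal.ofReal 2⁻¹ := by
        rw [ENNReal.ofReal_inv_of_pos two_pos]; norm_num
      have e4 : (4⁻¹ : ENNReal) = ENNReal.ofReal 4⁻¹ := by
        rw [ENNReal.ofReal_inv_of_pos four_pos]; norm_num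
      have k1 := kill_nonneg L t z
      have k2 := kill_nonneg L t (z + 1)
      have k3 := kill_nonneg L t (z + -1)
      rw [e2, e4, ← ENNReal.ofReal_mul (by norm_num), ← ENNReal.ofReal_mul (by norm_num),
        ← ENNReal.ofReal_mul (by norm_num), ← ENNReal.ofReal_add (by positivity) (by positivity),
        ← ENNReal.ofReal_add (by positivity) (by positivity)]
      congr 1
      rw [← sub_eq_add_neg]
      ring
    · rw [kill_of_notMem _ h, ENNReal.ofReal_zero]
      convert measure_empty (μ := stepLaw.prod (Measure.infinitePi fun _ : ℕ => stepLaw))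
      ext ⟨a, ξ⟩
      simp only [Set.mem_preimage, Set.mem_ofPred_eq, Set.mem_empty_iff_false, iff_false]
      intro h'
      exact h (by simpa [walk] using h' 0 (by omega))

theorem lt_exitTime_iff (L t : ℕ) (ξ : ℕ → ℤ) : (t : ℕ∞) < exitTime L ξ ↔
    ∀ n ≤ t, walk (((L + 1) / 2 : ℕ) : ℤ) ξ n ∈ Set.Icc (1 : ℤ) L := by
  rw [exitTime]
  constructor
  · intro h n hn
    by_contra h'
    have := h.trans_le (iInf₂_le n h')
    rw [Nat.cast_lt] at this
    omega
  · intro h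
    refine lt_of_lt_of_le (b := ((t + 1 : ℕ) : ℕ∞)) (by rw [Nat.cast_lt]; omega)
      (le_iInf₂ fun n hn => ?_)
    rw [Nat.cast_le]
    by_contra h'
    exact hn (h n (by omega))

theorem measurable_of_lt {Ω : Type*} [MeasurableSpace Ω] {τ : Ω → ℕ∞}
    (h : ∀ t : ℕ, MeasurableSet {ω | (t : ℕ∞) < τ ω}) : Measurable τ := by
  rw [ENat.measurable_iff]
  intro n
  cases n with
  | zero =>
    convert (h 0).compl using 1
    ext ω
    simp
  | succ n =>
    convert (h n).diff (h (n + 1)) using 1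
    ext ω
    simp only [Set.mem_preimage, Set.mem_singleton_iff, Set.mem_sdiff, Set.mem_ofPred_eq]
    induction τ ω using ENat.recTopCoe with
    | top =>
      exact iff_of_false (fun h => ENat.natCast_ne_top _ h.symm) fun h => h.2 (ENat.natCast_lt_top _)
    | coe a => simp only [Nat.cast_inj, Nat.cast_lt]; omega

theorem measurable_exitTime (L : ℕ) : Measurable (exitTime L) :=
  measurable_of_lt fun t => by
    simp only [lt_exitTime_iff]
    exact measurableSet_survive L _ t

theorem measureReal_lt_exitTime (m t : ℕ) :
    (Measure.infinitePi fun _ : ℕ => stepLaw).real {ξ | (t : ℕ∞) < exitTime (2 * m) ξ} =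
      surv m 0 t := by
  simp only [lt_exitTime_iff, measureReal_def, measure_survive]
  rw [ENNReal.toReal_ofReal (kill_nonneg _ _ _), show (2 * m + 1) / 2 = m by omega, surv]
  simp

instance (m : ℕ) : IsProbabilityMeasure (walksLaw m) := by
  unfold walksLaw; infer_instance

theorem walksLaw_succ (m k t : ℕ) :
    (walksLaw (m + 1)).real {ξ | (t : ℕ∞) < ∑ i, exitTime (2 * k) (ξ i)} =
      convAdd (surv k 0)
        (fun t => (walksLaw m).real {ξ | (t : ℕ∞) < ∑ i, exitTime (2 * k) (ξ i)}) t := by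
  have hmp := measurePreserving_piFinSuccAbove (n := m)
    (fun _ => Measure.infinitePi fun _ : ℕ => stepLaw) 0
  have hm : Measurable fun ξ : Fin m → ℕ → ℤ => ∑ i, exitTime (2 * k) (ξ i) :=
    Finset.measurable_sum _ fun i _ => (measurable_exitTime _).comp (measurable_pi_apply i)
  have h := measureReal_lt_add (Measure.infinitePi fun _ : ℕ => stepLaw) (walksLaw m)
    (measurable_exitTime (2 * k)) hm t
  simp only [measureReal_lt_exitTime] at h
  rw [← show _ = convAdd (surv k 0) _ t from h, measureReal_def, measureReal_def]
  congr 1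
  unfold walksLaw
  refine Eq.trans ?_ (hmp.measure_preimage_equiv _)
  congr 1
  ext ξ
  simp [Fin.sum_univ_succ, MeasurableEquiv.piFinSuccAbove, Fin.tail]

theorem walksLaw_three (k t : ℕ) :
    (walksLaw 3).real {ξ | (t : ℕ∞) < ∑ i, exitTime (2 * k) (ξ i)} =
      convAdd (surv k 0) (convAdd (surv k 0) (surv k 0)) t := by
  have h0 : (fun t : ℕ => (walksLaw 0).real {ξ | (t : ℕ∞) < ∑ i, exitTime (2 * k) (ξ i)}) = 0 := by
    ext t; simp
  have h1 := funext fun t => walksLaw_succ 0 k t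
  have h2 := funext fun t => walksLaw_succ 1 k t
  rw [h0, convAdd_zero_right] at h1
  rw [walksLaw_succ, h2, h1]

end SumOfTimes

end RWRedistribution

namespace RWRedistribution

open ProbabilityTheory

/-! ### Existence of inhomogeneous Markov chains -/

/-- Events determined by the first `n + 1` terms of a sequence. -/
def IsPrefixSet {E : Type*} (n : ℕ) (G : Set (ℕ → E)) : Prop :=
  ∀ ω ω' : ℕ → E, (∀ i ≤ n, ω i = ω' i) → ω ∈ G → ω' ∈ G

theorem IsPrefixSet.eq_preimage {E : Type*} {n : ℕ} {G : Set (ℕ → E)} (hG : IsPrefixSet n G) :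
    G = Preorder.frestrictLe n ⁻¹' {h | ∃ ω ∈ G, ∀ i : Finset.Iic n, ω i = h i} := by
  ext ω
  constructor
  · exact fun h => ⟨ω, h, fun _ => rfl⟩
  · rintro ⟨ω', h, h'⟩
    exact hG ω' ω (fun i hi => h' ⟨i, Finset.mem_Iic.2 hi⟩) h

section Markov

variable {E : Type*} [Fintype E] [MeasurableSpace E] [MeasurableSingletonClass E]

theorem IsPrefixSet.measurableSet {n : ℕ} {G : Set (ℕ → E)} (hG : IsPrefixSet n G) :
    MeasurableSet G := by
  rw [hG.eq_preimage]
  exact Preorder.measurable_frestrictLe n MeasurableSet.of_discrete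

/-- The Ionescu-Tulcea construction. The Markov property is stated for all events of the past,
because later ones involve flags and hidden paths. -/
theorem exists_markov (p : ℕ → E → E → ℝ) (hp : ∀ n e e', 0 ≤ p n e e')
    (hp1 : ∀ n e, ∑ e', p n e e' = 1) (e₀ : E) :
    ∃ ρ : Measure (ℕ → E), IsProbabilityMeasure ρ ∧ (∀ᵐ ω ∂ρ, ω 0 = e₀) ∧
      ∀ n G, IsPrefixSet n G → ∀ e' q, (∀ ω ∈ G, p n (ω n) e' = q) →
        ρ.real (G ∩ {ω | ω (n + 1) = e'}) = ρ.real G * q := by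
  classical
  set k : ℕ → Kernel E E := fun n => Kernel.ofFunOfCountable fun e =>
    (PMF.ofFintype (fun e' => ENNReal.ofReal (p n e e')) (by
      rw [← ENNReal.ofReal_sum_of_nonneg fun i _ => hp n e i, hp1, ENNReal.ofReal_one])).toMeasure
    with hk
  have hkm : ∀ n, IsMarkovKernel (k n) := fun n => ⟨fun e => PMF.toMeasure.isProbabilityMeasure _⟩
  have hks : ∀ n e e', k n e {e'} = ENNReal.ofReal (p n e e') := by
    intro n e e'
    simp only [hk]
    refine (PMF.toMeasure_apply_singleton _ _ (measurableSet_singleton _)).trans ?_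
    simp
  set κ : (n : ℕ) → Kernel ((i : Finset.Iic n) → E) E := fun n =>
    (k n).comap (fun h => h ⟨n, Finset.mem_Iic.2 le_rfl⟩) (measurable_pi_apply _) with hκ
  have hκm : ∀ n, IsMarkovKernel (κ n) := fun n => by rw [hκ]; infer_instance
  set ρ : Measure (ℕ → E) := Kernel.traj (X := fun _ => E) κ 0 (fun _ => e₀) with hρ
  refine ⟨ρ, by rw [hρ]; infer_instance, ?_, fun n G hG e' q hq => ?_⟩
  · have h := Kernel.traj_map_frestrictLe_apply (X := fun _ => E) (κ := κ) 0 0 (fun _ => e₀)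
    rw [Kernel.partialTraj_self, Kernel.id_apply, ← hρ] at h
    have h2 : ∀ᵐ g ∂(Measure.dirac (fun _ => e₀ : Finset.Iic 0 → E)),
        g ⟨0, Finset.mem_Iic.2 le_rfl⟩ = e₀ := by
      rw [ae_dirac_eq]
      rfl
    rw [← h] at h2
    exact ae_of_ae_map (Preorder.measurable_frestrictLe 0).aemeasurable h2
  · have h := Kernel.partialTraj_compProd_eq_map_traj (X := fun _ => E) (κ := κ) (Nat.zero_le n)
      (x₀ := fun _ => e₀)
    rw [← Kernel.traj_map_frestrictLe_apply, ← hρ] at h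
    set C : Set (Finset.Iic n → E) := {h | ∃ ω ∈ G, ∀ i : Finset.Iic n, ω i = h i} with hC
    have hGC : G = Preorder.frestrictLe n ⁻¹' C := hG.eq_preimage
    have h2 := DFunLike.congr_fun h (C ×ˢ {e'})
    rw [Measure.compProd_apply_prod MeasurableSet.of_discrete (measurableSet_singleton _),
      Measure.map_apply (by fun_prop) (MeasurableSet.of_discrete.prod (measurableSet_singleton _))]
      at h2
    have h3 : ∀ h ∈ C, κ n h {e'} = ENNReal.ofReal q := by
      rintro h ⟨ω, hω, hω'⟩
      rw [hκ, Kernel.comap_apply, hks, ← hω' ⟨n, Finset.mem_Iic.2 le_rfl⟩]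
      exact congrArg _ (hq ω hω)
    rw [setLIntegral_congr_fun MeasurableSet.of_discrete h3, setLIntegral_const,
      Measure.map_apply (Preorder.measurable_frestrictLe n) MeasurableSet.of_discrete, ← hGC] at h2
    have h4 : (fun x : ℕ → E => (Preorder.frestrictLe n x, x (n + 1))) ⁻¹' C ×ˢ {e'} =
        G ∩ {ω | ω (n + 1) = e'} := by
      rw [hGC]; rfl
    rw [h4] at h2
    rw [measureReal_def, ← h2, ENNReal.toReal_mul, mul_comm, measureReal_def]
    by_cases hne : G.Nonempty
    · obtain ⟨ω, hω⟩ := hne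
      rw [ENNReal.toReal_ofReal (by rw [← hq ω hω]; exact hp _ _ _)]
    · rw [Set.not_nonempty_iff_eq_empty.1 hne]
      simp

theorem measure_ext_of_prefix {μ ν : Measure (ℕ → E)} [IsFiniteMeasure μ] [IsFiniteMeasure ν]
    (h : ∀ (n : ℕ) (o : ℕ → E), μ.real {ω | ∀ i ≤ n, ω i = o i} = ν.real {ω | ∀ i ≤ n, ω i = o i}) :
    μ = ν := by
  have hmap : ∀ n : ℕ, μ.map (Preorder.frestrictLe n) = ν.map (Preorder.frestrictLe n) := by
    intro n
    refine Measure.ext_of_singleton fun g => ?_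
    rw [Measure.map_apply (Preorder.measurable_frestrictLe n) (measurableSet_singleton _),
      Measure.map_apply (Preorder.measurable_frestrictLe n) (measurableSet_singleton _)]
    rcases isEmpty_or_nonempty E with hE | ⟨⟨e⟩⟩
    · exact (hE.false (g ⟨0, Finset.mem_Iic.2 (Nat.zero_le n)⟩)).elim
    have hset : (Preorder.frestrictLe n ⁻¹' {g} : Set (ℕ → E)) =
        {ω | ∀ i ≤ n, ω i = if hi : i ∈ Finset.Iic n then g ⟨i, hi⟩ else e} := by
      ext ω
      simp only [Set.mem_preimage, Set.mem_singleton_iff, Set.mem_ofPred_eq]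
      constructor
      · rintro rfl i hi
        rw [dif_pos (Finset.mem_Iic.2 hi)]
        rfl
      · intro h
        ext i
        have := h i (Finset.mem_Iic.1 i.2)
        rwa [dif_pos i.2] at this
    rw [hset]
    have := h n fun i => if hi : i ∈ Finset.Iic n then g ⟨i, hi⟩ else e
    rwa [measureReal_def, measureReal_def,
      ENNReal.toReal_eq_toReal_iff' (measure_ne_top _ _) (measure_ne_top _ _)] at this
  have hproj : ∀ μ : Measure (ℕ → E), IsProjectiveMeasureFamily (α := fun _ : ℕ => E)
      fun I => μ.map I.restrict := by
    intro μ I J hJI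
    rw [Measure.map_map (by fun_prop) (by fun_prop)]
    rfl
  have h1 := (isProjectiveLimit_nat_iff (hproj ν) μ).2 hmap
  have h2 : IsProjectiveLimit ν (fun I => ν.map I.restrict) := fun I => rfl
  exact h1.unique h2

end Markov

end RWRedistribution

namespace RWRedistribution

open ProbabilityTheory

/-! ### Chains with a killing clock -/

section Flag

variable {S : Type}

theorem isPrefixSet_of_forall {E : Type*} {n : ℕ} {Q : ℕ → (ℕ → E) → Prop}
    (h : ∀ i ≤ n, ∀ ω ω' : ℕ → E, (∀ j ≤ n, ω j = ω' j) → Q i ω → Q i ω') :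
    IsPrefixSet n {ω | ∀ i ≤ n, Q i ω} :=
  fun ω ω' hω hQ i hi => h i hi ω ω' hω (hQ i hi)

theorem IsPrefixSet.inter {E : Type*} {n : ℕ} {G G' : Set (ℕ → E)} (h : IsPrefixSet n G)
    (h' : IsPrefixSet n G') : IsPrefixSet n (G ∩ G') :=
  fun ω ω' hω hG => ⟨h ω ω' hω hG.1, h' ω ω' hω hG.2⟩

theorem isPrefixSet_eval {E : Type*} {n i : ℕ} (hi : i ≤ n) (Q : E → Prop) :
    IsPrefixSet n {ω : ℕ → E | Q (ω i)} := fun ω ω' hω h => by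
  simpa only [Set.mem_ofPred_eq, ← hω i hi] using h

/-- The event that no flag has been raised up to time `n`. -/
def unflagged (S : Type) (n : ℕ) : Set (ℕ → S × Bool) := {ω | ∀ i ≤ n, (ω i).2 = false}

theorem isPrefixSet_unflagged (n : ℕ) : IsPrefixSet n (unflagged S n) :=
  isPrefixSet_of_forall fun i hi ω ω' hω h => by rw [← hω i hi]; exact h

theorem unflagged_succ (n : ℕ) :
    unflagged S (n + 1) = unflagged S n ∩ {ω | (ω (n + 1)).2 = false} := by
  ext ω
  constructor
  · exact fun h => ⟨fun i hi => h i (by omega), h (n + 1) le_rfl⟩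
  · rintro ⟨h, h'⟩ i hi
    rcases Nat.le_succ_iff.1 hi with h1 | rfl
    · exact h i h1
    · exact h'

open Classical in
/-- Hide the chain up to the first flag. -/
noncomputable def hide (s : S) (ω : ℕ → S × Bool) (n : ℕ) : S × Bool :=
  if ω ∈ unflagged S n then (s, false) else ((ω n).1, true)

theorem hide_of_mem (s : S) {ω : ℕ → S × Bool} {n : ℕ} (h : ω ∈ unflagged S n) :
    hide s ω n = (s, false) := if_pos h

theorem hide_of_notMem (s : S) {ω : ℕ → S × Bool} {n : ℕ} (h : ω ∉ unflagged S n) :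
    hide s ω n = ((ω n).1, true) := if_neg h

theorem hide_snd_eq_false {s : S} {ω : ℕ → S × Bool} {n : ℕ} :
    (hide s ω n).2 = false ↔ ω ∈ unflagged S n := by
  by_cases h : ω ∈ unflagged S n
  · simp [hide_of_mem s h, h]
  · simp [hide_of_notMem s h, h]

theorem unflagged_anti {n k : ℕ} (h : n ≤ k) : unflagged S k ⊆ unflagged S n :=
  fun _ hω i hi => hω i (hi.trans h)

theorem isPrefixSet_hide (s : S) (o : ℕ → S × Bool) (n : ℕ) :
    IsPrefixSet n {ω | ∀ i ≤ n, hide s ω i = o i} := by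
  refine isPrefixSet_of_forall fun i hi ω ω' hω h => ?_
  rw [← h]
  by_cases hu : ω ∈ unflagged S i
  · rw [hide_of_mem s hu, hide_of_mem s (isPrefixSet_unflagged i ω ω' (fun j hj => hω j (by omega)) hu)]
  · rw [hide_of_notMem s hu, hide_of_notMem s (fun hu' => hu (isPrefixSet_unflagged i ω' ω
      (fun j hj => (hω j (by omega)).symm) hu')), hω i hi]

theorem hide_set_unflagged (s : S) (o : ℕ → S × Bool) (n : ℕ) (ho : ∀ i ≤ n, o i = (s, false)) :
    {ω | ∀ i ≤ n, hide s ω i = o i} = unflagged S n := by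
  ext ω
  constructor
  · intro h
    rw [← hide_snd_eq_false (s := s), h n le_rfl, ho n le_rfl]
  · intro h i hi
    rw [ho i hi, hide_of_mem s (unflagged_anti hi h)]

theorem hide_set_empty (s : S) (o : ℕ → S × Bool) (n : ℕ) (hon : (o n).2 = false)
    (ho : ¬ ∀ i ≤ n, o i = (s, false)) : {ω : ℕ → S × Bool | ∀ i ≤ n, hide s ω i = o i} = ∅ := by
  rw [Set.eq_empty_iff_forall_notMem]
  intro ω h
  refine ho fun i hi => ?_
  rw [← h i hi]
  have := h n le_rfl
  rw [← this, hide_snd_eq_false] at hon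
  exact hide_of_mem s (unflagged_anti hi hon)

theorem isMarkovChain_of_flagged [MeasurableSpace S] {P : Matrix S S ℝ} {x : S} {ρ : Measure (ℕ → S × Bool)}
    (h0 : ∀ᵐ ω ∂ρ, ω 0 = (x, false))
    (hM : ∀ n G, IsPrefixSet n G → ∀ a b, (∀ ω ∈ G, (ω n).1 = a) →
        ρ.real (G ∩ {ω | (ω (n + 1)).1 = b}) = ρ.real G * P a b) :
    IsMarkovChain ρ P x fun n ω => (ω n).1 where
  measurable n := measurable_fst.comp (measurable_pi_apply n)
  init := by filter_upwards [h0] with ω hω; rw [hω]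
  markov n a := by
    rw [← hM n {ω | ∀ i ≤ n, (ω i).1 = a i}
      (isPrefixSet_of_forall fun i hi ω ω' hω h => by rw [← hω i hi]; exact h) (a n) (a (n + 1))
      fun ω hω => hω n le_rfl]
    congr 1
    ext ω
    simp only [Set.mem_ofPred_eq, Set.mem_inter_iff]
    constructor
    · exact fun h => ⟨fun i hi => h i (by omega), h (n + 1) le_rfl⟩
    · rintro ⟨h, h'⟩ i hi
      rcases Nat.le_succ_iff.1 hi with h1 | rfl
      · exact h i h1
      · exact h'

variable [Fintype S] [MeasurableSpace S] [MeasurableSingletonClass S]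

/-- On arrival at `b` the flag stays down with probability `A (n + 1) b / (A n P) b`. It does not
influence the chain, and the mass with no flag so far is exactly `A`. -/
theorem exists_flagged {P : Matrix S S ℝ} (hP : ∀ a b, 0 ≤ P a b) (hP1 : ∀ a, ∑ b, P a b = 1)
    (x : S) {A : ℕ → S → ℝ} (hA : ∀ n a, 0 ≤ A n a) (hA0 : ∀ a, A 0 a = ({x} : Set S).indicator 1 a)
    (hAP : ∀ n b, A (n + 1) b ≤ ∑ a, A n a * P a b) :
    ∃ ρ : Measure (ℕ → S × Bool), IsProbabilityMeasure ρ ∧ (∀ᵐ ω ∂ρ, ω 0 = (x, false)) ∧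
      (∀ n G, IsPrefixSet n G → ∀ a b, (∀ ω ∈ G, (ω n).1 = a) →
        ρ.real (G ∩ {ω | (ω (n + 1)).1 = b}) = ρ.real G * P a b) ∧
      ∀ n a, ρ.real (unflagged S n ∩ {ω | (ω n).1 = a}) = A n a := by
  classical
  set r : ℕ → S → ℝ := fun n b => A (n + 1) b / ∑ a, A n a * P a b with hr
  have hnn : ∀ n b, 0 ≤ ∑ a, A n a * P a b := fun n b =>
    Finset.sum_nonneg fun a _ => mul_nonneg (hA n a) (hP a b)
  have hr0 : ∀ n b, 0 ≤ r n b := fun n b => div_nonneg (hA _ _) (hnn n b)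
  have hr1 : ∀ n b, r n b ≤ 1 := fun n b => div_le_one_of_le₀ (hAP n b) (hnn n b)
  have hrA : ∀ n b, (∑ a, A n a * P a b) * r n b = A (n + 1) b := by
    intro n b
    -- Where the denominator vanishes the quotient is `0` by convention, and so is the mass `A (n +
    -- 1) b`.
    rcases (hnn n b).eq_or_lt with h | h
    · have := hAP n b
      rw [← h] at this ⊢
      rw [zero_mul]
      exact le_antisymm (hA _ _) this
    · exact mul_div_cancel₀ _ h.ne'
  obtain ⟨ρ, hρ, hρ0, hρM⟩ := exists_markov (E := S × Bool)
    (fun n e e' => P e.1 e'.1 * if e'.2 then 1 - r n e'.1 else r n e'.1)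
    (fun n e e' => mul_nonneg (hP _ _) (by
      split_ifs
      · exact sub_nonneg.2 (hr1 _ _)
      · exact hr0 _ _))
    (fun n e => by
      rw [Fintype.sum_prod_type]
      refine Eq.trans (Finset.sum_congr rfl fun b _ => ?_) (hP1 e.1)
      rw [Fintype.sum_bool]
      simp only [if_true, Bool.false_eq_true, if_false]
      ring) (x, false)
  refine ⟨ρ, hρ, hρ0, fun n G hG a b hGa => ?_, ?_⟩
  · have hs : G ∩ {ω | (ω (n + 1)).1 = b} = (G ∩ {ω | ω (n + 1) = (b, true)}) ∪
        (G ∩ {ω | ω (n + 1) = (b, false)}) := by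
      rw [← Set.inter_union_distrib_left]
      congr 1
      ext ω
      simp only [Set.mem_ofPred_eq, Set.mem_union]
      rcases h : ω (n + 1) with ⟨c, _ | _⟩ <;> simp
    have hm : MeasurableSet (G ∩ {ω | ω (n + 1) = (b, false)}) :=
      hG.measurableSet.inter (measurable_pi_apply (n + 1) (measurableSet_singleton _))
    rw [hs, measureReal_union _ hm, hρM n G hG _ (P a b * (1 - r n b)) fun ω hω => by
        simp [hGa ω hω], hρM n G hG _ (P a b * r n b) fun ω hω => by simp [hGa ω hω]]
    · ring
    · rw [Set.disjoint_left]
      rintro ω ⟨_, h1⟩ ⟨_, h2⟩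
      simp only [Set.mem_ofPred_eq] at h1 h2
      rw [h1] at h2
      simp at h2
  · intro n
    induction n with
    | zero =>
      intro a
      rw [hA0]
      by_cases h : a = x
      · subst h
        rw [Set.indicator_of_mem (Set.mem_singleton a), Pi.one_apply, ← probReal_univ (μ := ρ)]
        refine measureReal_congr ?_
        filter_upwards [hρ0] with ω hω
        refine propext (iff_of_true ⟨fun i hi => ?_, ?_⟩ trivial)
        · obtain rfl : i = 0 := by omega
          rw [hω]
        · simp [hω]
      · rw [Set.indicator_of_notMem (by simpa using h), ← measureReal_empty (μ := ρ)]
        refine measureReal_congr ?_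
        filter_upwards [hρ0] with ω hω
        refine propext (iff_of_false ?_ (by exact fun h => h))
        rintro ⟨_, h'⟩
        simp only [Set.mem_ofPred_eq, hω] at h'
        exact h h'.symm
    | succ n ih =>
      intro b
      have hs : unflagged S (n + 1) ∩ {ω | (ω (n + 1)).1 = b} = ⋃ a ∈ Finset.univ,
          (unflagged S n ∩ {ω | (ω n).1 = a}) ∩ {ω | ω (n + 1) = (b, false)} := by
        rw [unflagged_succ]
        ext ω
        simp only [Set.mem_inter_iff, Set.mem_ofPred_eq, Finset.mem_univ, Set.mem_iUnion,
          Prod.ext_iff, exists_prop, true_and]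
        constructor
        · rintro ⟨⟨h1, h2⟩, h3⟩
          exact ⟨_, ⟨h1, rfl⟩, h3, h2⟩
        · rintro ⟨a, ⟨h1, _⟩, h3, h2⟩
          exact ⟨⟨h1, h2⟩, h3⟩
      have hpre : ∀ a, IsPrefixSet n (unflagged S n ∩ {ω | (ω n).1 = a}) := fun a =>
        (isPrefixSet_unflagged n).inter (isPrefixSet_eval le_rfl fun e : S × Bool => e.1 = a)
      rw [hs, measureReal_biUnion_finset]
      · rw [← hrA, Finset.sum_mul]
        refine Finset.sum_congr rfl fun a _ => ?_
        rw [hρM n _ (hpre a) _ (P a b * r n b) fun ω hω => by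
          have : (ω n).1 = a := hω.2
          simp [this], ih]
        ring
      · intro a _ a' _ hne
        rw [Function.onFun, Set.disjoint_left]
        rintro ω ⟨⟨_, h1⟩, _⟩ ⟨⟨_, h2⟩, _⟩
        exact hne (h1.symm.trans h2)
      · exact fun a _ => (hpre a).measurableSet.inter
          (measurable_pi_apply (n + 1) (measurableSet_singleton _))

theorem measurable_hide (s : S) : Measurable (hide (S := S) s) := by
  classical
  refine measurable_pi_lambda _ fun n => ?_
  exact Measurable.ite (isPrefixSet_unflagged n).measurableSet measurable_const
    ((measurable_fst.comp (measurable_pi_apply n)).prodMk measurable_const)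

theorem measureReal_unflagged {ρ : Measure (ℕ → S × Bool)} [IsFiniteMeasure ρ] {A : ℕ → S → ℝ}
    (hA : ∀ n a, ρ.real (unflagged S n ∩ {ω | (ω n).1 = a}) = A n a) (n : ℕ) :
    ρ.real (unflagged S n) = ∑ a, A n a := by
  have hs : unflagged S n = ⋃ a ∈ Finset.univ, unflagged S n ∩ {ω | (ω n).1 = a} := by
    ext ω; simp
  rw [hs, measureReal_biUnion_finset]
  · exact Finset.sum_congr rfl fun a _ => hA n a
  · intro a _ a' _ hne
    rw [Function.onFun, Set.disjoint_left]
    rintro ω ⟨_, h1⟩ ⟨_, h2⟩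
    exact hne (h1.symm.trans h2)
  · exact fun a _ => ((isPrefixSet_unflagged n).inter
      (isPrefixSet_eval le_rfl fun e : S × Bool => e.1 = a)).measurableSet

theorem measureReal_unflagged_step {P : Matrix S S ℝ} {ρ : Measure (ℕ → S × Bool)}
    [IsFiniteMeasure ρ] {A : ℕ → S → ℝ}
    (hM : ∀ n G, IsPrefixSet n G → ∀ a b, (∀ ω ∈ G, (ω n).1 = a) →
        ρ.real (G ∩ {ω | (ω (n + 1)).1 = b}) = ρ.real G * P a b)
    (hA : ∀ n a, ρ.real (unflagged S n ∩ {ω | (ω n).1 = a}) = A n a) (n : ℕ) (b : S) :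
    ρ.real ((unflagged S n \ unflagged S (n + 1)) ∩ {ω | (ω (n + 1)).1 = b}) =
      ∑ a, A n a * P a b - A (n + 1) b := by
  have hpre : ∀ a, IsPrefixSet n (unflagged S n ∩ {ω | (ω n).1 = a}) := fun a =>
    (isPrefixSet_unflagged n).inter (isPrefixSet_eval le_rfl fun e : S × Bool => e.1 = a)
  have hmb : MeasurableSet {ω : ℕ → S × Bool | (ω (n + 1)).1 = b} :=
    (isPrefixSet_eval (n := n + 1) le_rfl fun e : S × Bool => e.1 = b).measurableSet
  have h1 : ρ.real (unflagged S n ∩ {ω | (ω (n + 1)).1 = b}) = ∑ a, A n a * P a b := by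
    have hs : unflagged S n ∩ {ω | (ω (n + 1)).1 = b} = ⋃ a ∈ Finset.univ,
        (unflagged S n ∩ {ω | (ω n).1 = a}) ∩ {ω | (ω (n + 1)).1 = b} := by
      ext ω; simp
    rw [hs, measureReal_biUnion_finset]
    · refine Finset.sum_congr rfl fun a _ => ?_
      rw [hM n _ (hpre a) a b fun ω hω => hω.2, hA]
    · intro a _ a' _ hne
      rw [Function.onFun, Set.disjoint_left]
      rintro ω ⟨⟨_, h1⟩, _⟩ ⟨⟨_, h2⟩, _⟩
      exact hne (h1.symm.trans h2)
    · exact fun a _ => (hpre a).measurableSet.inter hmb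
  rw [← h1, ← hA, eq_sub_iff_add_eq, ← measureReal_union]
  · congr 1
    ext ω
    simp only [Set.mem_union, Set.mem_inter_iff, Set.mem_sdiff]
    have := @unflagged_anti S n (n + 1) (by omega) ω
    tauto
  · rw [Set.disjoint_left]
    rintro ω ⟨⟨_, h⟩, _⟩ ⟨h', _⟩
    exact h h'
  · exact (isPrefixSet_unflagged (n + 1)).measurableSet.inter hmb

/-- The law of the hidden path depends only on the total unflagged mass, the flux into each state at
the first flag, and `P` afterwards. -/
theorem hide_law_eq {P : Matrix S S ℝ} {x y s : S} {ρ ρ' : Measure (ℕ → S × Bool)}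
    [IsProbabilityMeasure ρ] [IsProbabilityMeasure ρ'] {A B : ℕ → S → ℝ}
    (h0 : ∀ᵐ ω ∂ρ, ω 0 = (x, false)) (h0' : ∀ᵐ ω ∂ρ', ω 0 = (y, false))
    (hM : ∀ n G, IsPrefixSet n G → ∀ a b, (∀ ω ∈ G, (ω n).1 = a) →
        ρ.real (G ∩ {ω | (ω (n + 1)).1 = b}) = ρ.real G * P a b)
    (hM' : ∀ n G, IsPrefixSet n G → ∀ a b, (∀ ω ∈ G, (ω n).1 = a) →
        ρ'.real (G ∩ {ω | (ω (n + 1)).1 = b}) = ρ'.real G * P a b)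
    (hA : ∀ n a, ρ.real (unflagged S n ∩ {ω | (ω n).1 = a}) = A n a)
    (hB : ∀ n a, ρ'.real (unflagged S n ∩ {ω | (ω n).1 = a}) = B n a)
    (hsum : ∀ n, ∑ a, A n a = ∑ a, B n a)
    (hstep : ∀ n b, ∑ a, A n a * P a b - A (n + 1) b = ∑ a, B n a * P a b - B (n + 1) b) :
    ρ.map (hide s) = ρ'.map (hide s) := by
  have hpm := Measure.isProbabilityMeasure_map (μ := ρ) (measurable_hide s).aemeasurable
  have hpm' := Measure.isProbabilityMeasure_map (μ := ρ') (measurable_hide s).aemeasurable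
  refine measure_ext_of_prefix fun n o => ?_
  have hmeas : ∀ n, MeasurableSet {ω : ℕ → S × Bool | ∀ i ≤ n, ω i = o i} := fun n =>
    (isPrefixSet_of_forall (n := n) fun i hi ω ω' hω h => by rw [← hω i hi]; exact h).measurableSet
  rw [map_measureReal_apply (measurable_hide s) (hmeas n),
    map_measureReal_apply (measurable_hide s) (hmeas n)]
  change ρ.real {ω | ∀ i ≤ n, hide s ω i = o i} = ρ'.real {ω | ∀ i ≤ n, hide s ω i = o i}
  have hfalse : ∀ n, (o n).2 = false → ρ.real {ω | ∀ i ≤ n, hide s ω i = o i} =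
      ρ'.real {ω | ∀ i ≤ n, hide s ω i = o i} := by
    intro n hon
    by_cases ho : ∀ i ≤ n, o i = (s, false)
    · rw [hide_set_unflagged s o n ho, measureReal_unflagged hA, measureReal_unflagged hB, hsum]
    · rw [hide_set_empty s o n hon ho, measureReal_empty, measureReal_empty]
  induction n with
  | zero =>
    rcases hon : (o 0).2
    · exact hfalse 0 hon
    · have hz : ∀ (ρ : Measure (ℕ → S × Bool)) (x : S), (∀ᵐ ω ∂ρ, ω 0 = (x, false)) →
          ρ.real {ω | ∀ i ≤ 0, hide s ω i = o i} = 0 := by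
        intro ρ x h0
        rw [← measureReal_empty (μ := ρ)]
        refine measureReal_congr ?_
        filter_upwards [h0] with ω hω
        refine propext (iff_of_false (fun h => ?_) (by exact fun h => h))
        have h1 := h 0 le_rfl
        have h2 : ω ∈ unflagged S 0 := fun i hi => by
          obtain rfl : i = 0 := by omega
          rw [hω]
        rw [hide_of_mem s h2] at h1
        rw [← h1] at hon
        simp at hon
      rw [hz ρ x h0, hz ρ' y h0']
  | succ n ih =>
    rcases hon1 : (o (n + 1)).2
    · exact hfalse (n + 1) hon1
    · obtain ⟨d, hd⟩ : ∃ d, o (n + 1) = (d, true) := ⟨(o (n + 1)).1, by rw [← hon1]⟩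
      rcases hon : (o n).2
      · by_cases ho : ∀ i ≤ n, o i = (s, false)
        · have hset : {ω | ∀ i ≤ n + 1, hide s ω i = o i} =
              (unflagged S n \ unflagged S (n + 1)) ∩ {ω | (ω (n + 1)).1 = d} := by
            ext ω
            have e := Set.ext_iff.1 (hide_set_unflagged s o n ho) ω
            simp only [Set.mem_ofPred_eq] at e
            simp only [Set.mem_ofPred_eq, Set.mem_inter_iff, Set.mem_sdiff, ← e]
            constructor
            · intro h
              have h1 := h (n + 1) le_rfl
              have h2 : ω ∉ unflagged S (n + 1) := by
                rw [← hide_snd_eq_false (s := s), h1, hd]; simp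
              rw [hide_of_notMem s h2, hd] at h1
              exact ⟨⟨fun i hi => h i (by omega), h2⟩, (Prod.ext_iff.1 h1).1⟩
            · rintro ⟨⟨h, h2⟩, h3⟩ i hi
              rcases Nat.le_succ_iff.1 hi with h1 | rfl
              · exact h i h1
              · rw [hide_of_notMem s h2, hd, h3]
          rw [hset, measureReal_unflagged_step hM hA, measureReal_unflagged_step hM' hB, hstep]
        · have hemp : {ω | ∀ i ≤ n + 1, hide s ω i = o i} = ∅ := by
            rw [Set.eq_empty_iff_forall_notMem]
            intro ω h
            exact Set.eq_empty_iff_forall_notMem.1 (hide_set_empty s o n hon ho) ω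
              fun i hi => h i (by omega)
          rw [hemp, measureReal_empty, measureReal_empty]
      · have hset : {ω | ∀ i ≤ n + 1, hide s ω i = o i} =
            {ω | ∀ i ≤ n, hide s ω i = o i} ∩ {ω | (ω (n + 1)).1 = d} := by
          ext ω
          simp only [Set.mem_ofPred_eq, Set.mem_inter_iff]
          constructor
          · intro h
            have h1 := h (n + 1) le_rfl
            have h2 : ω ∉ unflagged S (n + 1) := by
              rw [← hide_snd_eq_false (s := s), h1, hd]; simp
            rw [hide_of_notMem s h2, hd] at h1
            exact ⟨fun i hi => h i (by omega), (Prod.ext_iff.1 h1).1⟩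
          · rintro ⟨h, h3⟩ i hi
            rcases Nat.le_succ_iff.1 hi with h1 | rfl
            · exact h i h1
            · have h2 : ω ∉ unflagged S n := by
                rw [← hide_snd_eq_false (s := s), h n le_rfl, hon]; simp
              rw [hide_of_notMem s fun h' => h2 (unflagged_anti (by omega) h'), hd, h3]
        have hn : ∀ ω ∈ {ω | ∀ i ≤ n, hide s ω i = o i}, (ω n).1 = (o n).1 := by
          intro ω h
          have h1 := h n le_rfl
          have h2 : ω ∉ unflagged S n := by
            rw [← hide_snd_eq_false (s := s), h1, hon]; simp
          rw [hide_of_notMem s h2] at h1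
          exact (Prod.ext_iff.1 h1).1
        rw [hset, hM n _ (isPrefixSet_hide s o n) _ d hn, hM' n _ (isPrefixSet_hide s o n) _ d hn,
          ih]

end Flag

end RWRedistribution

namespace RWRedistribution

open ProbabilityTheory

/-! ### Maximal couplings -/

section Excess

variable {S : Type} [Fintype S] [DecidableEq S]

theorem pow_stochastic {P : Matrix S S ℝ} (hP1 : ∀ a, ∑ b, P a b = 1) (n : ℕ) (a : S) :
    ∑ b, (P ^ n) a b = 1 := by
  induction n with
  | zero => simp [Matrix.one_apply]
  | succ n ih =>
    simp only [pow_succ, Matrix.mul_apply]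
    rw [Finset.sum_comm]
    simp only [← Finset.mul_sum, hP1, mul_one, ih]

/-- The positive part of the difference of the laws at time `n`. -/
noncomputable def excess (P : Matrix S S ℝ) (x y : S) (n : ℕ) (z : S) : ℝ :=
  max ((P ^ n) x z - (P ^ n) y z) 0

theorem excess_sub (P : Matrix S S ℝ) (x y : S) (n : ℕ) (z : S) :
    excess P x y n z - excess P y x n z = (P ^ n) x z - (P ^ n) y z := by
  unfold excess
  rcases le_total ((P ^ n) x z) ((P ^ n) y z) with h | h
  · rw [max_eq_right (by linarith), max_eq_left (by linarith)]; ring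
  · rw [max_eq_left (by linarith), max_eq_right (by linarith)]; ring

theorem excess_eq_zero_or (P : Matrix S S ℝ) (x y : S) (n : ℕ) (z : S) :
    excess P x y n z = 0 ∨ excess P y x n z = 0 := by
  unfold excess
  rcases le_total ((P ^ n) x z) ((P ^ n) y z) with h | h
  · exact Or.inl (max_eq_right (by linarith))
  · exact Or.inr (max_eq_right (by linarith))

theorem excess_succ_le {P : Matrix S S ℝ} (hP : ∀ a b, 0 ≤ P a b) (x y : S) (n : ℕ)
    (b : S) : excess P x y (n + 1) b ≤ ∑ a, excess P x y n a * P a b := by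
  refine max_le ?_ (Finset.sum_nonneg fun a _ => mul_nonneg (le_max_right _ _) (hP a b))
  rw [pow_succ, Matrix.mul_apply, Matrix.mul_apply, ← Finset.sum_sub_distrib]
  refine Finset.sum_le_sum fun a _ => ?_
  rw [← sub_mul]
  exact mul_le_mul_of_nonneg_right (le_max_left _ _) (hP a b)

end Excess

/-! ### Gluing two flagged chains into a maximal coupling. -/

section Coupling

variable {S : Type} [MeasurableSpace S]

theorem IsMarkovChain.comp [MeasurableSingletonClass S] {Ω Ω' : Type} [MeasurableSpace Ω]
    [MeasurableSpace Ω'] {μ : Measure Ω} {ρ : Measure Ω'} {P : Matrix S S ℝ} {x : S}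
    {X : ℕ → Ω' → S} (h : IsMarkovChain ρ P x X) {φ : Ω → Ω'} (hφ : MeasurePreserving φ μ ρ) :
    IsMarkovChain μ P x fun n ω => X n (φ ω) where
  measurable n := (h.measurable n).comp hφ.measurable
  init := hφ.quasiMeasurePreserving.ae h.init
  markov n a := by
    have hm : ∀ n, MeasurableSet {ω | ∀ i ≤ n, X i ω = a i} := fun n => by
      have : {ω | ∀ i ≤ n, X i ω = a i} = ⋂ i ∈ Set.Iic n, X i ⁻¹' {a i} := by
        ext ω; simp
      rw [this]
      exact MeasurableSet.biInter (Set.to_countable _) fun i _ =>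
        h.measurable i (measurableSet_singleton _)
    have e : ∀ n, μ.real {ω | ∀ i ≤ n, X i (φ ω) = a i} = ρ.real {ω | ∀ i ≤ n, X i ω = a i} :=
      fun n => hφ.measureReal_preimage (hm n).nullMeasurableSet
    rw [e, e, h.markov]

/-- Draw the common image, then the two points conditionally independently given it. -/
theorem exists_glue {E F : Type} [MeasurableSpace E] [StandardBorelSpace E] [Nonempty E]
    [MeasurableSpace F] {f g : E → F} (hf : Measurable f) (ρ ρ' : Measure E)
    [IsProbabilityMeasure ρ] [IsProbabilityMeasure ρ'] (h : ρ.map f = ρ'.map g) :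
    ∃ μ : Measure (F × E × E), IsProbabilityMeasure μ ∧
      μ.map (fun p => (p.1, p.2.1)) = ρ.map (fun ω => (f ω, ω)) ∧
      μ.map (fun p => (p.1, p.2.2)) = ρ'.map (fun ω => (g ω, ω)) := by
  have hm := Measure.isProbabilityMeasure_map (μ := ρ) hf.aemeasurable
  refine ⟨(ρ.map f) ⊗ₘ (condDistrib id f ρ ×ₖ condDistrib id g ρ'), inferInstance, ?_, ?_⟩
  · have e : (fun p : F × E × E => (p.1, p.2.1)) = Prod.map id Prod.fst := rfl
    rw [e, ← Measure.compProd_map measurable_fst, ← Kernel.fst_eq, Kernel.fst_prod,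
      compProd_map_condDistrib measurable_id.aemeasurable]
    rfl
  · have e : (fun p : F × E × E => (p.1, p.2.2)) = Prod.map id Prod.snd := rfl
    rw [e, ← Measure.compProd_map measurable_snd, ← Kernel.snd_eq, Kernel.snd_prod, h,
      compProd_map_condDistrib measurable_id.aemeasurable]
    rfl

variable [Fintype S] [MeasurableSingletonClass S]

theorem exists_excess_flagged [DecidableEq S] {P : Matrix S S ℝ} (hP : ∀ a b, 0 ≤ P a b)
    (hP1 : ∀ a, ∑ b, P a b = 1) {x y : S} (hxy : x ≠ y) :
    ∃ ρ : Measure (ℕ → S × Bool), IsProbabilityMeasure ρ ∧ (∀ᵐ ω ∂ρ, ω 0 = (x, false)) ∧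
      (∀ n G, IsPrefixSet n G → ∀ a b, (∀ ω ∈ G, (ω n).1 = a) →
        ρ.real (G ∩ {ω | (ω (n + 1)).1 = b}) = ρ.real G * P a b) ∧
      ∀ n a, ρ.real (unflagged S n ∩ {ω | (ω n).1 = a}) = excess P x y n a := by
  refine exists_flagged hP hP1 x (fun n a => le_max_right _ _) (fun a => ?_) (excess_succ_le hP x y)
  rw [excess, pow_zero, Matrix.one_apply, Matrix.one_apply]
  by_cases hx : x = a
  · subst hx
    simp [hxy.symm]
  · rw [Set.indicator_of_notMem (by simpa using Ne.symm hx), if_neg hx]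
    split_ifs <;> norm_num

/-- Flag both chains so that the unflagged laws are the two excesses. These have equal mass, and
their difference evolves by `P`, so the fluxes into the flagged state agree; the hidden paths then
have the same law and can be glued. From the first flag on the chains coincide; before it they live
on disjoint supports, so they cannot have met. The tail is thus bounded by the total variation
distance. -/
theorem exists_coupling [DecidableEq S] {P : Matrix S S ℝ} (hP : ∀ a b, 0 ≤ P a b)
    (hP1 : ∀ a, ∑ b, P a b = 1) {x y : S} (hxy : x ≠ y) :
    ∃ (Ω : Type) (_ : MeasurableSpace Ω) (μ : Measure Ω) (_ : IsProbabilityMeasure μ)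
      (X Y : ℕ → Ω → S), IsCoupling μ P x y X Y ∧
      ∀ t : ℕ, μ {ω | (t : ℕ∞) < couplingTime X Y ω} ≤ ENNReal.ofReal (∑ z, excess P x y t z) := by
  obtain ⟨ρ, hρ, h0, hM, hA⟩ := exists_excess_flagged hP hP1 hxy
  obtain ⟨ρ', hρ', h0', hM', hB⟩ := exists_excess_flagged hP hP1 hxy.symm
  have hlaw : ρ.map (hide x) = ρ'.map (hide x) := by
    refine hide_law_eq h0 h0' hM hM' hA hB (fun n => ?_) fun n b => ?_
    · rw [← sub_eq_zero, ← Finset.sum_sub_distrib]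
      simp only [excess_sub]
      rw [Finset.sum_sub_distrib, pow_stochastic hP1, pow_stochastic hP1, sub_self]
    · have e1 := excess_sub P x y (n + 1) b
      have e2 : ∑ a, excess P x y n a * P a b - ∑ a, excess P y x n a * P a b =
          (P ^ (n + 1)) x b - (P ^ (n + 1)) y b := by
        rw [pow_succ, Matrix.mul_apply, Matrix.mul_apply, ← Finset.sum_sub_distrib,
          ← Finset.sum_sub_distrib]
        refine Finset.sum_congr rfl fun a _ => ?_
        rw [← sub_mul, ← sub_mul, excess_sub]
      linarith
  have hne : Nonempty (ℕ → S × Bool) := ⟨fun _ => (x, false)⟩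
  obtain ⟨μ, hμ, hμ1, hμ2⟩ := exists_glue (measurable_hide x) ρ ρ' hlaw
  have mh : Measurable fun ω : ℕ → S × Bool => (hide x ω, ω) :=
    (measurable_hide x).prodMk measurable_id
  have mp1 : MeasurePreserving (fun p : (ℕ → S × Bool) × (ℕ → S × Bool) × (ℕ → S × Bool) => p.2.1)
      μ ρ := ⟨by fun_prop, by
    have := congrArg (Measure.map Prod.snd) hμ1
    rw [Measure.map_map measurable_snd (by fun_prop), Measure.map_map measurable_snd mh] at this
    exact this.trans Measure.map_id⟩
  have mp2 : MeasurePreserving (fun p : (ℕ → S × Bool) × (ℕ → S × Bool) × (ℕ → S × Bool) => p.2.2)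
      μ ρ' := ⟨by fun_prop, by
    have := congrArg (Measure.map Prod.snd) hμ2
    rw [Measure.map_map measurable_snd (by fun_prop), Measure.map_map measurable_snd mh] at this
    exact this.trans Measure.map_id⟩
  have hQ : ∀ ρ : Measure (ℕ → S × Bool), ∀ᵐ q ∂(ρ.map fun ω => (hide x ω, ω)), ∀ n,
      hide x q.2 n = q.1 n := by
    intro ρ
    rw [ae_all_iff]
    intro n
    have hm : MeasurableSet {q : (ℕ → S × Bool) × (ℕ → S × Bool) | hide x q.2 n = q.1 n} := by
      have h2 : Measurable fun q : (ℕ → S × Bool) × (ℕ → S × Bool) => (hide x q.2 n, q.1 n) :=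
        (((measurable_pi_apply n).comp (measurable_hide x)).comp measurable_snd).prodMk
          ((measurable_pi_apply n).comp measurable_fst)
      exact h2 (MeasurableSet.of_discrete (s := {e | e.1 = e.2}))
    rw [ae_map_iff mh.aemeasurable hm]
    exact Eventually.of_forall fun ω => rfl
  have hq1 : ∀ᵐ p ∂μ, ∀ n, hide x p.2.1 n = p.1 n := by
    have := hQ ρ
    rw [← hμ1] at this
    exact ae_of_ae_map (by fun_prop) this
  have hq2 : ∀ᵐ p ∂μ, ∀ n, hide x p.2.2 n = p.1 n := by
    have := hQ ρ'
    rw [← hμ2] at this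
    exact ae_of_ae_map (by fun_prop) this
  have hnull : ∀ (ρ : Measure (ℕ → S × Bool)) [IsProbabilityMeasure ρ] (A : ℕ → S → ℝ),
      (∀ n a, ρ.real (unflagged S n ∩ {ω | (ω n).1 = a}) = A n a) →
      ∀ᵐ ω ∂ρ, ∀ n a, A n a = 0 → ω ∈ unflagged S n → (ω n).1 ≠ a := by
    intro ρ _ A hA
    rw [ae_all_iff]
    intro n
    rw [ae_all_iff]
    intro a
    by_cases h : A n a = 0
    · have h1 := hA n a
      rw [h, measureReal_eq_zero_iff] at h1
      filter_upwards [measure_eq_zero_iff_ae_notMem.1 h1] with ω hω _ hu ha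
      exact hω ⟨hu, ha⟩
    · exact Eventually.of_forall fun ω h' => absurd h' h
  have hn1 := mp1.quasiMeasurePreserving.ae (hnull ρ _ hA)
  have hn2 := mp2.quasiMeasurePreserving.ae (hnull ρ' _ hB)
  have hu : ∀ᵐ p ∂μ, ∀ n, p.2.1 ∉ unflagged S n → (p.2.1 n).1 = (p.2.2 n).1 := by
    filter_upwards [hq1, hq2] with p h1 h2 n hn
    have e := (h1 n).trans (h2 n).symm
    have hn' : p.2.2 ∉ unflagged S n := by
      rwa [← hide_snd_eq_false (s := x), ← e, hide_snd_eq_false]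
    rw [hide_of_notMem x hn, hide_of_notMem x hn'] at e
    exact (Prod.ext_iff.1 e).1
  refine ⟨_, inferInstance, μ, hμ, fun n p => (p.2.1 n).1, fun n p => (p.2.2 n).1,
    ⟨(isMarkovChain_of_flagged h0 hM).comp mp1, (isMarkovChain_of_flagged h0' hM').comp mp2, ?_⟩,
    fun t => ?_⟩
  -- An unflagged time `k` after a meeting would make the meeting unflagged too, at a state where
  -- one of the excesses vanishes.
  · filter_upwards [hq1, hq2, hn1, hn2, hu] with p h1 h2 h3 h4 h5 n hn k hk
    refine h5 k fun hk' => ?_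
    have u1 : p.2.1 ∈ unflagged S n := unflagged_anti hk hk'
    have u2 : p.2.2 ∈ unflagged S n := by
      rw [← hide_snd_eq_false (s := x), h2 n, ← h1 n, hide_snd_eq_false]
      exact u1
    rcases excess_eq_zero_or P x y n (p.2.1 n).1 with h | h
    · exact h3 n _ h u1 rfl
    · exact h4 n _ h u2 hn.symm
  · rw [← measureReal_unflagged hA, ofReal_measureReal,
      ← mp1.measure_preimage (isPrefixSet_unflagged t).measurableSet.nullMeasurableSet]
    refine measure_mono_ae ?_
    filter_upwards [hu] with p hp ht
    by_contra hn
    have h1 : couplingTime (fun n p => (p.2.1 n).1) (fun n p => (p.2.2 n).1) p ≤ (t : ℕ∞) :=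
      iInf₂_le t (hp t hn)
    exact absurd ht (not_lt.2 h1)

end Coupling

end RWRedistribution

namespace RWRedistribution

/-! ### The chain with symmetric parity redistribution -/

section Rate

theorem trans_nonneg {N : ℕ} {ν : PMF (State N)} (x y : State N) : 0 ≤ trans N ν ν x y := by
  unfold trans
  split_ifs <;> positivity

theorem sum_toReal_eq_one {N : ℕ} (ν : PMF (State N)) : ∑ z, (ν z).toReal = 1 := by
  rw [← ENNReal.toReal_sum fun z _ => ν.apply_ne_top z, ← tsum_fintype (L := .unconditional _),
    ν.tsum_coe, ENNReal.toReal_one]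

theorem trans_sum {N : ℕ} {ν : PMF (State N)} (hN : 2 < N) (hν : ParitySupport N ν) (x : State N) :
    ∑ y, trans N ν ν x y = 1 := by
  have h := congrFun (trans_mulVec hN hν 1) x
  rw [avg_one (sum_toReal_eq_one ν)] at h
  simp only [Matrix.mulVec, dotProduct, Pi.one_apply, mul_one, Pi.smul_apply, Pi.add_apply,
    smul_eq_mul] at h
  rw [h]
  norm_num

variable {m : ℕ}

theorem isParityWeight_toReal {ν : PMF (State (4 * m))} (hν : ParitySupport (4 * m) ν) :
    IsParityWeight m fun z => (ν z).toReal := by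
  have hs : ∀ z, (ν z).toReal ≠ 0 → z ∈ ν.support := fun z hz => by
    rw [PMF.mem_support_iff]
    intro h
    exact hz (by rw [h, ENNReal.toReal_zero])
  exact ⟨fun z => ENNReal.toReal_nonneg, sum_toReal_eq_one ν, fun z hz => (hν z (hs z hz)).1,
    fun z hz => (hν z (hs z hz)).2.1, fun z hz => (hν z (hs z hz)).2.2⟩

/-- The survival function of the sum of three exit times. -/
noncomputable def survThree (m : ℕ) : ℕ → ℝ :=
  convAdd (surv m 0) (convAdd (surv m 0) (surv m 0))

theorem survThree_nonneg (m t : ℕ) : 0 ≤ survThree m t := by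
  rw [survThree, ← walksLaw_three]
  exact measureReal_nonneg

theorem survThree_le_pow (m : ℕ) {ρ : ℝ} (hρ : (1 + rootV m 0) / 2 < ρ) :
    ∃ K, ∀ t, survThree m t ≤ K * ρ ^ t := by
  rw [survThree, convAdd_surv_eq, convAdd_surv_eq, surv_eq]
  have hm : ∀ i < m, rootV m i ∈ Set.Icc (-1 : ℝ) 1 := fun i _ => rootV_mem m i
  have hr : ∀ i < m, (1 + rootV m i) / 2 < ρ := fun i hi => by
    have := rootV_le hi
    linarith
  exact geoAdds_le_pow m hm hr (geoAdds_le_pow m hm hr (geoAdds_le_pow m hm hr ⟨0, by simp⟩))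

theorem heat_eq_sum {N : ℕ} {ν : PMF (State N)} (hN : 2 < N) (hν : ParitySupport N ν)
    (A : Finset (State N)) (t : ℕ) (x : State N) :
    heat (fun z => (ν z).toReal) ((A : Set (State N)).indicator 1) t x =
      ∑ z ∈ A, (trans N ν ν ^ t) x z := by
  classical
  rw [heat_eq_pow_mulVec hN hν]
  simp [Matrix.mulVec, dotProduct, Set.indicator_apply, Finset.sum_ite_mem]

theorem sum_sub_sum_le {ν : PMF (State (4 * m))} (hm : 0 < m) (hν : ParitySupport (4 * m) ν)
    (A : Finset (State (4 * m))) {x y : State (4 * m)} (hxy : Even ((x : ℕ) + y)) (t : ℕ) :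
    ∑ z ∈ A, (trans (4 * m) ν ν ^ t) x z - ∑ z ∈ A, (trans (4 * m) ν ν ^ t) y z ≤
      survThree m t := by
  rw [← heat_eq_sum (by omega) hν, ← heat_eq_sum (by omega) hν]
  exact heat_sub_le hm (isParityWeight_toReal hν)
    (fun z => Set.indicator_nonneg (fun _ _ => zero_le_one) z)
    (fun z => Set.indicator_le_self' (fun _ _ => zero_le_one) z) hxy t

theorem sum_excess_eq {S : Type} [Fintype S] [DecidableEq S] (P : Matrix S S ℝ) (x y : S) (t : ℕ) :
    ∃ A : Finset S, ∑ z, excess P x y t z = ∑ z ∈ A, (P ^ t) x z - ∑ z ∈ A, (P ^ t) y z := by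
  classical
  refine ⟨Finset.univ.filter fun z => (P ^ t) y z < (P ^ t) x z, ?_⟩
  rw [← Finset.sum_sub_distrib, Finset.sum_filter]
  refine Finset.sum_congr rfl fun z _ => ?_
  rw [excess]
  split_ifs with h
  · exact max_eq_left (by linarith)
  · exact max_eq_right (by linarith)

theorem exists_dominated_coupling {ν : PMF (State (4 * m))} (hm : 0 < m)
    (hν : ParitySupport (4 * m) ν) {x y : State (4 * m)} (hne : x ≠ y)
    (hxy : Even ((x : ℕ) + y)) :
    ∃ (Ω : Type) (_ : MeasurableSpace Ω) (μ : Measure Ω) (_ : IsProbabilityMeasure μ)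
      (X Y : ℕ → Ω → State (4 * m)), IsCoupling μ (trans (4 * m) ν ν) x y X Y ∧
        DominatedByCopies μ (couplingTime X Y) 3 (2 * m) := by
  obtain ⟨Ω, _, μ, hμ, X, Y, hXY, hτ⟩ :=
    exists_coupling trans_nonneg (trans_sum (by omega) hν) hne
  refine ⟨Ω, _, μ, hμ, X, Y, hXY, fun t => (hτ t).trans ?_⟩
  obtain ⟨A, hA⟩ := sum_excess_eq (trans (4 * m) ν ν) x y t
  rw [hA, ← ofReal_measureReal, walksLaw_three]
  exact ENNReal.ofReal_le_ofReal (sum_sub_sum_le hm hν A hxy t)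

/-! ### The rate of convergence -/

theorem abs_heat_sub_le {w f : State (4 * m) → ℝ} (hm : 0 < m) (hw : IsParityWeight m w)
    (hf0 : ∀ x, 0 ≤ f x) (hf1 : ∀ x, f x ≤ 1) {x y : State (4 * m)} (hxy : Even ((x : ℕ) + y))
    (t : ℕ) : |heat w f t x - heat w f t y| ≤ survThree m t := by
  have h1 := heat_sub_le hm hw hf0 hf1 hxy t
  have h2 := heat_sub_le hm hw hf0 hf1 (x := y) (y := x) (by rwa [add_comm]) t
  rw [← survThree] at h1 h2
  rw [abs_le]
  constructor <;> linarith

/-- One step turns the difference across parity classes into a quarter of `(g 1 - ∑ w g) + (g 2 - g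
0)`, and each bracket compares points of equal parity because `w` charges odd points only. -/
theorem abs_heat_one_sub_zero_le {w f : State (4 * m) → ℝ} (hm : 0 < m) (hw : IsParityWeight m w)
    (hf0 : ∀ x, 0 ≤ f x) (hf1 : ∀ x, f x ≤ 1) (t : ℕ) :
    |heat w f (t + 1) ⟨1, by omega⟩ - heat w f (t + 1) ⟨0, by omega⟩| ≤ survThree m t := by
  set g := heat w f t with hg
  have e1 := bext_heat_succ w f t (u := 2) (by norm_num) (by push_cast; omega)
  have e0 := bext_heat_succ w f t (u := 1) (by norm_num) (by push_cast; omega)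
  rw [bext_of_mem w _ ⟨1, by omega⟩ (by norm_num), bext_of_mem w _ ⟨0, by omega⟩ (by norm_num),
    bext_of_mem w _ ⟨1, by omega⟩ (by norm_num), bext_of_mem w _ ⟨2, by omega⟩ (by norm_num),
    ← hg] at e1
  rw [bext_of_mem w _ ⟨0, by omega⟩ (by norm_num), bext_of_notMem w _ (by norm_num),
    bext_of_mem w _ ⟨0, by omega⟩ (by norm_num), bext_of_mem w _ ⟨1, by omega⟩ (by norm_num),
    ← hg] at e0
  have h1 : |g ⟨1, by omega⟩ - ∑ z, w z * g z| ≤ survThree m t := by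
    have : g ⟨1, by omega⟩ - ∑ z, w z * g z = ∑ z, w z * (g ⟨1, by omega⟩ - g z) := by
      simp only [mul_sub, Finset.sum_sub_distrib, ← Finset.sum_mul, hw.sum, one_mul]
    rw [this]
    refine (Finset.abs_sum_le_sum_abs _ _).trans ?_
    rw [← one_mul (survThree m t), ← hw.sum, Finset.sum_mul]
    refine Finset.sum_le_sum fun z _ => ?_
    rw [abs_mul, abs_of_nonneg (hw.nonneg z)]
    by_cases hz : w z = 0
    · simp [hz]
    · refine mul_le_mul_of_nonneg_left (abs_heat_sub_le hm hw hf0 hf1 ?_ t) (hw.nonneg z)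
      have := hw.odd z hz
      simp only
      rw [add_comm]
      exact this.add_one
  have h2 : |g ⟨2, by omega⟩ - g ⟨0, by omega⟩| ≤ survThree m t :=
    abs_heat_sub_le hm hw hf0 hf1 (by simp) t
  rw [e1, e0]
  rw [abs_le] at *
  constructor <;> linarith [h1.1, h1.2, h2.1, h2.2]

theorem heat_sub_le_of_any {w f : State (4 * m) → ℝ} (hm : 0 < m) (hw : IsParityWeight m w)
    (hf0 : ∀ x, 0 ≤ f x) (hf1 : ∀ x, f x ≤ 1) (t : ℕ) (x y : State (4 * m)) :
    heat w f (t + 1) x - heat w f (t + 1) y ≤ 2 * survThree m (t + 1) + survThree m t := by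
  have hc := abs_le.1 (abs_heat_one_sub_zero_le hm hw hf0 hf1 t)
  have hs := survThree_nonneg m (t + 1)
  have hs' := survThree_nonneg m t
  have he : ∀ x : State (4 * m), Even (x : ℕ) →
      |heat w f (t + 1) x - heat w f (t + 1) ⟨0, by omega⟩| ≤ survThree m (t + 1) := fun x hx =>
    abs_heat_sub_le hm hw hf0 hf1 (by simpa using hx) _
  have ho : ∀ x : State (4 * m), Odd (x : ℕ) →
      |heat w f (t + 1) x - heat w f (t + 1) ⟨1, by omega⟩| ≤ survThree m (t + 1) := fun x hx =>
    abs_heat_sub_le hm hw hf0 hf1 (by simpa using hx.add_one) _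
  rcases Nat.even_or_odd (x : ℕ) with hx | hx <;> rcases Nat.even_or_odd (y : ℕ) with hy | hy
  · have a := abs_le.1 (he x hx); have b := abs_le.1 (he y hy); linarith [a.1, a.2, b.1, b.2]
  · have a := abs_le.1 (he x hx); have b := abs_le.1 (ho y hy); linarith [a.1, a.2, b.1, b.2, hc.1]
  · have a := abs_le.1 (ho x hx); have b := abs_le.1 (he y hy); linarith [a.1, a.2, b.1, b.2, hc.2]
  · have a := abs_le.1 (ho x hx); have b := abs_le.1 (ho y hy); linarith [a.1, a.2, b.1, b.2]

theorem rootV_zero (m : ℕ) : (1 + rootV m 0) / 2 = lam (2 * m) := by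
  rw [rootV, lam]
  push_cast
  rw [show (2 * 0 + 1) * Real.pi = Real.pi by ring]
  ring

theorem maxTvDist_le {ν : PMF (State (4 * m))} (hm : 0 < m) (hν : ParitySupport (4 * m) ν) {ρ : ℝ}
    (hρ0 : 0 < ρ) (hρ : lam (2 * m) < ρ) :
    ∃ K, ∀ t, maxTvDist (trans (4 * m) ν ν) (t + 1) ≤ K * ρ ^ (t + 1) := by
  rw [← rootV_zero] at hρ
  obtain ⟨K, hK⟩ := survThree_le_pow m hρ
  -- The term `K / ρ` absorbs the contribution at time `t` into `ρ ^ (t + 1)`.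
  refine ⟨2 * K + K / ρ, fun t => ?_⟩
  refine ciSup_le fun x => ciSup_le fun y => ciSup_le fun A => ?_
  rw [← heat_eq_sum (by omega) hν, ← heat_eq_sum (by omega) hν]
  refine (heat_sub_le_of_any hm (isParityWeight_toReal hν)
    (fun z => Set.indicator_nonneg (fun _ _ => zero_le_one) z)
    (fun z => Set.indicator_le_self' (fun _ _ => zero_le_one) z) t x y).trans ?_
  have h1 := hK (t + 1)
  have h2 := hK t
  have h3 : (2 * K + K / ρ) * ρ ^ (t + 1) = 2 * (K * ρ ^ (t + 1)) + K * ρ ^ t := by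
    rw [pow_succ]; field_simp
  linarith

theorem le_maxTvDist {N : ℕ} (P : Matrix (State N) (State N) ℝ) (t : ℕ) (x y : State N)
    (A : Finset (State N)) :
    ∑ z ∈ A, (P ^ t) x z - ∑ z ∈ A, (P ^ t) y z ≤ maxTvDist P t := by
  refine le_trans ?_ (le_ciSup (f := fun x => ⨆ y, tvDist P t x y)
    (Set.finite_range _).bddAbove x)
  refine le_trans ?_ (le_ciSup (f := fun y => tvDist P t x y) (Set.finite_range _).bddAbove y)
  exact le_ciSup (f := fun A : Finset (State N) => ∑ z ∈ A, (P ^ t) x z - ∑ z ∈ A, (P ^ t) y z)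
    (Set.finite_range _).bddAbove A

/-- Integrate `f` against the two excesses, each of total mass at most `maxTvDist P t`. -/
theorem mulVec_sub_le_maxTvDist {N : ℕ} {P : Matrix (State N) (State N) ℝ} (t : ℕ) (x y : State N)
    {f : State N → ℝ} {M : ℝ} (hf : ∀ z, |f z| ≤ M) :
    ((P ^ t).mulVec f) x - ((P ^ t).mulVec f) y ≤ 2 * M * maxTvDist P t := by
  have hM : 0 ≤ M := (abs_nonneg _).trans (hf x)
  obtain ⟨A, hA⟩ := sum_excess_eq P x y t
  obtain ⟨B, hB⟩ := sum_excess_eq P y x t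
  have h1 := le_maxTvDist P t x y A
  have h2 := le_maxTvDist P t y x B
  rw [← hA] at h1
  rw [← hB] at h2
  have h3 : ((P ^ t).mulVec f) x - ((P ^ t).mulVec f) y ≤
      M * (∑ z, excess P x y t z + ∑ z, excess P y x t z) := by
    simp only [Matrix.mulVec, dotProduct]
    rw [← Finset.sum_sub_distrib, ← Finset.sum_add_distrib, Finset.mul_sum]
    refine Finset.sum_le_sum fun z _ => ?_
    rw [← sub_mul, ← excess_sub]
    have a1 : 0 ≤ excess P x y t z := le_max_right _ _
    have a2 : 0 ≤ excess P y x t z := le_max_right _ _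
    obtain ⟨b1, b2⟩ := abs_le.1 (hf z)
    nlinarith
  nlinarith

/-- Sines and cosines of angle `θ` have period `4m + 2`, the distance between the outer points, so
the two boundary conditions reduce to one: the common value must be the `w`-mean. -/
theorem exists_eigenfunction {w : State (4 * m) → ℝ} (hm : 0 < m) (hw : IsParityWeight m w) :
    ∃ f : State (4 * m) → ℝ, avg w f = Real.cos (Real.pi / (2 * m + 1)) • f ∧
      ∃ x y, f y < f x := by
  set θ := Real.pi / (2 * m + 1) with hθ
  have hπ := Real.pi_pos
  have hm' : (1 : ℝ) ≤ m := by exact_mod_cast hm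
  have hθm : θ * (2 * m + 1) = Real.pi := div_mul_cancel₀ _ (by positivity)
  have hθ0 : 0 < θ := by positivity
  have hθπ : θ < Real.pi := by nlinarith
  -- The mean of `a cos + b sin` is `a (1 - b) + b a = a`, its value at both outer points.
  -- Positivity of `b` makes the function nonconstant: its values at the states `0` and `4m` differ
  -- by `2 b sin θ`.
  set a := ∑ z, w z * Real.sin (θ * ((z : ℕ) + 1)) with ha
  set b := 1 - ∑ z, w z * Real.cos (θ * ((z : ℕ) + 1)) with hb
  have hbpos : 0 < b := by
    have e : b = ∑ z, w z * (1 - Real.cos (θ * ((z : ℕ) + 1))) := by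
      simp only [mul_sub, mul_one, Finset.sum_sub_distrib, hw.sum, hb]
    obtain ⟨z, hz⟩ : ∃ z, w z ≠ 0 := by
      by_contra! h
      have := hw.sum
      simp [h] at this
    rw [e]
    refine Finset.sum_pos' (fun z _ => mul_nonneg (hw.nonneg z)
      (sub_nonneg.2 (Real.cos_le_one _))) ⟨z, Finset.mem_univ _,
      mul_pos ((hw.nonneg z).lt_of_ne hz.symm) (sub_pos.2 ?_)⟩
    refine (Real.cos_le_one _).lt_of_ne fun h => ?_
    have h3 : ((z : ℕ) : ℝ) + 3 ≤ 4 * m := by exact_mod_cast hw.add_three_le z hz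
    have hu : 0 < θ * ((z : ℕ) + 1) := by positivity
    have := (Real.cos_eq_one_iff_of_lt_of_lt (by linarith) (by nlinarith)).1 h
    linarith
  set φ : ℤ → ℝ := fun u => a * Real.cos (θ * u) + b * Real.sin (θ * u) with hφ
  set f : State (4 * m) → ℝ := fun x => φ ((x : ℕ) + 1) with hf
  have hwf : ∑ z, w z * f z = a := by
    have : ∀ z, w z * f z = a * (w z * Real.cos (θ * ((z : ℕ) + 1))) +
        b * (w z * Real.sin (θ * ((z : ℕ) + 1))) := by
      intro z
      simp only [hf, hφ]
      push_cast
      ring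
    simp only [this, Finset.sum_add_distrib, ← Finset.mul_sum]
    rw [← ha, show ∑ z, w z * Real.cos (θ * ((z : ℕ) + 1)) = 1 - b by rw [hb]; ring]
    ring
  have hext : ∀ u : ℤ, 0 ≤ u → u ≤ 4 * m + 2 → bext w f u = φ u := by
    intro u h1 h2
    by_cases h : 1 ≤ u ∧ u ≤ ((4 * m : ℕ) : ℤ) + 1
    · obtain ⟨x, hx⟩ := exists_state h.1 h.2
      rw [bext_of_mem w f x hx, hx]
    · rw [bext_of_notMem w f (by omega), hwf]
      push_cast at h
      rcases (show u = 0 ∨ u = 4 * m + 2 by omega) with rfl | rfl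
      · simp [hφ]
      · simp only [hφ]
        push_cast
        rw [show θ * (4 * (m : ℝ) + 2) = 2 * Real.pi by linarith]
        simp
  refine ⟨f, ?_, ⟨0, by omega⟩, ⟨4 * m, by omega⟩, ?_⟩
  · ext x
    have hx := x.2
    rw [avg_apply, hext _ (by omega) (by omega), hext _ (by omega) (by omega), Pi.smul_apply,
      smul_eq_mul]
    simp only [hf, hφ]
    push_cast
    rw [show θ * ((x : ℕ) : ℝ) = θ * ((x : ℕ) + 1) - θ by ring,
      show θ * (((x : ℕ) : ℝ) + 2) = θ * ((x : ℕ) + 1) + θ by ring, Real.cos_sub, Real.cos_add,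
      Real.sin_sub, Real.sin_add]
    ring
  · simp only [hf, hφ]
    push_cast
    have hs := Real.sin_pos_of_pos_of_lt_pi hθ0 hθπ
    rw [show θ * (4 * (m : ℝ) + 1) = 2 * Real.pi - θ by linarith, Real.cos_two_pi_sub,
      Real.sin_two_pi_sub, mul_one]
    nlinarith

theorem lam_pos (L : ℕ) (hL : 1 < L) : 0 < lam L := by
  have hL' : (1 : ℝ) < L := by exact_mod_cast hL
  have hπ := Real.pi_pos
  have : 0 < Real.cos (Real.pi / ((L : ℝ) + 1)) := by
    refine Real.cos_pos_of_mem_Ioo ⟨?_, ?_⟩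
    · have : 0 < Real.pi / ((L : ℝ) + 1) := by positivity
      linarith
    · rw [div_lt_div_iff₀ (by positivity) two_pos]
      nlinarith
  rw [lam]
  linarith

theorem exists_le_maxTvDist {ν : PMF (State (4 * m))} (hm : 0 < m) (hν : ParitySupport (4 * m) ν) :
    ∃ c, 0 < c ∧ ∀ t, c * lam (2 * m) ^ t ≤ maxTvDist (trans (4 * m) ν ν) t := by
  obtain ⟨f, hf, x, y, hxy⟩ := exists_eigenfunction hm (isParityWeight_toReal hν)
  have hP : (trans (4 * m) ν ν).mulVec f = lam (2 * m) • f := by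
    rw [trans_mulVec (by omega) hν, hf, lam]
    push_cast
    module
  have hPt : ∀ t, (trans (4 * m) ν ν ^ t).mulVec f = lam (2 * m) ^ t • f := by
    intro t
    induction t with
    | zero => simp
    | succ t ih =>
      rw [pow_succ, ← Matrix.mulVec_mulVec, hP, Matrix.mulVec_smul, ih, smul_smul, ← pow_succ']
  set M := ∑ z, |f z| + 1 with hM
  have hM0 : 0 < M := by positivity
  have hfM : ∀ z, |f z| ≤ M := fun z =>
    (Finset.single_le_sum (f := fun z => |f z|) (fun z _ => abs_nonneg _)
      (Finset.mem_univ z)).trans (by linarith)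
  refine ⟨(f x - f y) / (2 * M), div_pos (sub_pos.2 hxy) (by positivity), fun t => ?_⟩
  have h := mulVec_sub_le_maxTvDist (P := trans (4 * m) ν ν) t x y hfM
  rw [hPt, Pi.smul_apply, Pi.smul_apply, smul_eq_mul, smul_eq_mul, ← mul_sub] at h
  rw [div_mul_eq_mul_div, div_le_iff₀ (by positivity)]
  linarith

theorem tendsto_log_of_pow_bounds {d : ℕ → ℝ} {l c : ℝ} (hl : 0 < l) (hc : 0 < c)
    (hlow : ∀ t, c * l ^ t ≤ d t) (hup : ∀ ρ, l < ρ → ∃ K, ∀ t, d (t + 1) ≤ K * ρ ^ (t + 1)) :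
    Tendsto (fun t : ℕ => 1 / (t : ℝ) * Real.log (d t)) atTop (𝓝 (Real.log l)) := by
  have hpos : ∀ t, 0 < d t := fun t => lt_of_lt_of_le (by positivity) (hlow t)
  have hlim : ∀ a b : ℝ, Tendsto (fun t : ℕ => a / (t : ℝ) + b) atTop (𝓝 b) := fun a b => by
    simpa using (tendsto_const_div_atTop_nhds_zero_nat a).add_const b
  rw [tendsto_order]
  constructor
  · intro a ha
    filter_upwards [(hlim (Real.log c) (Real.log l)).eventually (lt_mem_nhds ha),
      eventually_gt_atTop 0] with t ht ht0
    refine ht.trans_le ?_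
    have ht0' : (0 : ℝ) < t := by exact_mod_cast ht0
    have h := Real.log_le_log (by positivity) (hlow t)
    rw [Real.log_mul hc.ne' (by positivity), Real.log_pow] at h
    have h2 : Real.log c / t + Real.log l = 1 / t * (Real.log c + t * Real.log l) := by
      field_simp
    rw [h2]
    exact mul_le_mul_of_nonneg_left h (by positivity)
  · intro a ha
    obtain ⟨b, hb1, hb2⟩ := exists_between ha
    have hρ : l < Real.exp b := by rwa [← Real.log_lt_iff_lt_exp hl]
    obtain ⟨K, hK⟩ := hup _ hρ
    have hK0 : 0 < K := by
      have := (hpos 1).trans_le (hK 0)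
      exact pos_of_mul_pos_left this (by positivity)
    filter_upwards [(hlim (Real.log K) b).eventually (gt_mem_nhds hb2),
      eventually_gt_atTop 0] with t ht ht0
    refine lt_of_le_of_lt ?_ ht
    obtain ⟨s, rfl⟩ := Nat.exists_eq_succ_of_ne_zero ht0.ne'
    have h := Real.log_le_log (hpos _) (hK s)
    rw [Real.log_mul hK0.ne' (by positivity), Real.log_pow, Real.log_exp] at h
    have ht0' : (0 : ℝ) < (s.succ : ℕ) := by exact_mod_cast ht0
    have h2 : Real.log K / (s.succ : ℕ) + b =
        1 / (s.succ : ℕ) * (Real.log K + (s.succ : ℕ) * b) := by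
      field_simp
    rw [h2]
    exact mul_le_mul_of_nonneg_left h (by positivity)

end Rate

end RWRedistribution

/-! ### Assembly of the coupling bound and the rate. -/

theorem mainTheorem4 (N : ℕ) (hN : 2 < N) (hN4 : 4 ∣ N)
    (ν : PMF (RWRedistribution.State N)) (hν : RWRedistribution.ParitySupport N ν) :
    (∀ x y : RWRedistribution.State N, (x : ℕ) < (y : ℕ) → Even ((y : ℕ) - (x : ℕ)) →
      (y : ℕ) - (x : ℕ) ≤ RWRedistribution.rho N ν ν →
      ∃ (Ω : Type) (_ : MeasurableSpace Ω) (μ : MeasureTheory.Measure Ω)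
        (_ : MeasureTheory.IsProbabilityMeasure μ)
        (X Y : ℕ → Ω → RWRedistribution.State N),
        RWRedistribution.IsCoupling μ (RWRedistribution.trans N ν ν) x y X Y ∧
        ∃ m : ℕ, m ≤ 5 ∧
          RWRedistribution.DominatedByCopies μ (RWRedistribution.couplingTime X Y) m (N / 2)) ∧
    Filter.Tendsto
      (fun t : ℕ => 1 / (t : ℝ) *
        Real.log (RWRedistribution.maxTvDist (RWRedistribution.trans N ν ν) t))
      Filter.atTop (nhds (Real.log (RWRedistribution.lam (N / 2)))) := by
  obtain ⟨m, rfl⟩ := hN4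
  have hm : 0 < m := by omega
  rw [show 4 * m / 2 = 2 * m by omega]
  refine ⟨fun x y hxy hev _ => ?_, ?_⟩
  · obtain ⟨k, hk⟩ := hev
    obtain ⟨Ω, _, μ, hμ, X, Y, hXY, hdom⟩ := RWRedistribution.exists_dominated_coupling hm hν
      (x := x) (y := y) (fun h => by simp [h] at hxy) ⟨x + k, by omega⟩
    exact ⟨Ω, _, μ, hμ, X, Y, hXY, 3, by norm_num, hdom⟩
  · obtain ⟨c, hc, hlow⟩ := RWRedistribution.exists_le_maxTvDist hm hν
    have hl := RWRedistribution.lam_pos (2 * m) (by omega)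
    exact RWRedistribution.tendsto_log_of_pow_bounds hl hc hlow fun ρ hρ =>
      RWRedistribution.maxTvDist_le hm hν (hl.trans hρ) hρ
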